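/- **Lemma (boundedness of the trilinear response operator).** Let $T,\rho>0$, let $\mathcal O=\{x'\in\mathbb R^3:|x'|<\rho\}$, $\mho=(0,T)\times\mathcal O$ and $\mathbb M_T=(0,T)\times\mathbb R^3$, and let $s\ge 4$ be an integer. Let $\Box=\partial_t^2-\Delta_{x'}$ on $\mathbb R\times\mathbb R^3$, let $V\in C^\infty(\mathbb R\times\mathbb R^3)$ be real-valued, and let $h\in C^\infty(\mathbb R\times\mathbb R^3)$ be nowhere zero (possibly complex-valued). For $\Omega\subset\mathbb R^3$ open let $$\mathscr H^s((0,T)\times\Omega)=\bigcap_{0\le k\le s}C^k\big((0,T);H^{s-k}(\Omega)\big)$$ denote the space of complex-valued functions $u$ in this intersection with finite norm $$\|u\|_{\mathscr H^s((0,T)\times\Omega)}=\max_{0\le j\le k\le s}\ \sup_{0<t<T}\|\partial_t^j u(t)\|_{H^{s-k}(\Omega)} .$$ Let $\mathscr H^s_0(\mho)\subset\mathscr H^s(\mho)$, with the norm of $\mathscr H^s(\mho)$, be the subspace of sources made within $\mho$, that is, of those $f\in\mathscr H^s(\mho)$ whose extension by zero to $\mathbb M_T$ belongs to $\mathscr H^s(\mathbb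 M_T)$. Then for all $f_{(1)},f_{(2)},f_{(3)}\in\mathscr H^s_0(\mho)$, extended by zero outside $\mho$, there are unique $u_{(1)},u_{(2)},u_{(3)},u_{(123)}\in\mathscr H^s(\mathbb M_T)$ which, extended by zero to $t\le 0$, solve $$(\Box+V)u_{(j)}=f_{(j)}\quad(j=1,2,3),\qquad (\Box+V)u_{(123)}=h\,u_{(1)}u_{(2)}u_{(3)}$$ on $(-\infty,T)\times\mathbb R^3$ in the sense of distributions. The map $$T_{V,h}:\ (f_{(1)},f_{(2)},f_{(3)})\longmapsto u_{(123)}|_{\mho}$$ is a bounded trilinear operator $\mathscr H^s_0(\mho)\times\mathscr H^s_0(\mho)\times\mathscr H^s_0(\mho)\to\mathscr H^s(\mho)$: its operator norm $$\|T_{V,h}\|=\sup\Big\{\|u_{(123)}\|_{\mathscr H^s(\mho)}:\ \|f_{(j)}\|_{\mathscr H^s(\mho)}=1,\ j=1,2,3\Big\}$$ is finite, and $\|T_{V,h}(f_{(1)},f_{(2)},f_{(3)})\|_{\mathscr H^s(\mho)}\le\|T_{V,h}\|\prod_{j=1}^3\|f_{(j)}\|_{\mathscr H^s(\mho)}$ for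 all sources in $\mathscr H^s_0(\mho)$. -/

import Mathlib

open MeasureTheory Set
open scoped ContDiff Laplacian

noncomputable section

/-- The space `ℝ³` with its Euclidean norm; Minkowski space is `ℝ × R3`, with points `(t, x')`. -/
abbrev R3 : Type := EuclideanSpace ℝ (Fin 3)

/-- The space `L²(Ω)` of complex-valued functions. -/
abbrev L2 (Ω : Set R3) : Type := Lp ℂ 2 (volume.restrict Ω)

/-- The partial derivatives of order at most `m`: a word `⟨n, w⟩` with `n ≤ m` stands for
`∂_{w 0} ∂_{w 1} ⋯ ∂_{w (n-1)}`. -/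
abbrev DerivWord (m : ℕ) : Type := Σ n : Fin (m + 1), (Fin n → Fin 3)

/-- The word of length zero, which stands for the function itself. -/
def emptyWord (m : ℕ) : DerivWord m := ⟨0, fun i => i.elim0⟩

/-- The classical partial derivative `∂_{w 0} ⋯ ∂_{w (n-1)} φ`. -/
def partialDeriv {n : ℕ} (w : Fin n → Fin 3) (φ : R3 → ℝ) (x : R3) : ℝ :=
  iteratedFDeriv ℝ n φ x (fun i => EuclideanSpace.single (w i) 1)

theorem integrable_partialDeriv_smul {Ω : Set R3} {n : ℕ} (w : Fin n → Fin 3) {φ : R3 → ℝ}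
    (hφ : ContDiff ℝ ∞ φ) (hc : HasCompactSupport φ) (g : L2 Ω) :
    Integrable (fun x => partialDeriv w φ x • g x) (volume.restrict Ω) := by
  have h1 : Continuous (partialDeriv w φ) :=
    ((hφ.continuous_iteratedFDeriv (m := n) (by exact_mod_cast le_top)).eval continuous_const)
  have h2 : HasCompactSupport (partialDeriv w φ) :=
    (hc.iteratedFDeriv (𝕜 := ℝ) n).comp_left
      (g := fun A : ContinuousMultilinearMap ℝ (fun _ : Fin n => R3) ℝ =>
        A (fun i => EuclideanSpace.single (w i) 1)) rfl
  exact ((Lp.memLp g).locallyIntegrable (by norm_num)).integrable_smul_left_of_hasCompactSupport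
    h1 h2

theorem integrable_test_smul {Ω : Set R3} {φ : R3 → ℝ}
    (hφ : ContDiff ℝ ∞ φ) (hc : HasCompactSupport φ) (g : L2 Ω) :
    Integrable (fun x => φ x • g x) (volume.restrict Ω) :=
  ((Lp.memLp g).locallyIntegrable (by norm_num)).integrable_smul_left_of_hasCompactSupport
    hφ.continuous hc

/-- The Sobolev space `H^m(Ω)`, `m ∈ ℕ`, through weak derivatives. An element is the family of
all weak derivatives of order at most `m` of an `L²(Ω)` function, all of them in `L²(Ω)`; the
norm is `(∑_{n ≤ m} ∑_{w : Fin n → Fin 3} ‖∂_w g‖²_{L²(Ω)})^{1/2}`. -/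
def SobolevSpace (Ω : Set R3) (m : ℕ) : Submodule ℂ (PiLp 2 (fun _ : DerivWord m => L2 Ω)) where
  carrier := {G | ∀ (w : DerivWord m) (φ : R3 → ℝ), ContDiff ℝ ∞ φ → HasCompactSupport φ →
    tsupport φ ⊆ Ω →
      ∫ x in Ω, partialDeriv w.2 φ x • G (emptyWord m) x =
        (-1 : ℝ) ^ (w.1 : ℕ) • ∫ x in Ω, φ x • G w x}
  zero_mem' := by
    intro w φ _ _ _
    have h0 : ((0 : L2 Ω) : R3 → ℂ) =ᵐ[volume.restrict Ω] 0 := Lp.coeFn_zero _ _ _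
    have h (ψ : R3 → ℝ) : ∫ x in Ω, ψ x • (0 : L2 Ω) x = 0 := by
      rw [integral_congr_ae (g := fun _ => (0 : ℂ)) (by filter_upwards [h0] with x hx; rw [hx]; simp)]
      simp
    simp only [PiLp.zero_apply, h, smul_zero]
  add_mem' := by
    intro F G hF hG w φ h1 h2 h3
    have h (a b : L2 Ω) (ψ : R3 → ℝ) (ha : Integrable (fun x => ψ x • a x) (volume.restrict Ω))
        (hb : Integrable (fun x => ψ x • b x) (volume.restrict Ω)) :
        ∫ x in Ω, ψ x • (a + b : L2 Ω) x =
          (∫ x in Ω, ψ x • a x) + ∫ x in Ω, ψ x • b x := by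
      rw [← integral_add ha hb]
      refine integral_congr_ae ?_
      filter_upwards [Lp.coeFn_add a b] with x hx
      rw [hx, Pi.add_apply, smul_add]
    simp only [PiLp.add_apply]
    rw [h _ _ _ (integrable_partialDeriv_smul _ h1 h2 _) (integrable_partialDeriv_smul _ h1 h2 _),
      h _ _ _ (integrable_test_smul h1 h2 _) (integrable_test_smul h1 h2 _),
      hF w φ h1 h2 h3, hG w φ h1 h2 h3, smul_add]
  smul_mem' := by
    intro c G hG w φ h1 h2 h3
    have h (a : L2 Ω) (ψ : R3 → ℝ) :
        ∫ x in Ω, ψ x • (c • a : L2 Ω) x = c * ∫ x in Ω, ψ x • a x := by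
      rw [← integral_const_mul]
      refine integral_congr_ae ?_
      filter_upwards [Lp.coeFn_smul c a] with x hx
      rw [hx, Pi.smul_apply, smul_eq_mul, mul_smul_comm]
    simp only [PiLp.smul_apply]
    rw [h, h, hG w φ h1 h2 h3, mul_smul_comm]

/-- The inclusion of `H^m(Ω)` into `L²(Ω)`. -/
def sobolevToL2 {Ω : Set R3} {m : ℕ} (G : SobolevSpace Ω m) : L2 Ω := G.1 (emptyWord m)

/-- For every integer `0 ≤ k ≤ s` the curve `u : (0,T) → L²(Ω)` is a `C^k` curve in `H^{s-k}(Ω)`,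
and its time derivatives of order at most `k` are bounded by `C` in the norm of `H^{s-k}(Ω)`,
uniformly on `(0,T)`. The curve `U` is the curve `u` seen in `H^{s-k}(Ω)`; only its values on
`(0,T)` matter. -/
def HBound (T : ℝ) (Ω : Set R3) (s : ℕ) (u : Ioo 0 T → L2 Ω) (C : ℝ) : Prop :=
  0 ≤ C ∧ ∀ k ≤ s, ∃ U : ℝ → SobolevSpace Ω (s - k),
    (∀ t : Ioo 0 T, sobolevToL2 (U t) = u t) ∧ ContDiffOn ℝ k U (Ioo 0 T) ∧
      ∀ j ≤ k, ∀ t ∈ Ioo 0 T, ‖iteratedDerivWithin j U (Ioo 0 T) t‖ ≤ C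

theorem HBound.zero (T : ℝ) (Ω : Set R3) (s : ℕ) : HBound T Ω s 0 0 := by
  refine ⟨le_rfl, fun k _ => ⟨fun _ => 0, fun _ => rfl, contDiffOn_const, fun j _ t _ => ?_⟩⟩
  rw [iteratedDerivWithin_const]
  split_ifs <;> simp

theorem HBound.add {T : ℝ} {Ω : Set R3} {s : ℕ} {u v : Ioo 0 T → L2 Ω} {C D : ℝ}
    (hu : HBound T Ω s u C) (hv : HBound T Ω s v D) : HBound T Ω s (u + v) (C + D) := by
  refine ⟨add_nonneg hu.1 hv.1, fun k hk => ?_⟩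
  obtain ⟨U, h1, h2, h3⟩ := hu.2 k hk
  obtain ⟨W, g1, g2, g3⟩ := hv.2 k hk
  refine ⟨U + W, fun t => ?_, h2.add g2, fun j hj t ht => ?_⟩
  · rw [Pi.add_apply u v, ← h1, ← g1]; rfl
  · rw [iteratedDerivWithin_add ht (uniqueDiffOn_Ioo 0 T)
      ((h2 t ht).of_le (by exact_mod_cast hj)) ((g2 t ht).of_le (by exact_mod_cast hj))]
    exact (norm_add_le _ _).trans (add_le_add (h3 j hj t ht) (g3 j hj t ht))

theorem HBound.smul {T : ℝ} {Ω : Set R3} {s : ℕ} {u : Ioo 0 T → L2 Ω} {C : ℝ}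
    (c : ℂ) (hu : HBound T Ω s u C) : HBound T Ω s (c • u) (‖c‖ * C) := by
  refine ⟨mul_nonneg (norm_nonneg c) hu.1, fun k hk => ?_⟩
  obtain ⟨U, h1, h2, h3⟩ := hu.2 k hk
  refine ⟨c • U, fun t => ?_, h2.const_smul c, fun j hj t ht => ?_⟩
  · rw [Pi.smul_apply c u, ← h1]; rfl
  · rw [iteratedDerivWithin_const_smul ht (uniqueDiffOn_Ioo 0 T) c
      ((h2 t ht).of_le (by exact_mod_cast hj)), norm_smul]
    exact mul_le_mul_of_nonneg_left (h3 j hj t ht) (norm_nonneg c)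

/-- The space `𝓗^s((0,T) × Ω) = ⋂_{0 ≤ k ≤ s} C^k((0,T); H^{s-k}(Ω))` of curves with finite norm,
an element being given by its curve `(0,T) → L²(Ω)`. -/
def WaveSpace (T : ℝ) (Ω : Set R3) (s : ℕ) : Submodule ℂ (Ioo 0 T → L2 Ω) where
  carrier := {u | ∃ C, HBound T Ω s u C}
  zero_mem' := ⟨0, HBound.zero T Ω s⟩
  add_mem' := by
    rintro u v ⟨C, hC⟩ ⟨D, hD⟩
    exact ⟨C + D, hC.add hD⟩
  smul_mem' := by
    rintro c u ⟨C, hC⟩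
    exact ⟨‖c‖ * C, hC.smul c⟩

/-- The norm of `𝓗^s((0,T) × Ω)`,
`‖u‖ = max_{0 ≤ j ≤ k ≤ s} sup_{t ∈ (0,T)} ‖∂_t^j u(t)‖_{H^{s-k}(Ω)}`,
written as the least number that bounds all these quantities. -/
def waveNorm {T : ℝ} {Ω : Set R3} {s : ℕ} (u : WaveSpace T Ω s) : ℝ :=
  sInf {C | HBound T Ω s u.1 C}

/-- `F : (0,T) → L²(ℝ³)` is the extension by zero of `f : (0,T) → L²(Ω)`. -/
def IsZeroExtension {T : ℝ} {Ω : Set R3} (f : Ioo 0 T → L2 Ω) (F : Ioo 0 T → L2 univ) : Prop :=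
  ∀ t, ∀ᵐ x, F t x = Ω.indicator (f t) x

theorem ae_of_ae_restrict_univ {p : R3 → Prop}
    (hp : ∀ᵐ x ∂(volume.restrict (univ : Set R3)), p x) : ∀ᵐ x, p x := by
  rwa [Measure.restrict_univ] at hp

theorem IsZeroExtension.zero {T : ℝ} {Ω : Set R3} :
    IsZeroExtension (0 : Ioo 0 T → L2 Ω) 0 := by
  intro t
  filter_upwards [ae_of_ae_restrict_univ (Lp.coeFn_zero ℂ 2 (volume.restrict (univ : Set R3))),
    ae_imp_of_ae_restrict (Lp.coeFn_zero ℂ 2 (volume.restrict Ω))] with x h1 h2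
  rw [Pi.zero_apply, Pi.zero_apply, h1]
  by_cases hx : x ∈ Ω
  · rw [indicator_of_mem hx, h2 hx]
  · rw [indicator_of_notMem hx]; rfl

theorem IsZeroExtension.add {T : ℝ} {Ω : Set R3} {f g : Ioo 0 T → L2 Ω} {F G : Ioo 0 T → L2 univ}
    (hf : IsZeroExtension f F) (hg : IsZeroExtension g G) : IsZeroExtension (f + g) (F + G) := by
  intro t
  filter_upwards [hf t, hg t, ae_of_ae_restrict_univ (Lp.coeFn_add (F t) (G t)),
    ae_imp_of_ae_restrict (Lp.coeFn_add (f t) (g t))] with x h1 h2 h3 h4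
  rw [Pi.add_apply, Pi.add_apply, h3, Pi.add_apply, h1, h2]
  by_cases hx : x ∈ Ω
  · rw [indicator_of_mem hx, indicator_of_mem hx, indicator_of_mem hx, h4 hx, Pi.add_apply]
  · rw [indicator_of_notMem hx, indicator_of_notMem hx, indicator_of_notMem hx, add_zero]

theorem IsZeroExtension.smul {T : ℝ} {Ω : Set R3} {f : Ioo 0 T → L2 Ω} {F : Ioo 0 T → L2 univ}
    (c : ℂ) (hf : IsZeroExtension f F) : IsZeroExtension (c • f) (c • F) := by
  intro t
  filter_upwards [hf t, ae_of_ae_restrict_univ (Lp.coeFn_smul c (F t)),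
    ae_imp_of_ae_restrict (Lp.coeFn_smul c (f t))] with x h1 h3 h4
  rw [Pi.smul_apply, Pi.smul_apply, h3, Pi.smul_apply, h1]
  by_cases hx : x ∈ Ω
  · rw [indicator_of_mem hx, indicator_of_mem hx, h4 hx, Pi.smul_apply]
  · rw [indicator_of_notMem hx, indicator_of_notMem hx, smul_zero]

/-- `g : (0,T) → L²(Ω)` is the restriction to `(0,T) × Ω` of `w : (0,T) → L²(ℝ³)`. -/
def IsRestriction {T : ℝ} {Ω : Set R3} (w : Ioo 0 T → L2 univ) (g : Ioo 0 T → L2 Ω) : Prop :=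
  ∀ t, ∀ᵐ x ∂(volume.restrict Ω), g t x = w t x

/-- The sources made within `(0,T) × Ω`: the elements of `𝓗^s((0,T) × Ω)` which, extended by zero
to `(0,T) × ℝ³`, lie in `𝓗^s((0,T) × ℝ³)`. -/
def SourceSpace (T : ℝ) (Ω : Set R3) (s : ℕ) : Submodule ℂ (WaveSpace T Ω s) where
  carrier := {f | ∃ F ∈ WaveSpace T univ s, IsZeroExtension f.1 F}
  zero_mem' := ⟨0, (WaveSpace T univ s).zero_mem, IsZeroExtension.zero⟩
  add_mem' := by
    rintro f g ⟨F, hF, hfF⟩ ⟨G, hG, hgG⟩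
    exact ⟨F + G, (WaveSpace T univ s).add_mem hF hG, IsZeroExtension.add hfF hgG⟩
  smul_mem' := by
    rintro c f ⟨F, hF, hfF⟩
    exact ⟨c • F, (WaveSpace T univ s).smul_mem c hF, IsZeroExtension.smul c hfF⟩

/-- The function on space-time, zero outside `(0,T) × Ω`, that a curve `(0,T) → L²(Ω)` defines.
For each time it is determined up to null sets of `x`. -/
def extendZero {T : ℝ} {Ω : Set R3} (u : Ioo 0 T → L2 Ω) (t : ℝ) (x : R3) : ℂ :=
  if ht : t ∈ Ioo 0 T then Ω.indicator (u ⟨t, ht⟩) x else 0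

/-- The d'Alembertian `□ φ = ∂_t² φ - Δ_{x'} φ`. -/
def dAlembertian (φ : ℝ × R3 → ℝ) (z : ℝ × R3) : ℝ :=
  iteratedDeriv 2 (fun t => φ (t, z.2)) z.1 - Δ (fun x => φ (z.1, x)) z.2

/-- The function `u` vanishes for `t ≤ 0` and solves `(□ + V) u = F` on `(-∞,T) × ℝ³` in the sense
of distributions. As `u` and `F` are determined only up to null sets at each time, they are
integrated over space first. -/
def IsWaveSolution (T : ℝ) (V : ℝ × R3 → ℝ) (F u : ℝ → R3 → ℂ) : Prop :=
  (∀ t ≤ 0, ∀ x, u t x = 0) ∧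
  ∀ φ : ℝ × R3 → ℝ, ContDiff ℝ ∞ φ → HasCompactSupport φ → tsupport φ ⊆ Iio T ×ˢ univ →
    ∫ t, ∫ x, (dAlembertian φ (t, x) + V (t, x) * φ (t, x)) • u t x = ∫ t, ∫ x, φ (t, x) • F t x

/-- The waves `u_{(1)}, u_{(2)}, u_{(3)}` and `w = u_{(123)}` in `𝓗^s((0,T) × ℝ³)`, all of them zero
for `t ≤ 0`, that the sources `f_{(1)}, f_{(2)}, f_{(3)}` generate:
`(□ + V) u_{(j)} = f_{(j)}` and `(□ + V) u_{(123)} = h u_{(1)} u_{(2)} u_{(3)}`. -/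
def AreGeneratedWaves {T : ℝ} {Ω : Set R3} {s : ℕ} (V : ℝ × R3 → ℝ) (h : ℝ × R3 → ℂ)
    (f : Fin 3 → SourceSpace T Ω s) (u : Fin 3 → WaveSpace T univ s) (w : WaveSpace T univ s) : Prop :=
  (∀ j, IsWaveSolution T V (extendZero (f j).1.1) (extendZero (u j).1)) ∧
  IsWaveSolution T V
    (fun t x => h (t, x) * (extendZero (u 0).1 t x * extendZero (u 1).1 t x *
      extendZero (u 2).1 t x))
    (extendZero w.1)

/-- The set `{‖A(f₁,f₂,f₃)‖ : ‖f₁‖ = ‖f₂‖ = ‖f₃‖ = 1}`, all norms being those of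
`𝓗^s((0,T) × Ω)`. -/
def unitValues {T : ℝ} {Ω : Set R3} {s : ℕ}
    (A : MultilinearMap ℂ (fun _ : Fin 3 => SourceSpace T Ω s) (WaveSpace T Ω s)) : Set ℝ :=
  {r | ∃ f : Fin 3 → SourceSpace T Ω s, (∀ j, waveNorm (f j).1 = 1) ∧ r = waveNorm (A f)}

/-- The operator norm `‖A‖ = sup {‖A(f₁,f₂,f₃)‖ : ‖f₁‖ = ‖f₂‖ = ‖f₃‖ = 1}`. -/
def trilinearOpNorm {T : ℝ} {Ω : Set R3} {s : ℕ}
    (A : MultilinearMap ℂ (fun _ : Fin 3 => SourceSpace T Ω s) (WaveSpace T Ω s)) : ℝ :=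
  sSup (unitValues A)

end

/-!
# The trilinear response operator of a wave equation with cubic interaction

The theorem combines the well-posedness of the linear equation `(□ + V) u = f` in `𝓗^s` with the fact
that `𝓗^s` is an algebra.

*Regularity.* On `(0,T) × ℝ³` the space `𝓗^s` is described by `Reg T s u C`: all mixed derivatives of
`u` in time and space of order at most `s` are continuous curves in `L²(ℝ³)`, bounded by `C`. For
sources in the ball this holds for the extension by zero with the bound that the source itself has,
because the derivatives of the extension are the extensions of the derivatives
(`HBound.reg_of_isZeroExtension`); conversely, regular curves restrict to elements of `𝓗^s`
(`exists_hBound`).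

*Existence.* If `V` is replaced by a smooth function `W` with compact support, Duhamel's formula with
the propagator `S(t) = sin(t√-Δ)/√-Δ`, a bounded Fourier multiplier, turns the equation into a Volterra
equation in `L²(ℝ³)`, which is a contraction in a weighted norm (`volterra_exists`). The same Volterra
equation in the graph of the weak derivative `∂ᵢ` shows that `∂ᵢu` is the mild solution of the
differentiated equation (`IsMild.isD_space`); the time derivatives come from
`∂ₜu = ∫ cos((t - τ)√-Δ) (f - W u)(τ) dτ` and `∂ₜ²u = Δu + f - W u`. By induction on `s` the solution is
as regular as the source (`exists_isMild_reg`).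

*Uniqueness and finite speed.* The energy with a smooth weight supported in a backward cone
satisfies Gronwall's inequality, as its flux through the cone has a sign (`WaveJet.eq_zero_of_weight`).
Only a bound of the potential on the cone enters. So solutions are unique for the unbounded potential
`V` (`StrongSol.unique`), and waves of sources in the ball stay in a larger ball
(`StrongSol.eq_zero_of_source`). There `V` and `h` may be cut off without changing the equations, which
removes the assumption that they have compact support (`exists_strongSol`).

*The meaning of the equation.* In the class `Reg T 2`, extending by zero to `t ≤ 0` and solving in the
sense of distributions on `(-∞,T) × ℝ³` amounts to the pointwise equation on `(0,T)` with zero initial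
values (`StrongSol.isWaveSolution`, `StrongSol.of_isWaveSolution`): integration by parts in time
produces the initial values as boundary terms (`WaveJet.weak_sub`).

*Products.* By the embedding `H²(ℝ³) ⊂ L^∞(ℝ³)` and the Leibniz rule, products of curves with `s ≥ 3`
derivatives have `s` derivatives (`exists_reg_prod`). Hence `h u₁ u₂ u₃` is an admissible source for the
last wave, and composing the estimates bounds `u₁₂₃` by a constant times the product of the bounds of
the sources (`exists_isResponse`). Trilinearity follows from uniqueness, and the estimates for the norm
follow by scaling (`bounded_of_hBound`).
-/

open Filter Topology

noncomputable section

/-! ### Multiplication operators and the bilinear pairing on `L²(ℝ³)` -/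

/-- Lebesgue measure on `ℝ³`, written in the form in which it enters `L2 univ`. -/
abbrev leb3 : Measure R3 := volume.restrict univ

/-- The space `L²(ℝ³)`. -/
abbrev L2R3 : Type := L2 (univ : Set R3)

theorem leb3_eq : leb3 = volume := Measure.restrict_univ

theorem ae_leb3 {p : R3 → Prop} : (∀ᵐ x ∂leb3, p x) ↔ ∀ᵐ x, p x := by rw [leb3_eq]

/-- `a` is a measurable function on `ℝ³` that is essentially bounded by `M`. -/
structure EssBdd (a : R3 → ℂ) (M : ℝ) : Prop where
  meas : AEStronglyMeasurable a leb3
  nonneg : 0 ≤ M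
  bound : ∀ᵐ x ∂leb3, ‖a x‖ ≤ M

theorem EssBdd.memLp_mul {a : R3 → ℂ} {M : ℝ} (ha : EssBdd a M) {g : R3 → ℂ}
    (hg : MemLp g 2 leb3) : MemLp (fun x => a x * g x) 2 leb3 := by
  refine hg.of_le_mul (c := M) (ha.meas.mul hg.1) ?_
  filter_upwards [ha.bound] with x hx
  rw [norm_mul]
  exact mul_le_mul_of_nonneg_right hx (norm_nonneg _)

theorem norm_le_of_ae_le_mul {f g : L2R3} {M : ℝ} (hM : 0 ≤ M)
    (h : ∀ᵐ x ∂leb3, ‖f x‖ ≤ M * ‖g x‖) : ‖f‖ ≤ M * ‖g‖ := by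
  have h1 : ∀ᵐ x ∂leb3, ‖f x‖ ≤ ‖((M : ℂ) • g : L2R3) x‖ := by
    filter_upwards [h, Lp.coeFn_smul (M : ℂ) g] with x hx h2
    rw [h2, Pi.smul_apply, norm_smul, Complex.norm_real, Real.norm_of_nonneg hM]
    exact hx
  have h2 := Lp.norm_le_norm_of_ae_le h1
  rwa [norm_smul, Complex.norm_real, Real.norm_of_nonneg hM] at h2

open Classical in
/-- Multiplication by the essentially bounded function `a`, as an operator on `L²(ℝ³)`;
it is zero if `a` is not essentially bounded. -/
def mulB (a : R3 → ℂ) : L2R3 →L[ℂ] L2R3 :=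
  if h : ∃ M, EssBdd a M then
    LinearMap.mkContinuous
      { toFun := fun g => (h.choose_spec.memLp_mul (Lp.memLp g)).toLp
        map_add' := fun f g => by
          rw [← MemLp.toLp_add]
          refine MemLp.toLp_congr _ _ ?_
          filter_upwards [Lp.coeFn_add f g] with x hx
          rw [hx]
          simp [mul_add]
        map_smul' := fun c g => by
          rw [RingHom.id_apply, ← MemLp.toLp_const_smul]
          refine MemLp.toLp_congr _ _ ?_
          filter_upwards [Lp.coeFn_smul c g] with x hx
          rw [hx]
          simp [mul_left_comm] }
      h.choose (fun g => by
        refine norm_le_of_ae_le_mul h.choose_spec.nonneg ?_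
        filter_upwards [h.choose_spec.bound,
          (h.choose_spec.memLp_mul (Lp.memLp g)).coeFn_toLp] with x h1 h2
        change ‖((h.choose_spec.memLp_mul (Lp.memLp g)).toLp : L2R3) x‖ ≤ _
        rw [h2, norm_mul]
        exact mul_le_mul_of_nonneg_right h1 (norm_nonneg _))
  else 0

theorem EssBdd.coe_mulB {a : R3 → ℂ} {M : ℝ} (ha : EssBdd a M) (g : L2R3) :
    mulB a g =ᵐ[leb3] fun x => a x * g x := by
  have h : ∃ M, EssBdd a M := ⟨M, ha⟩
  have : mulB a g = (h.choose_spec.memLp_mul (Lp.memLp g)).toLp := by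
    simp only [mulB, dif_pos h]
    rfl
  rw [this]
  exact MemLp.coeFn_toLp _

theorem EssBdd.norm_mulB_le {a : R3 → ℂ} {M : ℝ} (ha : EssBdd a M) (g : L2R3) :
    ‖mulB a g‖ ≤ M * ‖g‖ := by
  refine norm_le_of_ae_le_mul ha.nonneg ?_
  filter_upwards [ha.bound, ha.coe_mulB g] with x h1 h2
  rw [h2, norm_mul]
  exact mul_le_mul_of_nonneg_right h1 (norm_nonneg _)

theorem EssBdd.opNorm_mulB_le {a : R3 → ℂ} {M : ℝ} (ha : EssBdd a M) : ‖mulB a‖ ≤ M :=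
  ContinuousLinearMap.opNorm_le_bound _ ha.nonneg ha.norm_mulB_le

theorem EssBdd.of_continuous {a : R3 → ℂ} {M : ℝ} (h : Continuous a) (hM : ∀ x, ‖a x‖ ≤ M) :
    EssBdd a M :=
  ⟨h.aestronglyMeasurable, (norm_nonneg _).trans (hM 0), .of_forall hM⟩

theorem EssBdd.add {a b : R3 → ℂ} {M N : ℝ} (ha : EssBdd a M) (hb : EssBdd b N) :
    EssBdd (a + b) (M + N) := by
  refine ⟨ha.meas.add hb.meas, add_nonneg ha.nonneg hb.nonneg, ?_⟩
  filter_upwards [ha.bound, hb.bound] with x h1 h2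
  exact (norm_add_le _ _).trans (add_le_add h1 h2)

theorem EssBdd.const_smul {a : R3 → ℂ} {M : ℝ} (ha : EssBdd a M) (c : ℂ) :
    EssBdd (c • a) (‖c‖ * M) := by
  refine ⟨ha.meas.const_smul c, mul_nonneg (norm_nonneg _) ha.nonneg, ?_⟩
  filter_upwards [ha.bound] with x h1
  rw [Pi.smul_apply, norm_smul]
  exact mul_le_mul_of_nonneg_left h1 (norm_nonneg _)

theorem EssBdd.mono {a : R3 → ℂ} {M N : ℝ} (ha : EssBdd a M) (h : M ≤ N) : EssBdd a N :=
  ⟨ha.meas, ha.nonneg.trans h, ha.bound.mono fun _ hx => hx.trans h⟩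

theorem EssBdd.congr {a b : R3 → ℂ} {M : ℝ} (ha : EssBdd a M) (h : a =ᵐ[leb3] b) :
    EssBdd b M := by
  refine ⟨ha.meas.congr h, ha.nonneg, ?_⟩
  filter_upwards [ha.bound, h] with x h1 h2
  rwa [← h2]

theorem mulB_add {a b : R3 → ℂ} {M N : ℝ} (ha : EssBdd a M) (hb : EssBdd b N) :
    mulB (a + b) = mulB a + mulB b := by
  ext1 g
  refine Lp.ext ?_
  rw [_root_.add_apply]
  filter_upwards [ha.coe_mulB g, hb.coe_mulB g, (ha.add hb).coe_mulB g,
    Lp.coeFn_add (mulB a g) (mulB b g)] with x h1 h2 h3 h4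
  rw [h3, h4, Pi.add_apply, Pi.add_apply, h1, h2, add_mul]

theorem mulB_smul {a : R3 → ℂ} {M : ℝ} (ha : EssBdd a M) (c : ℂ) :
    mulB (c • a) = c • mulB a := by
  ext1 g
  refine Lp.ext ?_
  rw [_root_.smul_apply]
  filter_upwards [ha.coe_mulB g, (ha.const_smul c).coe_mulB g,
    Lp.coeFn_smul c (mulB a g)] with x h1 h2 h3
  rw [h2, h3, Pi.smul_apply, Pi.smul_apply, h1, smul_eq_mul, smul_eq_mul, mul_assoc]

theorem mulB_sub {a b : R3 → ℂ} {M N : ℝ} (ha : EssBdd a M) (hb : EssBdd b N) :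
    mulB (a - b) = mulB a - mulB b := by
  have h := mulB_add ha (hb.const_smul (-1))
  rw [mulB_smul hb] at h
  rw [sub_eq_add_neg, sub_eq_add_neg, ← neg_one_smul ℂ b, h, neg_one_smul]

/-- The bilinear pairing `(f, g) ↦ ∫ f g` on `L²(ℝ³)`. -/
def pair : L2R3 →L[ℂ] L2R3 →L[ℂ] ℂ :=
  have : ENNReal.HolderConjugate 2 2 := ⟨by rw [ENNReal.inv_two_add_inv_two, inv_one]⟩
  (ContinuousLinearMap.mul ℂ ℂ).lpPairing leb3 2 2

theorem pair_apply (f g : L2R3) : pair f g = ∫ x, f x * g x ∂leb3 := by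
  have : ENNReal.HolderConjugate 2 2 := ⟨by rw [ENNReal.inv_two_add_inv_two, inv_one]⟩
  exact (ContinuousLinearMap.mul ℂ ℂ).lpPairing_eq_integral (μ := leb3) (p := 2) (q := 2) f g

theorem pair_eq_inner (f g : L2R3) : pair f g = inner ℂ (star f) g := by
  rw [pair_apply, L2.inner_def]
  refine integral_congr_ae ?_
  filter_upwards [Lp.coeFn_star f] with x hx
  rw [hx]
  simp [mul_comm]

theorem pair_mulB {a : R3 → ℂ} {M : ℝ} (ha : EssBdd a M) (f g : L2R3) :
    pair (mulB a f) g = pair f (mulB a g) := by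
  rw [pair_apply, pair_apply]
  refine integral_congr_ae ?_
  filter_upwards [ha.coe_mulB f, ha.coe_mulB g] with x h1 h2
  rw [h1, h2]
  ring

open Classical in
/-- The class in `L²(ℝ³)` of a square integrable function; zero if it is not square integrable. -/
def toL2 (a : R3 → ℂ) : L2R3 := if h : MemLp a 2 leb3 then h.toLp else 0

theorem coe_toL2 {a : R3 → ℂ} (h : MemLp a 2 leb3) : toL2 a =ᵐ[leb3] a := by
  rw [toL2, dif_pos h]
  exact h.coeFn_toLp

theorem toL2_add {a b : R3 → ℂ} (ha : MemLp a 2 leb3) (hb : MemLp b 2 leb3) :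
    toL2 (a + b) = toL2 a + toL2 b := by
  refine Lp.ext ?_
  filter_upwards [coe_toL2 ha, coe_toL2 hb, coe_toL2 (ha.add hb), Lp.coeFn_add (toL2 a) (toL2 b)]
    with x h1 h2 h3 h4
  rw [h3, h4, Pi.add_apply, Pi.add_apply, h1, h2]

theorem toL2_smul {a : R3 → ℂ} (ha : MemLp a 2 leb3) (c : ℂ) :
    toL2 (c • a) = c • toL2 a := by
  refine Lp.ext ?_
  filter_upwards [coe_toL2 ha, coe_toL2 (ha.const_smul c), Lp.coeFn_smul c (toL2 a)]
    with x h1 h2 h3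
  rw [h2, h3, Pi.smul_apply, Pi.smul_apply, h1]

theorem mulB_toL2 {a b : R3 → ℂ} {M : ℝ} (ha : EssBdd a M) (hb : MemLp b 2 leb3) :
    mulB a (toL2 b) = toL2 (a * b) := by
  refine Lp.ext ?_
  filter_upwards [ha.coe_mulB (toL2 b), coe_toL2 hb, coe_toL2 (a := a * b) (ha.memLp_mul hb)]
    with x h1 h2 h3
  rw [h1, h3, h2, Pi.mul_apply]

/-! ### Test functions and weak derivatives -/

/-- Smooth functions on `ℝ³` with compact support. -/
structure IsTest {F : Type*} [NormedAddCommGroup F] [NormedSpace ℝ F] (φ : R3 → F) : Prop where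
  smooth : ContDiff ℝ ∞ φ
  cpt : HasCompactSupport φ

/-- The unit vector `eᵢ` of `ℝ³`. -/
abbrev e3 (i : Fin 3) : R3 := EuclideanSpace.single i 1

/-- The classical partial derivative `∂ᵢ`. -/
def pd {F : Type*} [NormedAddCommGroup F] [NormedSpace ℝ F] (i : Fin 3) (φ : R3 → F) (x : R3) : F :=
  fderiv ℝ φ x (e3 i)

section Test

variable {F : Type*} [NormedAddCommGroup F] [NormedSpace ℝ F]

theorem contDiff_pd {φ : R3 → F} (h : ContDiff ℝ ∞ φ) (i : Fin 3) : ContDiff ℝ ∞ (pd i φ) :=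
  (h.fderiv_right (m := ∞) (by simp)).clm_apply contDiff_const

theorem IsTest.pd {φ : R3 → F} (h : IsTest φ) (i : Fin 3) : IsTest (pd i φ) :=
  ⟨contDiff_pd h.smooth i, h.cpt.fderiv_apply (𝕜 := ℝ) (e3 i)⟩

end Test

/-- A real-valued function, seen as a complex-valued one. -/
def ofR (φ : R3 → ℝ) (x : R3) : ℂ := (φ x : ℂ)

theorem IsTest.memLp {φ : R3 → ℂ} (h : IsTest φ) : MemLp φ 2 leb3 :=
  h.smooth.continuous.memLp_of_hasCompactSupport h.cpt

theorem IsTest.ofReal {φ : R3 → ℝ} (h : IsTest φ) : IsTest (ofR φ) :=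
  ⟨Complex.ofRealCLM.contDiff.comp h.smooth, h.cpt.comp_left (g := ((↑) : ℝ → ℂ)) rfl⟩

theorem IsTest.re {φ : R3 → ℂ} (h : IsTest φ) : IsTest (fun x => (φ x).re) :=
  ⟨Complex.reCLM.contDiff.comp h.smooth, h.cpt.comp_left (g := Complex.re) rfl⟩

theorem IsTest.im {φ : R3 → ℂ} (h : IsTest φ) : IsTest (fun x => (φ x).im) :=
  ⟨Complex.imCLM.contDiff.comp h.smooth, h.cpt.comp_left (g := Complex.im) rfl⟩

theorem IsTest.mul_smooth {φ a : R3 → ℂ} (h : IsTest φ) (ha : ContDiff ℝ ∞ a) :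
    IsTest (fun x => φ x * a x) :=
  ⟨h.smooth.mul ha, h.cpt.mul_right⟩

theorem pd_ofReal {φ : R3 → ℝ} (h : ContDiff ℝ ∞ φ) (i : Fin 3) (x : R3) :
    pd i (ofR φ) x = ofR (pd i φ) x := by
  have := (Complex.ofRealCLM.hasFDerivAt.comp x
    (h.differentiable (by simp) x).hasFDerivAt).fderiv
  rw [pd, show ofR φ = Complex.ofRealCLM ∘ φ from rfl, this]
  rfl

theorem pd_clm {F G : Type*} [NormedAddCommGroup F] [NormedSpace ℝ F] [NormedAddCommGroup G]
    [NormedSpace ℝ G] (L : F →L[ℝ] G) {φ : R3 → F} (h : ContDiff ℝ ∞ φ) (i : Fin 3) (x : R3) :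
    pd i (fun x => L (φ x)) x = L (pd i φ x) := by
  have := (L.hasFDerivAt.comp x (h.differentiable (by simp) x).hasFDerivAt).fderiv
  rw [pd, show (fun x => L (φ x)) = L ∘ φ from rfl, this]
  rfl

theorem pd_mul {φ a : R3 → ℂ} (h : ContDiff ℝ ∞ φ) (ha : ContDiff ℝ ∞ a) (i : Fin 3) (x : R3) :
    pd i (fun x => φ x * a x) x = pd i φ x * a x + φ x * pd i a x := by
  have := ((h.differentiable (by simp) x).hasFDerivAt.mul
    (ha.differentiable (by simp) x).hasFDerivAt).fderiv
  rw [pd, show (fun x => φ x * a x) = φ * a from rfl, this]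
  simp [pd]
  ring

/-- The pairing `g ↦ ∫ φ g` with a fixed square integrable function `φ`. -/
def tpair (φ : R3 → ℂ) : L2R3 →L[ℂ] ℂ := pair (toL2 φ)

theorem tpair_apply {φ : R3 → ℂ} (h : MemLp φ 2 leb3) (g : L2R3) :
    tpair φ g = ∫ x, φ x * g x ∂leb3 := by
  rw [tpair, pair_apply]
  refine integral_congr_ae ?_
  filter_upwards [coe_toL2 h] with x hx
  rw [hx]

theorem tpair_ofReal {φ : R3 → ℝ} (h : IsTest φ) (g : L2R3) :
    tpair (ofR φ) g = ∫ x in univ, φ x • g x := by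
  rw [tpair_apply h.ofReal.memLp]
  simp [ofR]

theorem tpair_mulB {φ a : R3 → ℂ} {M : ℝ} (h : MemLp φ 2 leb3) (ha : EssBdd a M) (g : L2R3) :
    tpair φ (mulB a g) = tpair (fun x => φ x * a x) g := by
  rw [tpair, ← pair_mulB ha, mulB_toL2 ha h, tpair]
  congr 3
  ext x
  simp [mul_comm]

theorem tpair_add {φ ψ : R3 → ℂ} (h : MemLp φ 2 leb3) (h' : MemLp ψ 2 leb3) :
    tpair (fun x => φ x + ψ x) = tpair φ + tpair ψ := by
  rw [tpair, show (fun x => φ x + ψ x) = φ + ψ from rfl, toL2_add h h', map_add]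
  rfl

theorem tpair_smul {φ : R3 → ℂ} (h : MemLp φ 2 leb3) (c : ℂ) :
    tpair (fun x => c * φ x) = c • tpair φ := by
  rw [tpair, show (fun x => c * φ x) = c • φ from rfl, toL2_smul h, map_smul]
  rfl

theorem L2R3.locallyIntegrable (g : L2R3) : LocallyIntegrable g leb3 :=
  (Lp.memLp g).locallyIntegrable (by norm_num)

/-- Test functions separate the points of `L²(ℝ³)`. -/
theorem eq_zero_of_tpair {g : L2R3}
    (h : ∀ φ : R3 → ℝ, IsTest φ → tpair (ofR φ) g = 0) : g = 0 := by
  refine Lp.ext ?_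
  have h1 := ae_eq_zero_of_integral_contDiff_smul_eq_zero g.locallyIntegrable
    (fun φ h1 h2 => by rw [← tpair_ofReal ⟨h1, h2⟩]; exact h φ ⟨h1, h2⟩)
  filter_upwards [h1, Lp.coeFn_zero ℂ 2 leb3] with x h1 h2
  rw [h1, h2, Pi.zero_apply]

theorem eq_of_tpair {f g : L2R3}
    (h : ∀ φ : R3 → ℝ, IsTest φ → tpair (ofR φ) f = tpair (ofR φ) g) :
    f = g := by
  rw [← sub_eq_zero]
  refine eq_zero_of_tpair fun φ hφ => ?_
  rw [map_sub, h φ hφ, sub_self]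

/-- `g'` is the weak derivative `∂ᵢ g`. -/
def HasWeakDeriv (i : Fin 3) (g g' : L2R3) : Prop :=
  ∀ φ : R3 → ℝ, IsTest φ →
    tpair (ofR (pd i φ)) g = - tpair (ofR φ) g'

theorem HasWeakDeriv.unique {i : Fin 3} {g a b : L2R3} (ha : HasWeakDeriv i g a)
    (hb : HasWeakDeriv i g b) : a = b :=
  eq_of_tpair fun φ hφ => by rw [← neg_inj, ← ha φ hφ, ← hb φ hφ]

theorem HasWeakDeriv.zero (i : Fin 3) : HasWeakDeriv i 0 0 := fun φ _ => by simp

theorem HasWeakDeriv.add {i : Fin 3} {f g f' g' : L2R3} (hf : HasWeakDeriv i f f')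
    (hg : HasWeakDeriv i g g') : HasWeakDeriv i (f + g) (f' + g') := fun φ hφ => by
  rw [map_add, map_add, hf φ hφ, hg φ hφ, neg_add]

theorem HasWeakDeriv.smul {i : Fin 3} {f f' : L2R3} (c : ℂ) (hf : HasWeakDeriv i f f') :
    HasWeakDeriv i (c • f) (c • f') := fun φ hφ => by
  rw [map_smul, map_smul, hf φ hφ, smul_neg]

theorem HasWeakDeriv.neg {i : Fin 3} {f f' : L2R3} (hf : HasWeakDeriv i f f') :
    HasWeakDeriv i (-f) (-f') := fun φ hφ => by rw [map_neg, map_neg, hf φ hφ]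

theorem HasWeakDeriv.sub {i : Fin 3} {f g f' g' : L2R3} (hf : HasWeakDeriv i f f')
    (hg : HasWeakDeriv i g g') : HasWeakDeriv i (f - g) (f' - g') := by
  rw [sub_eq_add_neg, sub_eq_add_neg]
  exact hf.add hg.neg

/-- Complex-valued test functions may be used in the definition of the weak derivative. -/
theorem HasWeakDeriv.complex {i : Fin 3} {g g' : L2R3} (h : HasWeakDeriv i g g') {φ : R3 → ℂ}
    (hφ : IsTest φ) : tpair (pd i φ) g = - tpair φ g' := by
  have key : ∀ ψ : R3 → ℂ, IsTest ψ → tpair ψ = tpair (ofR fun x => (ψ x).re) +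
      Complex.I • tpair (ofR fun x => (ψ x).im) := fun ψ hψ => by
    rw [← tpair_smul hψ.im.ofReal.memLp, ← tpair_add hψ.re.ofReal.memLp
      (hψ.im.ofReal.memLp.const_mul _)]
    congr 1
    ext x
    rw [mul_comm]
    exact (Complex.re_add_im _).symm
  rw [key _ (hφ.pd i), key φ hφ]
  have h1 := h _ hφ.re
  have h2 := h _ hφ.im
  have e1 : ∀ x, pd i (fun x => (φ x).re) x = (pd i φ x).re := pd_clm Complex.reCLM hφ.smooth i
  have e2 : ∀ x, pd i (fun x => (φ x).im) x = (pd i φ x).im := pd_clm Complex.imCLM hφ.smooth i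
  rw [funext e1] at h1
  rw [funext e2] at h2
  simp only [_root_.add_apply, _root_.smul_apply, h1, h2]
  simp
  ring

/-- The Leibniz rule for the product of a function with a weak derivative and a smooth one. -/
theorem HasWeakDeriv.mulB_smooth {i : Fin 3} {g g' : L2R3} (h : HasWeakDeriv i g g')
    {a : R3 → ℂ} {M N : ℝ} (ha : ContDiff ℝ ∞ a) (hM : EssBdd a M) (hN : EssBdd (pd i a) N) :
    HasWeakDeriv i (mulB a g) (mulB (pd i a) g + mulB a g') := fun φ hφ => by
  have h1 := h.complex (hφ.ofReal.mul_smooth ha)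
  have h2 : pd i (fun x => ofR φ x * a x) =
      fun x => ofR (pd i φ) x * a x + ofR φ x * pd i a x := by
    ext x
    rw [pd_mul hφ.ofReal.smooth ha, pd_ofReal hφ.smooth]
  rw [h2, tpair_add ((hφ.pd i).ofReal.mul_smooth ha).memLp
    (hφ.ofReal.mul_smooth (contDiff_pd ha i)).memLp, _root_.add_apply] at h1
  rw [map_add, tpair_mulB (hφ.pd i).ofReal.memLp hM, tpair_mulB hφ.ofReal.memLp hM,
    tpair_mulB hφ.ofReal.memLp hN, eq_sub_of_add_eq h1]
  ring

theorem isClosed_hasWeakDeriv (i : Fin 3) : IsClosed {p : L2R3 × L2R3 | HasWeakDeriv i p.1 p.2} := by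
  have : {p : L2R3 × L2R3 | HasWeakDeriv i p.1 p.2} = ⋂ (φ : R3 → ℝ) (_ : IsTest φ),
      {p : L2R3 × L2R3 | tpair (ofR (pd i φ)) p.1 = - tpair (ofR φ) p.2} := by
    ext p
    simp [HasWeakDeriv]
  rw [this]
  refine isClosed_iInter fun φ => isClosed_iInter fun _ => isClosed_eq ?_ ?_
  · exact (tpair _).continuous.comp continuous_fst
  · exact ((tpair _).continuous.comp continuous_snd).neg

/-! ### Curves in `L²(ℝ³)` -/

/-- The time derivative of a curve commutes with weak space derivatives. -/
theorem HasWeakDeriv.of_hasDerivAt {i : Fin 3} {u v : ℝ → L2R3} {u' v' : L2R3} {t : ℝ}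
    (h : ∀ᶠ s in 𝓝 t, HasWeakDeriv i (u s) (v s)) (hu : HasDerivAt u u' t)
    (hv : HasDerivAt v v' t) : HasWeakDeriv i u' v' := fun φ hφ => by
  have h1 := ((tpair (ofR (pd i φ))).restrictScalars ℝ).hasFDerivAt.comp_hasDerivAt t hu
  have h2 := (((tpair (ofR φ)).restrictScalars ℝ).hasFDerivAt.comp_hasDerivAt t hv).neg
  refine h1.unique (h2.congr_of_eventuallyEq ?_)
  filter_upwards [h] with s hs
  exact hs φ hφ

theorem tpair_hasDerivAt (φ : R3 → ℂ) {u : ℝ → L2R3} {u' : L2R3} {t : ℝ} (hu : HasDerivAt u u' t) :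
    HasDerivAt (fun s => tpair φ (u s)) (tpair φ u') t :=
  ((tpair φ).restrictScalars ℝ).hasFDerivAt.comp_hasDerivAt t hu

/-- A weakly differentiable curve whose derivative is continuous is differentiable. -/
theorem hasDerivAt_of_tpair {a b : ℝ} {p q : ℝ → L2R3} (hq : ContinuousOn q (Ioo a b))
    (h : ∀ φ : R3 → ℝ, IsTest φ → ∀ t ∈ Ioo a b,
      HasDerivAt (fun s => tpair (ofR φ) (p s)) (tpair (ofR φ) (q t)) t)
    {t : ℝ} (ht : t ∈ Ioo a b) : HasDerivAt p (q t) t := by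
  -- `p` differs from the primitive `Q` of `q` by a constant, since all pairings do
  set Q : ℝ → L2R3 := fun s => ∫ r in t..s, q r with hQ
  have hd : ∀ s ∈ Ioo a b, HasDerivAt Q (q s) s := fun s hs => by
    have hsub : uIcc t s ⊆ Ioo a b := (convex_Ioo a b).ordConnected.uIcc_subset ht hs
    refine intervalIntegral.integral_hasDerivAt_right (hq.mono hsub).intervalIntegrable ?_
      (hq.continuousAt (isOpen_Ioo.mem_nhds hs))
    exact hq.stronglyMeasurableAtFilter isOpen_Ioo s hs
  have hconst : ∀ s ∈ Ioo a b, p s - Q s = p t := fun s hs => by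
    refine eq_of_tpair fun φ hφ => ?_
    have h0 : ∀ r ∈ Ioo a b, HasDerivWithinAt
        (fun r => tpair (ofR φ) (p r - Q r)) 0 (Ioo a b) r := fun r hr => by
      have := (h φ hφ r hr).sub (tpair_hasDerivAt (ofR φ) (hd r hr))
      simp only [sub_self] at this
      simp only [map_sub]
      exact this.hasDerivWithinAt
    have h1 := (convex_Ioo a b).norm_image_sub_le_of_norm_hasDerivWithin_le (C := 0) h0
      (fun _ _ => by simp) ht hs
    rw [zero_mul, norm_le_zero_iff, sub_eq_zero] at h1
    rw [h1]
    simp [hQ]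
  have : p =ᶠ[𝓝 t] fun s => p t + Q s := by
    filter_upwards [isOpen_Ioo.mem_nhds ht] with s hs
    rw [← hconst s hs, sub_add_cancel]
  exact ((hd t ht).const_add (p t)).congr_of_eventuallyEq this

/-! ### Smooth compactly supported coefficients on space-time -/

/-- Smooth compactly supported functions on space-time. -/
structure IsCoeff (W : ℝ × R3 → ℂ) : Prop where
  smooth : ContDiff ℝ ∞ W
  cpt : HasCompactSupport W

/-- The directional derivative of a function on space-time. -/
def dirD (v : ℝ × R3) (W : ℝ × R3 → ℂ) (z : ℝ × R3) : ℂ := fderiv ℝ W z v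

/-- The restriction of a function on space-time to time `t`. -/
def slice (W : ℝ × R3 → ℂ) (t : ℝ) (x : R3) : ℂ := W (t, x)

theorem IsCoeff.dirD {W : ℝ × R3 → ℂ} (h : IsCoeff W) (v : ℝ × R3) : IsCoeff (dirD v W) :=
  ⟨(h.smooth.fderiv_right (m := ∞) (by simp)).clm_apply contDiff_const,
    h.cpt.fderiv_apply (𝕜 := ℝ) v⟩

theorem IsCoeff.exists_bound {W : ℝ × R3 → ℂ} (h : IsCoeff W) :
    ∃ M, ∀ t, EssBdd (slice W t) M := by
  obtain ⟨M, hM⟩ := h.cpt.exists_bound_of_continuous h.smooth.continuous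
  exact ⟨M, fun t => .of_continuous (h.smooth.continuous.comp (by fun_prop)) fun x => hM (t, x)⟩

theorem contDiff_slice {W : ℝ × R3 → ℂ} (h : ContDiff ℝ ∞ W) (t : ℝ) : ContDiff ℝ ∞ (slice W t) :=
  h.comp (contDiff_const.prodMk contDiff_id)

theorem pd_slice {W : ℝ × R3 → ℂ} (h : ContDiff ℝ ∞ W) (i : Fin 3) (t : ℝ) :
    pd i (slice W t) = slice (dirD (0, e3 i) W) t := by
  ext x
  have h1 : HasFDerivAt (fun x : R3 => (t, x)) (ContinuousLinearMap.inr ℝ ℝ R3) x := by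
    exact hasFDerivAt_prodMk_right t x
  have := ((h.differentiable (by simp) (t, x)).hasFDerivAt.comp x h1).fderiv
  rw [pd, show slice W t = W ∘ fun x => (t, x) from rfl, this]
  simp [slice, dirD]

theorem hasDerivAt_slice {W : ℝ × R3 → ℂ} (h : ContDiff ℝ ∞ W) (t : ℝ) (x : R3) :
    HasDerivAt (fun s => W (s, x)) (slice (dirD (1, 0) W) t x) t := by
  have h1 : HasFDerivAt (fun s : ℝ => (s, x)) (ContinuousLinearMap.inl ℝ ℝ R3) t := by
    exact hasFDerivAt_prodMk_left t x
  have := ((h.differentiable (by simp) (t, x)).hasFDerivAt.comp t h1).hasDerivAt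
  simpa [slice, dirD, Function.comp_def] using this

/-- Multiplication by a smooth compactly supported function is differentiable in time in the
operator norm. -/
theorem IsCoeff.hasDerivAt_mulB {W : ℝ × R3 → ℂ} (h : IsCoeff W) (t : ℝ) :
    HasDerivAt (fun s => mulB (slice W s)) (mulB (slice (_root_.dirD (1, 0) W) t)) t := by
  obtain ⟨K, hK⟩ := ContDiff.lipschitzWith_of_hasCompactSupport (h.dirD (1, 0)).cpt
    (h.dirD (1, 0)).smooth (by simp)
  obtain ⟨M, hM⟩ := h.exists_bound
  obtain ⟨N, hN⟩ := (h.dirD (1, 0)).exists_bound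
  have hb : ∀ s x, ‖W (s, x) - W (t, x) - (s - t : ℝ) • slice (_root_.dirD (1, 0) W) t x‖
      ≤ (K : ℝ) * |s - t| * |s - t| := fun s x => by
    have h1 : ∀ r ∈ uIcc t s, HasDerivWithinAt
        (fun r => W (r, x) - r • slice (_root_.dirD (1, 0) W) t x)
        (slice (_root_.dirD (1, 0) W) r x - slice (_root_.dirD (1, 0) W) t x) (uIcc t s) r :=
      fun r _ => by
        have := (hasDerivAt_slice h.smooth r x).sub
          ((hasDerivAt_id r).smul_const (slice (_root_.dirD (1, 0) W) t x))
        rw [one_smul] at this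
        exact this.hasDerivWithinAt
    have h2 := (convex_uIcc t s).norm_image_sub_le_of_norm_hasDerivWithin_le
      (C := K * |s - t|) h1 (fun r hr => ?_) left_mem_uIcc right_mem_uIcc
    · convert! h2 using 2
      rw [sub_smul]
      ring
    · have h3 := hK.dist_le_mul (r, x) (t, x)
      rw [dist_eq_norm, Prod.dist_eq, dist_self, max_eq_left dist_nonneg, Real.dist_eq] at h3
      refine h3.trans (mul_le_mul_of_nonneg_left ?_ K.2)
      exact abs_sub_left_of_mem_uIcc hr
  rw [hasDerivAt_iff_isLittleO]
  refine Asymptotics.IsBigO.trans_isLittleO (g := fun s : ℝ => (s - t) * (s - t)) ?_ ?_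
  · refine Asymptotics.IsBigO.of_bound K (.of_forall fun s => ?_)
    rw [norm_mul, Real.norm_eq_abs, ← mul_assoc]
    have e1 : mulB (slice W s) - mulB (slice W t) - (s - t) • mulB (slice (_root_.dirD (1, 0) W) t)
        = mulB (slice W s - slice W t - ((s - t : ℝ) : ℂ) • slice (_root_.dirD (1, 0) W) t) := by
      have e2 : EssBdd (slice W s - slice W t) (M + ‖(-1 : ℂ)‖ * M) := by
        have := (hM s).add ((hM t).const_smul (-1))
        rwa [neg_one_smul, ← sub_eq_add_neg] at this
      rw [mulB_sub e2 ((hN t).const_smul _), mulB_sub (hM s) (hM t), mulB_smul (hN t)]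
      rfl
    rw [e1]
    refine EssBdd.opNorm_mulB_le (.of_continuous ?_ fun x => ?_)
    · exact ((contDiff_slice h.smooth s).continuous.sub (contDiff_slice h.smooth t).continuous).sub
        ((contDiff_slice (h.dirD (1, 0)).smooth t).continuous.const_smul _)
    · exact hb s x
  · have : (fun s : ℝ => (s - t) * (s - t)) =o[𝓝 t] fun s => (s - t) * (1 : ℝ) := by
      refine (Asymptotics.isBigO_refl _ _).mul_isLittleO ?_
      rw [Asymptotics.isLittleO_one_iff]
      exact (continuous_sub_right t).tendsto' _ _ (sub_self t)
    simpa using this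

theorem IsCoeff.continuous_mulB {W : ℝ × R3 → ℂ} (h : IsCoeff W) :
    Continuous fun s => mulB (slice W s) :=
  continuous_iff_continuousAt.2 fun t => (h.hasDerivAt_mulB t).continuousAt

/-- Space derivatives of a product with a smooth coefficient. -/
theorem IsCoeff.hasWeakDeriv {W : ℝ × R3 → ℂ} (h : IsCoeff W) {i : Fin 3} {g g' : L2R3}
    (hg : HasWeakDeriv i g g') (t : ℝ) : HasWeakDeriv i (mulB (slice W t) g)
      (mulB (slice (_root_.dirD (0, e3 i) W) t) g + mulB (slice W t) g') := by
  obtain ⟨M, hM⟩ := h.exists_bound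
  obtain ⟨N, hN⟩ := (h.dirD (0, e3 i)).exists_bound
  have := hg.mulB_smooth (contDiff_slice h.smooth t) (hM t) (N := N)
    (by rw [pd_slice h.smooth]; exact hN t)
  rwa [pd_slice h.smooth] at this

/-- Time derivatives of a product with a smooth coefficient. -/
theorem IsCoeff.hasDerivAt {W : ℝ × R3 → ℂ} (h : IsCoeff W) {u : ℝ → L2R3} {u' : L2R3} {t : ℝ}
    (hu : HasDerivAt u u' t) : HasDerivAt (fun s => mulB (slice W s) (u s))
      (mulB (slice (_root_.dirD (1, 0) W) t) (u t) + mulB (slice W t) u') t := by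
  have h1 : HasDerivAt (fun s => (mulB (slice W s)).restrictScalars ℝ)
      ((mulB (slice (_root_.dirD (1, 0) W) t)).restrictScalars ℝ) t :=
    (ContinuousLinearMap.restrictScalarsL ℂ L2R3 L2R3 ℝ ℝ).hasFDerivAt.comp_hasDerivAt t
      (h.hasDerivAt_mulB t)
  exact h1.clm_apply hu

end

open scoped FourierTransform SchwartzMap LineDeriv

noncomputable section

/-! ### The Fourier transform and weak derivatives -/

/-- `L2R3` is `L²(ℝ³)` with respect to Lebesgue measure. -/
def toVol : L2R3 ≃ₗᵢ[ℂ] Lp ℂ 2 (volume : Measure R3) :=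
  have h1 : MeasurePreserving (id : R3 → R3) volume leb3 := by
    rw [leb3_eq]; exact MeasurePreserving.id _
  have h2 : MeasurePreserving (id : R3 → R3) leb3 volume := by
    rw [leb3_eq]; exact MeasurePreserving.id _
  LinearIsometryEquiv.mk
    (LinearEquiv.ofLinearMap (Lp.compMeasurePreservingₗᵢ ℂ id h1).toLinearMap
      (Lp.compMeasurePreservingₗᵢ ℂ id h2).toLinearMap
      (by
        ext1 g
        refine Lp.ext ?_
        refine (Lp.coeFn_compMeasurePreserving _ h1).trans ?_
        exact ae_leb3.1 (Lp.coeFn_compMeasurePreserving g h2))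
      (by
        ext1 g
        refine Lp.ext ?_
        refine (Lp.coeFn_compMeasurePreserving _ h2).trans ?_
        exact ae_leb3.2 (Lp.coeFn_compMeasurePreserving g h1)))
    (Lp.compMeasurePreservingₗᵢ ℂ id h1).norm_map

theorem coe_toVol (g : L2R3) : toVol g =ᵐ[leb3] g := by
  have h1 : MeasurePreserving (id : R3 → R3) volume leb3 := by
    rw [leb3_eq]; exact MeasurePreserving.id _
  exact ae_leb3.2 (Lp.coeFn_compMeasurePreserving g h1)

/-- The Fourier transform on `L²(ℝ³)`. -/
def FT : L2R3 ≃ₗᵢ[ℂ] L2R3 :=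
  (toVol.trans (Lp.fourierTransformₗᵢ R3 ℂ)).trans toVol.symm

theorem schwartz_memLp (ψ : 𝓢(R3, ℂ)) : MemLp ψ 2 leb3 := by
  rw [leb3_eq]
  exact ψ.memLp 2

theorem toVol_toL2 (ψ : 𝓢(R3, ℂ)) : toVol (toL2 ψ) = ψ.toLp 2 := by
  refine Lp.ext ?_
  have h1 := (coe_toVol (toL2 ψ)).trans (coe_toL2 (schwartz_memLp ψ))
  rw [leb3_eq] at h1
  exact h1.trans (ψ.coeFn_toLp 2).symm

theorem FT_toL2 (ψ : 𝓢(R3, ℂ)) : FT (toL2 ψ) = toL2 (𝓕 ψ : 𝓢(R3, ℂ)) := by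
  have h : FT (toL2 ψ) = toVol.symm (𝓕 (toVol (toL2 ψ))) := rfl
  rw [h, toVol_toL2, SchwartzMap.toLp_fourier_eq, ← toVol_toL2, LinearIsometryEquiv.symm_apply_apply]

theorem inner_toL2 {a : R3 → ℂ} (ha : MemLp a 2 leb3) (g : L2R3) :
    inner ℂ (toL2 a) g = ∫ x, (starRingEnd ℂ) (a x) * g x ∂leb3 := by
  rw [L2.inner_def]
  refine integral_congr_ae ?_
  filter_upwards [coe_toL2 ha] with x hx
  rw [hx]
  simp [mul_comm]

theorem integrable_mul_L2 {a : R3 → ℂ} (ha : MemLp a 2 leb3) (g : L2R3) :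
    Integrable (fun x => a x * g x) leb3 := ha.integrable_mul (Lp.memLp g)

/-- In the definition of the weak derivative one may test with square integrable smooth functions
whose derivative is square integrable. -/
theorem HasWeakDeriv.memLp_test {i : Fin 3} {g g' : L2R3} (h : HasWeakDeriv i g g') {f : R3 → ℂ}
    (hf : ContDiff ℝ ∞ f) (h1 : MemLp f 2 leb3) (h2 : MemLp (pd i f) 2 leb3) :
    tpair (pd i f) g = - tpair f g' := by
  let χ : ContDiffBump (0 : R3) := ⟨1, 2, one_pos, one_lt_two⟩
  -- the cutoffs `χₙ(x) = χ(x / (n + 1))`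
  let c : ℕ → R3 → ℂ := fun n x => (χ ((n + 1 : ℝ)⁻¹ • x) : ℂ)
  have hcs : ∀ n, ContDiff ℝ ∞ (c n) := fun n =>
    Complex.ofRealCLM.contDiff.comp (χ.contDiff.comp (contDiff_const_smul _))
  have hcc : ∀ n, HasCompactSupport (c n) := fun n => by
    have : HasCompactSupport fun x : R3 => χ ((n + 1 : ℝ)⁻¹ • x) :=
      χ.hasCompactSupport.comp_smul (by positivity)
    exact this.comp_left (g := ((↑) : ℝ → ℂ)) rfl
  have ht : ∀ n, IsTest (fun x => c n x * f x) := fun n =>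
    ⟨(hcs n).mul hf, (hcc n).mul_right⟩
  have hc1 : ∀ n x, ‖c n x‖ ≤ 1 := fun n x => by
    simp only [c, Complex.norm_real, Real.norm_of_nonneg χ.nonneg]
    exact χ.le_one
  obtain ⟨B, hB⟩ := (IsTest.pd (φ := fun x => (χ x : ℝ)) ⟨χ.contDiff, χ.hasCompactSupport⟩ i).cpt
    |>.exists_bound_of_continuous (IsTest.pd (φ := fun x => (χ x : ℝ))
      ⟨χ.contDiff, χ.hasCompactSupport⟩ i).smooth.continuous
  have hpd : ∀ n x, pd i (c n) x = (((n + 1 : ℝ)⁻¹ * pd i χ ((n + 1 : ℝ)⁻¹ • x) : ℝ) : ℂ) :=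
    fun n x => by
      have h1 := pd_ofReal (φ := fun x => χ ((n + 1 : ℝ)⁻¹ • x))
        (χ.contDiff.comp (contDiff_const_smul _)) i x
      have h2 := (((χ.contDiff (n := ⊤)).differentiable (by simp) ((n + 1 : ℝ)⁻¹ • x)).hasFDerivAt.comp x
        ((hasFDerivAt_id x).const_smul (n + 1 : ℝ)⁻¹)).fderiv
      refine h1.trans ?_
      rw [ofR, pd, show (fun x : R3 => χ ((n + 1 : ℝ)⁻¹ • x)) = χ ∘ HSMul.hSMul (n + 1 : ℝ)⁻¹ from rfl, h2]
      simp [pd]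
  have hB0 : 0 ≤ B := (norm_nonneg _).trans (hB 0)
  have hpdb : ∀ n x, ‖pd i (c n) x‖ ≤ (n + 1 : ℝ)⁻¹ * B := fun n x => by
    rw [hpd, Complex.norm_real, norm_mul, Real.norm_of_nonneg (by positivity)]
    exact mul_le_mul_of_nonneg_left (hB _) (by positivity)
  have hn1 : ∀ n : ℕ, (n + 1 : ℝ)⁻¹ ≤ 1 := fun n => inv_le_one_of_one_le₀ (by simp)
  have hn0 : Tendsto (fun n : ℕ => (n + 1 : ℝ)⁻¹) atTop (𝓝 0) := by
    simpa using tendsto_one_div_add_atTop_nhds_zero_nat (𝕜 := ℝ)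
  have hclim : ∀ x, Tendsto (fun n => c n x) atTop (𝓝 1) := fun x => by
    have h3 : Tendsto (fun n : ℕ => χ ((n + 1 : ℝ)⁻¹ • x)) atTop (𝓝 (χ ((0 : ℝ) • x))) :=
      (χ.continuous.tendsto _).comp (hn0.smul_const x)
    rw [zero_smul, χ.one_of_mem_closedBall (by simp [χ.rIn_pos.le])] at h3
    have h4 := (Complex.continuous_ofReal.tendsto 1).comp h3
    rwa [Complex.ofReal_one] at h4
  have hplim : ∀ x, Tendsto (fun n => pd i (c n) x) atTop (𝓝 0) := fun x => by
    refine squeeze_zero_norm (fun n => hpdb n x) ?_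
    simpa using hn0.mul_const B
  have L1 : Tendsto (fun n => tpair (fun x => c n x * f x) g') atTop (𝓝 (tpair f g')) := by
    simp_rw [tpair_apply (ht _).memLp, tpair_apply h1]
    refine tendsto_integral_of_dominated_convergence (fun x => ‖f x * g' x‖) (fun n => ?_)
      (integrable_mul_L2 h1 g').norm (fun n => .of_forall fun x => ?_) (.of_forall fun x => ?_)
    · exact (integrable_mul_L2 (ht n).memLp g').1
    · rw [mul_assoc, norm_mul]
      exact mul_le_of_le_one_left (norm_nonneg _) (hc1 n x)
    · simpa using ((hclim x).mul_const (f x)).mul_const (g' x)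
  have L2 : Tendsto (fun n => tpair (pd i (fun x => c n x * f x)) g) atTop
      (𝓝 (tpair (pd i f) g)) := by
    simp_rw [tpair_apply ((ht _).pd i).memLp, tpair_apply h2]
    refine tendsto_integral_of_dominated_convergence
      (fun x => B * ‖f x * g x‖ + ‖pd i f x * g x‖) (fun n => ?_)
      (((integrable_mul_L2 h1 g).norm.const_mul B).add (integrable_mul_L2 h2 g).norm)
      (fun n => .of_forall fun x => ?_) (.of_forall fun x => ?_)
    · exact (integrable_mul_L2 ((ht n).pd i).memLp g).1
    · rw [pd_mul (hcs n) hf, add_mul]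
      refine (norm_add_le _ _).trans (add_le_add ?_ ?_)
      · rw [mul_assoc, norm_mul]
        refine mul_le_mul_of_nonneg_right ((hpdb n x).trans ?_) (norm_nonneg _)
        exact mul_le_of_le_one_left hB0 (hn1 n)
      · rw [mul_assoc, norm_mul]
        exact mul_le_of_le_one_left (norm_nonneg _) (hc1 n x)
    · simp_rw [pd_mul (hcs _) hf]
      simpa using (((hplim x).mul_const (f x)).add ((hclim x).mul_const (pd i f x))).mul_const (g x)
  have L3 := L1.neg
  simp_rw [← fun n => h.complex (ht n)] at L3
  exact tendsto_nhds_unique L2 L3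

theorem pd_conj {f : R3 → ℂ} (hf : ContDiff ℝ ∞ f) (i : Fin 3) :
    pd i (fun x => (starRingEnd ℂ) (f x)) = fun x => (starRingEnd ℂ) (pd i f x) :=
  funext fun x => pd_clm (Complex.conjCLE : ℂ →L[ℝ] ℂ) hf i x

theorem memLp_conj {f : R3 → ℂ} (hf : MemLp f 2 leb3) :
    MemLp (fun x => (starRingEnd ℂ) (f x)) 2 leb3 := hf.star

/-- The Fourier transform of a derivative of a Schwartz function. -/
theorem fourier_pd (ψ : 𝓢(R3, ℂ)) (i : Fin 3) (ξ : R3) :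
    (𝓕 (∂_{e3 i} ψ) : 𝓢(R3, ℂ)) ξ = 2 * Real.pi * Complex.I * ξ i * (𝓕 ψ : 𝓢(R3, ℂ)) ξ := by
  rw [SchwartzMap.fourier_lineDerivOp_eq]
  have : (inner ℝ · (e3 i)).HasTemperateGrowth := ((innerSL ℝ).flip (e3 i)).hasTemperateGrowth
  have h2 : inner ℝ ξ (e3 i) = ξ i := by simp [EuclideanSpace.inner_single_right]
  simp [this, h2]
  ring

theorem schwartz_pd (ψ : 𝓢(R3, ℂ)) (i : Fin 3) : pd i ψ = (∂_{e3 i} ψ : 𝓢(R3, ℂ)) := by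
  ext x
  rw [SchwartzMap.lineDerivOp_apply_eq_fderiv]
  rfl

theorem HasWeakDeriv.inner_schwartz {i : Fin 3} {g g' : L2R3} (h : HasWeakDeriv i g g')
    (ψ : 𝓢(R3, ℂ)) :
    inner ℂ (toL2 (∂_{e3 i} ψ : 𝓢(R3, ℂ))) g = - inner ℂ (toL2 ψ) g' := by
  have h1 := h.memLp_test (f := fun x => (starRingEnd ℂ) (ψ x))
    ((Complex.conjCLE : ℂ →L[ℝ] ℂ).contDiff.comp (ψ.smooth ⊤)) (memLp_conj (schwartz_memLp ψ))
    (by rw [pd_conj (ψ.smooth ⊤), schwartz_pd]; exact memLp_conj (schwartz_memLp _))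
  rw [pd_conj (ψ.smooth ⊤), schwartz_pd, tpair_apply (memLp_conj (schwartz_memLp _)),
    tpair_apply (memLp_conj (schwartz_memLp _))] at h1
  rw [inner_toL2 (schwartz_memLp _), inner_toL2 (schwartz_memLp _), h1]

/-- A test function as a Schwartz function. -/
def IsTest.schwartz {φ : R3 → ℝ} (h : IsTest φ) : 𝓢(R3, ℂ) :=
  h.ofReal.cpt.toSchwartzMap h.ofReal.smooth

theorem IsTest.coe_schwartz {φ : R3 → ℝ} (h : IsTest φ) : (h.schwartz : R3 → ℂ) = ofR φ := rfl

theorem conj_ofR (φ : R3 → ℝ) (x : R3) : (starRingEnd ℂ) (ofR φ x) = ofR φ x :=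
  Complex.conj_ofReal _

theorem IsTest.tpair_eq_inner {φ : R3 → ℝ} (h : IsTest φ) (g : L2R3) :
    tpair (ofR φ) g = inner ℂ (toL2 (ofR φ)) g := by
  rw [tpair_apply h.ofReal.memLp, inner_toL2 h.ofReal.memLp]
  simp only [conj_ofR]

theorem IsTest.schwartz_pd {φ : R3 → ℝ} (h : IsTest φ) (i : Fin 3) :
    ofR (_root_.pd i φ) = (∂_{e3 i} h.schwartz : 𝓢(R3, ℂ)) := by
  rw [← _root_.schwartz_pd, h.coe_schwartz]
  exact (funext fun x => pd_ofReal h.smooth i x).symm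

/-- On the Fourier side, the weak derivative `∂ᵢ` is multiplication by `2πi ξᵢ`. -/
theorem hasWeakDeriv_iff_FT {i : Fin 3} {g g' : L2R3} : HasWeakDeriv i g g' ↔
    FT g' =ᵐ[leb3] fun ξ => 2 * Real.pi * Complex.I * ξ i * FT g ξ := by
  constructor
  · intro h
    have hloc : LocallyIntegrable (fun ξ : R3 => 2 * Real.pi * Complex.I * ξ i * FT g ξ) leb3 := by
      refine (FT g).locallyIntegrable.continuous_smul (g := fun ξ : R3 => 2 * Real.pi * Complex.I * ξ i) ?_
      fun_prop
    refine ae_eq_of_integral_contDiff_smul_eq (FT g').locallyIntegrable hloc fun θ h1 h2 => ?_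
    have hθ : IsTest θ := ⟨h1, h2⟩
    -- test the weak derivative with the inverse Fourier transform of `θ`, by Plancherel
    have hF : 𝓕 (𝓕⁻ hθ.schwartz : 𝓢(R3, ℂ)) = hθ.schwartz := FourierTransform.fourier_fourierInv_eq _
    have h3 := h.inner_schwartz (𝓕⁻ hθ.schwartz)
    rw [← FT.inner_map_map, FT_toL2, ← FT.inner_map_map (toL2 _) g', FT_toL2,
      inner_toL2 (schwartz_memLp _), inner_toL2 (schwartz_memLp _)] at h3
    simp only [fourier_pd, hF, hθ.coe_schwartz, map_mul, Complex.conj_ofReal, conj_ofR,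
      Complex.conj_I, map_ofNat] at h3
    rw [← neg_eq_iff_eq_neg, ← integral_neg] at h3
    calc _ = ∫ x, ofR θ x * FT g' x ∂leb3 := by simp [ofR]
      _ = _ := by
        rw [← h3]
        refine integral_congr_ae (.of_forall fun ξ => ?_)
        simp only [ofR, Complex.real_smul]
        ring
  · intro h φ hφ
    rw [(hφ.pd i).tpair_eq_inner, hφ.tpair_eq_inner, hφ.schwartz_pd, ← hφ.coe_schwartz,
      ← FT.inner_map_map, FT_toL2, ← FT.inner_map_map (toL2 _) g', FT_toL2,
      inner_toL2 (schwartz_memLp _), inner_toL2 (schwartz_memLp _), ← integral_neg]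
    refine integral_congr_ae ?_
    filter_upwards [h] with ξ hξ
    rw [hξ, fourier_pd]
    simp only [map_mul, Complex.conj_ofReal, Complex.conj_I, map_ofNat]
    ring

theorem tpair_star {φ : R3 → ℝ} (h : IsTest φ) (g : L2R3) :
    tpair (ofR φ) (star g) = (starRingEnd ℂ) (tpair (ofR φ) g) := by
  rw [tpair_apply h.ofReal.memLp, tpair_apply h.ofReal.memLp, ← integral_conj]
  refine integral_congr_ae ?_
  filter_upwards [Lp.coeFn_star g] with x hx
  rw [hx, map_mul, conj_ofR]
  rfl

theorem HasWeakDeriv.star {i : Fin 3} {g g' : L2R3} (h : HasWeakDeriv i g g') :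
    HasWeakDeriv i (star g) (star g') := fun φ hφ => by
  rw [tpair_star (hφ.pd i), tpair_star hφ, h φ hφ, map_neg]

/-- Integration by parts for two functions with a square integrable weak derivative. -/
theorem HasWeakDeriv.inner_eq {i : Fin 3} {u u' v v' : L2R3} (hu : HasWeakDeriv i u u')
    (hv : HasWeakDeriv i v v') : inner ℂ u' v = - inner ℂ u v' := by
  rw [← FT.inner_map_map, ← FT.inner_map_map u, L2.inner_def, L2.inner_def, ← integral_neg]
  refine integral_congr_ae ?_
  filter_upwards [hasWeakDeriv_iff_FT.1 hu, hasWeakDeriv_iff_FT.1 hv] with ξ h1 h2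
  rw [h1, h2]
  simp only [RCLike.inner_apply, map_mul, Complex.conj_ofReal, Complex.conj_I, map_ofNat]
  ring

theorem HasWeakDeriv.pair_eq {i : Fin 3} {u u' v v' : L2R3} (hu : HasWeakDeriv i u u')
    (hv : HasWeakDeriv i v v') : pair u' v = - pair u v' := by
  rw [pair_eq_inner, pair_eq_inner, hu.star.inner_eq hv]

theorem IsTest.essBdd {φ : R3 → ℂ} (h : IsTest φ) : ∃ M, EssBdd φ M := by
  obtain ⟨M, hM⟩ := h.cpt.exists_bound_of_continuous h.smooth.continuous
  exact ⟨M, .of_continuous h.smooth.continuous hM⟩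

/-- The Leibniz rule for two functions in `H¹`, tested against `φ`. -/
theorem HasWeakDeriv.pair_mulB {i : Fin 3} {u u' v v' : L2R3} (hu : HasWeakDeriv i u u')
    (hv : HasWeakDeriv i v v') {φ : R3 → ℂ} (hφ : IsTest φ) :
    pair (mulB (pd i φ) u) v = - (pair (mulB φ u') v + pair (mulB φ u) v') := by
  obtain ⟨M, hM⟩ := hφ.essBdd
  obtain ⟨N, hN⟩ := (hφ.pd i).essBdd
  have h := (hu.mulB_smooth hφ.smooth hM hN).pair_eq hv
  rw [map_add, _root_.add_apply] at h
  rw [eq_sub_of_add_eq h]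
  ring

end

noncomputable section

/-! ### The Sobolev embedding `H²(ℝ³) ⊂ L^∞(ℝ³)` -/

theorem norm_fourier_schwartz_le (ψ : 𝓢(R3, ℂ)) (ξ : R3) :
    ‖(𝓕 ψ : 𝓢(R3, ℂ)) ξ‖ ≤ ∫ x, ‖ψ x‖ := by
  rw [SchwartzMap.fourier_coe, Real.fourier_eq]
  refine (norm_integral_le_integral_norm _).trans (le_of_eq ?_)
  simp

/-- The function `(1 + |ξ|²)⁻¹` is square integrable, as the dimension `3` is less than `4`. -/
theorem memLp_bessel : MemLp (fun ξ : R3 => ((1 + ‖ξ‖ ^ 2 : ℝ) : ℂ)⁻¹) 2 leb3 := by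
  rw [leb3_eq]
  have hc : Continuous fun ξ : R3 => ((1 + ‖ξ‖ ^ 2 : ℝ) : ℂ)⁻¹ := by
    refine Continuous.inv₀ (by fun_prop) fun ξ => ?_
    rw [Complex.ofReal_ne_zero]
    positivity
  rw [memLp_two_iff_integrable_sq_norm hc.aestronglyMeasurable]
  have h := integrable_rpow_neg_one_add_norm_sq (E := R3) (μ := volume) (r := 4) (by simp; norm_num)
  refine h.congr (.of_forall fun ξ => ?_)
  have h1 : (0 : ℝ) < 1 + ‖ξ‖ ^ 2 := by positivity
  simp only [norm_inv, Complex.norm_real, Real.norm_of_nonneg h1.le]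
  rw [show (-4 / 2 : ℝ) = -((2 : ℕ) : ℝ) by norm_num, Real.rpow_neg h1.le, Real.rpow_natCast, inv_pow]

/-- An `L²` function that is bounded by `M` on `L¹`-normalised test functions is bounded by `M`. -/
theorem essBdd_of_tpair {g : L2R3} {M : ℝ} (hM : 0 ≤ M)
    (h : ∀ φ : R3 → ℝ, IsTest φ → ‖tpair (ofR φ) g‖ ≤ M * ∫ x, |φ x|) : EssBdd g M := by
  refine ⟨(Lp.memLp g).1, hM, ae_leb3.2 ?_⟩
  -- convolution with an approximate identity converges almost everywhere
  let φ : ℕ → ContDiffBump (0 : R3) := fun n =>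
    ⟨1 / (n + 1 : ℝ), 2 * (1 / (n + 1 : ℝ)), by positivity,
      lt_mul_of_one_lt_left (by positivity) one_lt_two⟩
  have hloc : LocallyIntegrable g (volume : Measure R3) := by
    have := g.locallyIntegrable
    rwa [leb3_eq] at this
  have hlim := ContDiffBump.ae_convolution_tendsto_right_of_locallyIntegrable
    (φ := φ) (l := atTop) (K := 2) (by
      have := (tendsto_one_div_add_atTop_nhds_zero_nat (𝕜 := ℝ)).const_mul 2
      rw [mul_zero] at this
      exact this)
    (.of_forall fun n => le_rfl) hloc
  filter_upwards [hlim] with x hx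
  refine le_of_tendsto hx.norm (.of_forall fun n => ?_)
  have hθ : IsTest fun y => (φ n).normed volume (x - y) := by
    refine ⟨(φ n).contDiff_normed.comp (contDiff_const.sub contDiff_id), ?_⟩
    exact (φ n).hasCompactSupport_normed.comp_homeomorph (Homeomorph.subLeft x)
  have h1 := h _ hθ
  rw [tpair_ofReal hθ, setIntegral_univ] at h1
  have h2 : ∫ y, |(φ n).normed volume (x - y)| = 1 := by
    simp_rw [abs_of_nonneg ((φ n).nonneg_normed _)]
    rw [integral_sub_left_eq_self (fun y => (φ n).normed volume y) volume x]
    exact (φ n).integral_normed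
  rw [h2, mul_one] at h1
  rw [convolution_eq_swap]
  exact h1

/-- The embedding `H² ⊂ L^∞`, by duality: `(1 + |ξ|²)⁻¹` is square integrable on `ℝ³`, so that
`|∫ φ g| ≤ c ‖φ‖₁ ‖(1 - Δ) g‖₂`. -/
theorem sobolev_embedding : ∃ c : ℝ, 0 ≤ c ∧ ∀ (g : L2R3) (d dd : Fin 3 → L2R3),
    (∀ i, HasWeakDeriv i g (d i)) → (∀ i, HasWeakDeriv i (d i) (dd i)) →
      EssBdd g (c * (‖g‖ + ∑ i, ‖dd i‖)) := by
  set k : R3 → ℂ := fun ξ => ((1 + ‖ξ‖ ^ 2 : ℝ) : ℂ)⁻¹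
  set b : ℝ := (4 * Real.pi ^ 2)⁻¹ with hb
  have hb0 : 0 ≤ b := by positivity
  refine ⟨‖toL2 k‖ * (1 + b), by positivity, fun g d dd hd hdd => ?_⟩
  -- `ψ = (1 - Δ / (4π²)) g`
  set ψ : L2R3 := g - (b : ℂ) • ∑ i, dd i with hψ
  have hψn : ‖ψ‖ ≤ (1 + b) * (‖g‖ + ∑ i, ‖dd i‖) := by
    have h1 : ‖ψ‖ ≤ ‖g‖ + b * ∑ i, ‖dd i‖ := by
      refine (norm_sub_le _ _).trans (add_le_add le_rfl ?_)
      rw [norm_smul, Complex.norm_real, Real.norm_of_nonneg hb0]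
      exact mul_le_mul_of_nonneg_left (norm_sum_le _ _) hb0
    have h2 : 0 ≤ ∑ i, ‖dd i‖ := Finset.sum_nonneg fun _ _ => norm_nonneg _
    nlinarith [norm_nonneg g]
  have hF : FT ψ =ᵐ[leb3] fun ξ => ((1 + ‖ξ‖ ^ 2 : ℝ) : ℂ) * FT g ξ := by
    have e1 : ∀ i, FT (dd i) =ᵐ[leb3] fun ξ => -(4 * Real.pi ^ 2 * ξ i ^ 2) * FT g ξ := fun i => by
      filter_upwards [hasWeakDeriv_iff_FT.1 (hd i), hasWeakDeriv_iff_FT.1 (hdd i)] with ξ h1 h2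
      rw [h2, h1]
      linear_combination (4 * Real.pi ^ 2 * ξ i ^ 2 * FT g ξ) * Complex.I_sq
    have e2 : FT ψ = FT g - (b : ℂ) • (FT (dd 0) + FT (dd 1) + FT (dd 2)) := by
      rw [hψ, map_sub, map_smul, Fin.sum_univ_three, map_add, map_add]
    rw [e2]
    filter_upwards [Lp.coeFn_sub (FT g) ((b : ℂ) • (FT (dd 0) + FT (dd 1) + FT (dd 2))),
      Lp.coeFn_smul (b : ℂ) (FT (dd 0) + FT (dd 1) + FT (dd 2)),
      Lp.coeFn_add (FT (dd 0) + FT (dd 1)) (FT (dd 2)), Lp.coeFn_add (FT (dd 0)) (FT (dd 1)),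
      e1 0, e1 1, e1 2] with ξ h1 h2 h3 h4 h5 h6 h7
    rw [h1, Pi.sub_apply, h2, Pi.smul_apply, h3, Pi.add_apply, h4, Pi.add_apply, h5, h6, h7,
      EuclideanSpace.norm_sq_eq, Fin.sum_univ_three]
    have hpi : (b : ℂ) * (4 * Real.pi ^ 2) = 1 := by
      rw [hb]
      push_cast
      exact inv_mul_cancel₀ (by simp)
    simp only [smul_eq_mul, Real.norm_eq_abs, sq_abs]
    push_cast
    linear_combination (ξ 0 ^ 2 + ξ 1 ^ 2 + ξ 2 ^ 2) * FT g ξ * hpi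
  refine EssBdd.mono (M := ‖toL2 k‖ * ‖ψ‖) (essBdd_of_tpair (by positivity) fun φ hφ => ?_) ?_
  · have hB : EssBdd (𝓕 hφ.schwartz : 𝓢(R3, ℂ)) (∫ x, |φ x|) := by
      refine .of_continuous (𝓕 hφ.schwartz : 𝓢(R3, ℂ)).continuous fun ξ => ?_
      refine (norm_fourier_schwartz_le _ ξ).trans (le_of_eq ?_)
      simp [hφ.coe_schwartz, ofR]
    -- Plancherel: `∫ φ g = ⟪φ̂ k, ψ̂⟫` with `|φ̂| ≤ ‖φ‖₁` and `k = (1 + |ξ|²)⁻¹` in `L²(ℝ³)`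
    have e1 : tpair (ofR φ) g = inner ℂ (mulB (𝓕 hφ.schwartz : 𝓢(R3, ℂ)) (toL2 k)) (FT ψ) := by
      rw [hφ.tpair_eq_inner, ← hφ.coe_schwartz, ← FT.inner_map_map, FT_toL2,
        mulB_toL2 hB memLp_bessel, inner_toL2 (schwartz_memLp _),
        inner_toL2 (a := _ * _) (hB.memLp_mul memLp_bessel)]
      refine integral_congr_ae ?_
      filter_upwards [hF] with ξ hξ
      have h0 : ((1 + ‖ξ‖ ^ 2 : ℝ) : ℂ) ≠ 0 := by
        rw [Complex.ofReal_ne_zero]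
        positivity
      rw [hξ, Pi.mul_apply, map_mul, map_inv₀, Complex.conj_ofReal]
      field_simp
    rw [e1]
    refine (norm_inner_le_norm _ _).trans ?_
    rw [FT.norm_map]
    have := hB.norm_mulB_le (toL2 k)
    nlinarith [norm_nonneg ψ]
  · rw [mul_assoc]
    exact mul_le_mul_of_nonneg_left hψn (norm_nonneg _)

/-! ### The propagators of the free wave equation -/

/-- The Fourier multiplier with symbol `a`. -/
def fmul (a : R3 → ℂ) : L2R3 →L[ℂ] L2R3 :=
  (FT.symm.toContinuousLinearEquiv : L2R3 →L[ℂ] L2R3).comp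
    ((mulB a).comp (FT.toContinuousLinearEquiv : L2R3 →L[ℂ] L2R3))

theorem FT_fmul (a : R3 → ℂ) (g : L2R3) : FT (fmul a g) = mulB a (FT g) :=
  FT.apply_symm_apply _

theorem EssBdd.norm_fmul_le {a : R3 → ℂ} {M : ℝ} (ha : EssBdd a M) (g : L2R3) :
    ‖fmul a g‖ ≤ M * ‖g‖ := by
  rw [← FT.norm_map (fmul a g), FT_fmul, ← FT.norm_map g]
  exact ha.norm_mulB_le _

/-- Bounded Fourier multipliers commute with weak derivatives. -/
theorem EssBdd.hasWeakDeriv_fmul {a : R3 → ℂ} {M : ℝ} (ha : EssBdd a M) {i : Fin 3} {g g' : L2R3}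
    (h : HasWeakDeriv i g g') : HasWeakDeriv i (fmul a g) (fmul a g') := by
  rw [hasWeakDeriv_iff_FT, FT_fmul, FT_fmul]
  filter_upwards [ha.coe_mulB (FT g), ha.coe_mulB (FT g'), hasWeakDeriv_iff_FT.1 h] with ξ h1 h2 h3
  rw [h1, h2, h3]
  ring

theorem IsTest.tpair_fmul {φ : R3 → ℝ} (h : IsTest φ) {a : R3 → ℂ} {M : ℝ} (ha : EssBdd a M)
    (g : L2R3) : tpair (ofR φ) (fmul a g) =
      ∫ ξ, (starRingEnd ℂ) ((𝓕 h.schwartz : 𝓢(R3, ℂ)) ξ) * a ξ * FT g ξ ∂leb3 := by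
  rw [h.tpair_eq_inner, ← h.coe_schwartz, ← FT.inner_map_map, FT_toL2, FT_fmul,
    inner_toL2 (schwartz_memLp _)]
  refine integral_congr_ae ?_
  filter_upwards [ha.coe_mulB (FT g)] with ξ hξ
  rw [hξ, mul_assoc]

/-- The angular frequency `2π|ξ|`. -/
def freq (ξ : R3) : ℝ := 2 * Real.pi * ‖ξ‖

/-- The symbol `sin(t · 2π|ξ|) / (2π|ξ|)`. -/
def sinSymbol (t : ℝ) (ξ : R3) : ℂ := (t * Real.sinc (t * freq ξ) : ℝ)

/-- The symbol `cos(t · 2π|ξ|)`. -/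
def cosSymbol (t : ℝ) (ξ : R3) : ℂ := (Real.cos (t * freq ξ) : ℝ)

theorem continuous_freq : Continuous freq := by unfold freq; fun_prop

theorem essBdd_sinSymbol (t : ℝ) : EssBdd (sinSymbol t) |t| := by
  refine .of_continuous ?_ fun ξ => ?_
  · exact Complex.continuous_ofReal.comp (continuous_const.mul
      (Real.continuous_sinc.comp (continuous_const.mul continuous_freq)))
  · rw [sinSymbol, Complex.norm_real, Real.norm_eq_abs, abs_mul]
    exact mul_le_of_le_one_right (abs_nonneg _) (Real.abs_sinc_le_one _)

theorem essBdd_cosSymbol (t : ℝ) : EssBdd (cosSymbol t) 1 := by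
  refine .of_continuous ?_ fun ξ => ?_
  · exact Complex.continuous_ofReal.comp
      (Real.continuous_cos.comp (continuous_const.mul continuous_freq))
  · rw [cosSymbol, Complex.norm_real, Real.norm_eq_abs]
    exact Real.abs_cos_le_one _

theorem hasDerivAt_sinSymbol (t : ℝ) (ξ : R3) :
    HasDerivAt (fun s => sinSymbol s ξ) (cosSymbol t ξ) t := by
  refine HasDerivAt.ofReal_comp ?_
  by_cases h : freq ξ = 0
  · simpa [h] using hasDerivAt_id' t
  · have e : ∀ s, s * Real.sinc (s * freq ξ) = Real.sin (s * freq ξ) / freq ξ := fun s => by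
      by_cases hs : s = 0
      · simp [hs]
      · rw [Real.sinc_of_ne_zero (mul_ne_zero hs h)]
        field_simp
    simp_rw [e]
    have := (((hasDerivAt_id t).mul_const (freq ξ)).sin).div_const (freq ξ)
    simpa [h] using this

theorem hasDerivAt_cosSymbol (t : ℝ) (ξ : R3) :
    HasDerivAt (fun s => cosSymbol s ξ) (-(freq ξ : ℂ) ^ 2 * sinSymbol t ξ) t := by
  have h := (((hasDerivAt_id t).mul_const (freq ξ)).cos).ofReal_comp
  convert! h using 1
  rw [sinSymbol]
  norm_cast
  by_cases h0 : freq ξ = 0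
  · simp [h0]
  by_cases ht : t = 0
  · simp [ht]
  · rw [Real.sinc_of_ne_zero (mul_ne_zero ht h0), id]
    field_simp

/-- The propagator `S(t) = sin(t√-Δ)/√-Δ` of the free wave equation. -/
def sinProp (t : ℝ) : L2R3 →L[ℂ] L2R3 := fmul (sinSymbol t)

/-- The propagator `C(t) = cos(t√-Δ)` of the free wave equation. -/
def cosProp (t : ℝ) : L2R3 →L[ℂ] L2R3 := fmul (cosSymbol t)

theorem sinProp_zero : sinProp 0 = 0 := by
  ext1 g
  have := (essBdd_sinSymbol 0).norm_fmul_le g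
  rw [abs_zero, zero_mul, norm_le_zero_iff] at this
  exact this

theorem cosProp_zero (g : L2R3) : cosProp 0 g = g := by
  refine FT.injective ?_
  rw [cosProp, FT_fmul]
  refine Lp.ext ?_
  filter_upwards [(essBdd_cosSymbol 0).coe_mulB (FT g)] with ξ h
  rw [h]
  simp [cosSymbol]

theorem norm_sinProp_le (t : ℝ) (g : L2R3) : ‖sinProp t g‖ ≤ |t| * ‖g‖ :=
  (essBdd_sinSymbol t).norm_fmul_le g

theorem norm_cosProp_le (t : ℝ) (g : L2R3) : ‖cosProp t g‖ ≤ ‖g‖ := by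
  simpa [cosProp] using (essBdd_cosSymbol t).norm_fmul_le g

theorem norm_sq_mulB {a : R3 → ℂ} {M : ℝ} (ha : EssBdd a M) (g : L2R3) :
    ((‖mulB a g‖ ^ 2 : ℝ) : ℂ) = ∫ x, ((‖a x‖ ^ 2 * ‖g x‖ ^ 2 : ℝ) : ℂ) ∂leb3 := by
  have h := inner_self_eq_norm_sq_to_K (𝕜 := ℂ) (mulB a g)
  rw [L2.inner_def] at h
  push_cast
  refine Eq.trans h.symm (integral_congr_ae ?_)
  filter_upwards [ha.coe_mulB g] with x hx
  rw [hx, inner_self_eq_norm_sq_to_K, norm_mul, ← mul_pow]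
  push_cast
  rfl

theorem continuous_cosProp (g : L2R3) : Continuous fun t => cosProp t g := by
  have key : Continuous fun t => mulB (cosSymbol t) (FT g) := by
    refine continuous_iff_continuousAt.2 fun t => ?_
    rw [ContinuousAt, tendsto_iff_norm_sub_tendsto_zero]
    have hE : ∀ s, EssBdd (cosSymbol s - cosSymbol t) (1 + ‖(-1 : ℂ)‖ * 1) := fun s => by
      have := (essBdd_cosSymbol s).add ((essBdd_cosSymbol t).const_smul (-1))
      rwa [neg_one_smul, ← sub_eq_add_neg] at this
    have e : ∀ s, mulB (cosSymbol s) (FT g) - mulB (cosSymbol t) (FT g) =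
        mulB (cosSymbol s - cosSymbol t) (FT g) := fun s => by
      rw [mulB_sub (essBdd_cosSymbol s) (essBdd_cosSymbol t)]
      rfl
    simp_rw [e]
    have h2 : Tendsto (fun s => ((‖mulB (cosSymbol s - cosSymbol t) (FT g)‖ ^ 2 : ℝ) : ℂ)) (𝓝 t)
        (𝓝 (∫ _, (0 : ℂ) ∂leb3)) := by
      simp_rw [norm_sq_mulB (hE _)]
      refine tendsto_integral_filter_of_dominated_convergence (fun ξ => 4 * ‖FT g ξ‖ ^ 2)
        (.of_forall fun s => ?_) (.of_forall fun s => ?_) ?_ (.of_forall fun ξ => ?_)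
      · refine Complex.continuous_ofReal.comp_aestronglyMeasurable ?_
        exact ((hE s).meas.norm.pow 2).mul ((Lp.memLp (FT g)).1.norm.pow 2)
      · filter_upwards [(hE s).bound] with ξ hξ
        rw [Complex.norm_real, norm_mul, norm_pow, norm_norm, norm_pow, norm_norm]
        refine mul_le_mul_of_nonneg_right ?_ (by positivity)
        norm_num at hξ
        have := norm_nonneg ((cosSymbol s - cosSymbol t) ξ)
        rw [Pi.sub_apply] at this ⊢
        nlinarith
      · exact ((memLp_two_iff_integrable_sq_norm (Lp.memLp (FT g)).1).1
          (Lp.memLp (FT g))).const_mul 4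
      · have hc : Tendsto (fun s => cosSymbol s ξ - cosSymbol t ξ) (𝓝 t) (𝓝 0) := by
          rw [← sub_self (cosSymbol t ξ)]
          exact (hasDerivAt_cosSymbol t ξ).continuousAt.tendsto.sub_const _
        have := (((hc.norm.pow 2).mul_const (‖FT g ξ‖ ^ 2)))
        have h4 := (Complex.continuous_ofReal.tendsto _).comp this
        simpa [Function.comp_def] using h4
    have h3 := (Complex.continuous_re.tendsto _).comp h2
    simp only [integral_zero, Complex.zero_re, Function.comp_def, Complex.ofReal_re] at h3
    have h5 := (Real.continuous_sqrt.tendsto _).comp h3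
    simpa [Function.comp_def, Real.sqrt_sq (norm_nonneg _)] using h5
  have := FT.symm.continuous.comp key
  exact this

/-- Differentiation under the integral sign for a Fourier multiplier depending on a parameter. -/
theorem hasDerivAt_integral_symbol {k : R3 → ℂ} {m m' : ℝ → R3 → ℂ} {B : R3 → ℝ} {M : ℝ → ℝ}
    (hk : MemLp k 2 leb3) (hm : ∀ t, EssBdd (m t) (M t)) (hm' : ∀ t, Continuous (m' t))
    (hd : ∀ t ξ, HasDerivAt (fun s => m s ξ) (m' t ξ) t) {a b : ℝ}
    (hB : MemLp (fun ξ => (B ξ : ℂ)) 2 leb3)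
    (hb : ∀ t ∈ Ioo a b, ∀ ξ, ‖k ξ * m' t ξ‖ ≤ B ξ) (g : L2R3) {t : ℝ} (ht : t ∈ Ioo a b) :
    HasDerivAt (fun s => ∫ ξ, k ξ * m s ξ * g ξ ∂leb3) (∫ ξ, k ξ * m' t ξ * g ξ ∂leb3) t := by
  have hmk : ∀ s, MemLp (fun ξ => k ξ * m s ξ) 2 leb3 := fun s => by
    simpa only [mul_comm] using (hm s).memLp_mul hk
  refine (hasDerivAt_integral_of_dominated_loc_of_deriv_le (F' := fun s ξ => k ξ * m' s ξ * g ξ)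
    (bound := fun ξ => ‖(B ξ : ℂ) * g ξ‖) (isOpen_Ioo.mem_nhds ht)
    (.of_forall fun s => (integrable_mul_L2 (hmk s) g).1) (integrable_mul_L2 (hmk t) g) ?_
    (.of_forall fun ξ s hs => ?_) (integrable_mul_L2 hB g).norm
    (.of_forall fun ξ s _ => ((hd s ξ).const_mul (k ξ)).mul_const (g ξ))).2
  · exact (hk.1.mul (hm' t).aestronglyMeasurable).mul (Lp.memLp g).1
  · rw [norm_mul, norm_mul (B ξ : ℂ), Complex.norm_real]
    exact mul_le_mul_of_nonneg_right ((hb s hs ξ).trans (le_abs_self _)) (norm_nonneg _)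

theorem hasDerivAt_sinProp (g : L2R3) (t : ℝ) : HasDerivAt (fun s => sinProp s g) (cosProp t g) t := by
  refine hasDerivAt_of_tpair (a := t - 1) (b := t + 1) (continuous_cosProp g).continuousOn
    (fun φ hφ s _ => ?_) (by constructor <;> linarith)
  simp_rw [sinProp, cosProp, hφ.tpair_fmul (essBdd_sinSymbol _),
    hφ.tpair_fmul (essBdd_cosSymbol _)]
  have hF := schwartz_memLp (𝓕 hφ.schwartz : 𝓢(R3, ℂ))
  refine hasDerivAt_integral_symbol (a := s - 1) (b := s + 1)
    (B := fun ξ => ‖(𝓕 hφ.schwartz : 𝓢(R3, ℂ)) ξ‖) (memLp_conj hF)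
    essBdd_sinSymbol (fun t => ?_) hasDerivAt_sinSymbol ?_ (fun t _ ξ => ?_) (FT g)
    (by constructor <;> linarith)
  · exact Complex.continuous_ofReal.comp
      (Real.continuous_cos.comp (continuous_const.mul continuous_freq))
  · exact hF.norm.ofReal
  · rw [norm_mul, RCLike.norm_conj, cosSymbol, Complex.norm_real]
    exact mul_le_of_le_one_right (norm_nonneg _) (Real.abs_cos_le_one _)

/-- The Laplacian of a test function. -/
def lap3 (φ : R3 → ℝ) (x : R3) : ℝ := ∑ i, pd i (pd i φ) x

theorem IsTest.sum {ι : Type*} (s : Finset ι) {F : Type*} [NormedAddCommGroup F] [NormedSpace ℝ F]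
    {φ : ι → R3 → F} (h : ∀ i ∈ s, IsTest (φ i)) : IsTest (fun x => ∑ i ∈ s, φ i x) := by
  classical
  refine ⟨ContDiff.sum fun i hi => (h i hi).smooth, ?_⟩
  induction s using Finset.induction_on with
  | empty => simpa using! HasCompactSupport.zero
  | insert i s hi ih =>
    simp_rw [Finset.sum_insert hi]
    exact (h i (by simp)).cpt.add (ih fun j hj => h j (by simp [hj]))

theorem IsTest.lap3 {φ : R3 → ℝ} (h : IsTest φ) : IsTest (lap3 φ) :=
  IsTest.sum Finset.univ fun i _ => (h.pd i).pd i

theorem IsTest.fourier_lap3 {φ : R3 → ℝ} (h : IsTest φ) (ξ : R3) :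
    (𝓕 h.lap3.schwartz : 𝓢(R3, ℂ)) ξ = -(freq ξ : ℂ) ^ 2 * (𝓕 h.schwartz : 𝓢(R3, ℂ)) ξ := by
  have e : h.lap3.schwartz = ∑ i, (∂_{e3 i} (∂_{e3 i} h.schwartz : 𝓢(R3, ℂ)) : 𝓢(R3, ℂ)) := by
    ext x
    rw [_root_.sum_apply, h.lap3.coe_schwartz, ofR, _root_.lap3, Complex.ofReal_sum]
    refine Finset.sum_congr rfl fun i _ => ?_
    have h1 := congrFun ((h.pd i).schwartz_pd i) x
    have h2 : (h.pd i).schwartz = (∂_{e3 i} h.schwartz : 𝓢(R3, ℂ)) := by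
      ext y
      exact congrFun (h.schwartz_pd i) y
    rw [h2] at h1
    exact h1
  have e2 : (𝓕 h.lap3.schwartz : 𝓢(R3, ℂ)) =
      ∑ i, (𝓕 (∂_{e3 i} (∂_{e3 i} h.schwartz : 𝓢(R3, ℂ)) : 𝓢(R3, ℂ)) : 𝓢(R3, ℂ)) := by
    rw [e]
    exact map_sum (FourierTransform.fourierCLM ℂ 𝓢(R3, ℂ)) _ _
  rw [e2, _root_.sum_apply]
  simp_rw [fourier_pd]
  rw [freq, Fin.sum_univ_three]
  have h3 : ((‖ξ‖ : ℝ) : ℂ) ^ 2 = ξ 0 ^ 2 + ξ 1 ^ 2 + ξ 2 ^ 2 := by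
    rw [← Complex.ofReal_pow, EuclideanSpace.norm_sq_eq, Fin.sum_univ_three]
    simp
  push_cast
  rw [mul_pow, h3]
  linear_combination (4 * Real.pi ^ 2 * (ξ 0 ^ 2 + ξ 1 ^ 2 + ξ 2 ^ 2) *
    (𝓕 h.schwartz : 𝓢(R3, ℂ)) ξ) * Complex.I_sq

/-- The weak form of `C'(t) = Δ S(t)`. -/
theorem IsTest.hasDerivAt_cosProp {φ : R3 → ℝ} (h : IsTest φ) (g : L2R3) (t : ℝ) :
    HasDerivAt (fun s => tpair (ofR φ) (cosProp s g)) (tpair (ofR (_root_.lap3 φ)) (sinProp t g)) t := by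
  simp_rw [sinProp, cosProp, h.tpair_fmul (essBdd_cosSymbol _),
    h.lap3.tpair_fmul (essBdd_sinSymbol _)]
  have hF := schwartz_memLp (𝓕 h.schwartz : 𝓢(R3, ℂ))
  have hL := schwartz_memLp (𝓕 h.lap3.schwartz : 𝓢(R3, ℂ))
  have key := hasDerivAt_integral_symbol (a := t - 1) (b := t + 1) (m := cosSymbol)
    (m' := fun t ξ => -(freq ξ : ℂ) ^ 2 * sinSymbol t ξ)
    (B := fun ξ => (|t| + 1) * ‖(𝓕 h.lap3.schwartz : 𝓢(R3, ℂ)) ξ‖) (memLp_conj hF)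
    essBdd_cosSymbol (fun t => ?_) hasDerivAt_cosSymbol ?_ (fun s hs ξ => ?_) (FT g)
    (t := t) (by constructor <;> linarith)
  · convert! key using 1
    refine integral_congr_ae (.of_forall fun ξ => ?_)
    simp only [h.fourier_lap3, map_mul, map_neg, map_pow, Complex.conj_ofReal]
    ring
  · refine Continuous.mul ?_ (Complex.continuous_ofReal.comp (continuous_const.mul
      (Real.continuous_sinc.comp (continuous_const.mul continuous_freq))))
    exact ((Complex.continuous_ofReal.comp continuous_freq).pow 2).neg
  · exact (hL.norm.const_mul (|t| + 1)).ofReal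
  · rw [h.fourier_lap3, norm_mul, norm_mul, norm_mul, RCLike.norm_conj, sinSymbol,
      Complex.norm_real (_ * _), norm_mul]
    have h1 : ‖s‖ ≤ |t| + 1 := by
      rw [Real.norm_eq_abs]
      obtain ⟨h1, h2⟩ := hs
      rw [abs_le]
      constructor <;> linarith [le_abs_self t, neg_abs_le t]
    have h2 : ‖Real.sinc (s * freq ξ)‖ ≤ 1 := Real.abs_sinc_le_one _
    have h3 : ‖s‖ * ‖Real.sinc (s * freq ξ)‖ ≤ (|t| + 1) * 1 :=
      mul_le_mul h1 h2 (norm_nonneg _) (by positivity)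
    calc _ = (‖s‖ * ‖Real.sinc (s * freq ξ)‖) *
        (‖-(freq ξ : ℂ) ^ 2‖ * ‖(𝓕 h.schwartz : 𝓢(R3, ℂ)) ξ‖) := by ring
      _ ≤ _ := by
        refine mul_le_mul_of_nonneg_right ?_ (by positivity)
        linarith

end

noncomputable section

/-! ### Duhamel integrals and Volterra equations -/

/-- A curve that is continuous on `(0,T)` and bounded there by `C`. -/
structure BddCurve {E : Type*} [NormedAddCommGroup E] (T : ℝ) (F : ℝ → E) (C : ℝ) : Prop where
  cont : ContinuousOn F (Ioo 0 T)
  nonneg : 0 ≤ C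
  bound : ∀ t ∈ Ioo 0 T, ‖F t‖ ≤ C

/-- A strongly continuous family of operators, bounded by `M` for `|t| ≤ T`. -/
structure StrongFam {X E : Type*} [NormedAddCommGroup X] [NormedSpace ℂ X] [NormedAddCommGroup E]
    [NormedSpace ℂ E] (T : ℝ) (A : ℝ → X →L[ℂ] E) (M : ℝ) : Prop where
  cont : ∀ x, Continuous fun t => A t x
  nonneg : 0 ≤ M
  bound : ∀ t, |t| ≤ T → ∀ x, ‖A t x‖ ≤ M * ‖x‖

section Curve

variable {E : Type*} [NormedAddCommGroup E]

theorem BddCurve.add {T C D : ℝ} {F G : ℝ → E} (hF : BddCurve T F C) (hG : BddCurve T G D) :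
    BddCurve T (F + G) (C + D) :=
  ⟨hF.cont.add hG.cont, add_nonneg hF.nonneg hG.nonneg, fun t ht =>
    (norm_add_le _ _).trans (add_le_add (hF.bound t ht) (hG.bound t ht))⟩

theorem BddCurve.neg {T C : ℝ} {F : ℝ → E} (hF : BddCurve T F C) : BddCurve T (-F) C :=
  ⟨hF.cont.neg, hF.nonneg, fun t ht => by rw [Pi.neg_apply, norm_neg]; exact hF.bound t ht⟩

theorem BddCurve.sub {T C D : ℝ} {F G : ℝ → E} (hF : BddCurve T F C) (hG : BddCurve T G D) :
    BddCurve T (F - G) (C + D) := by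
  rw [sub_eq_add_neg]
  exact hF.add hG.neg

theorem BddCurve.mono {T C D : ℝ} {F : ℝ → E} (hF : BddCurve T F C) (h : C ≤ D) :
    BddCurve T F D :=
  ⟨hF.cont, hF.nonneg.trans h, fun t ht => (hF.bound t ht).trans h⟩

theorem BddCurve.congr {T C : ℝ} {F G : ℝ → E} (hF : BddCurve T F C)
    (h : ∀ t ∈ Ioo 0 T, G t = F t) : BddCurve T G C :=
  ⟨hF.cont.congr h, hF.nonneg, fun t ht => by rw [h t ht]; exact hF.bound t ht⟩

end Curve

section Duhamel

variable {X E : Type*} [NormedAddCommGroup X] [NormedSpace ℂ X] [NormedAddCommGroup E]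
  [NormedSpace ℂ E]

/-- The Duhamel integral `∫₀ᵗ A(t - τ) F(τ) dτ`. -/
def duhamel (A : ℝ → X →L[ℂ] E) (F : ℝ → X) (t : ℝ) : E := ∫ τ in Ioo 0 t, A (t - τ) (F τ)

theorem StrongFam.continuousAt {T M : ℝ} {A : ℝ → X →L[ℂ] E} (hA : StrongFam T A M) {F : ℝ → X}
    {σ t : ℝ} (hσ : |σ| < T) (hF : ContinuousAt F t) :
    ContinuousAt (fun p : ℝ × ℝ => A p.1 (F p.2)) (σ, t) := by
  have h1 : Tendsto (fun p : ℝ × ℝ => M * ‖F p.2 - F t‖ + ‖A p.1 (F t) - A σ (F t)‖) (𝓝 (σ, t))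
      (𝓝 (M * 0 + 0)) := by
    have e1 : Tendsto (fun p : ℝ × ℝ => F p.2) (𝓝 (σ, t)) (𝓝 (F t)) :=
      hF.tendsto.comp continuous_snd.continuousAt
    have e2 : Tendsto (fun p : ℝ × ℝ => A p.1 (F t)) (𝓝 (σ, t)) (𝓝 (A σ (F t))) :=
      ((hA.cont (F t)).tendsto σ).comp continuous_fst.continuousAt
    exact ((tendsto_iff_norm_sub_tendsto_zero.1 e1).const_mul M).add
      (tendsto_iff_norm_sub_tendsto_zero.1 e2)
  rw [mul_zero, add_zero] at h1
  refine tendsto_iff_norm_sub_tendsto_zero.2 (squeeze_zero' (.of_forall fun _ => norm_nonneg _) ?_ h1)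
  have h2 : ∀ᶠ p : ℝ × ℝ in 𝓝 (σ, t), |p.1| < T :=
    (continuous_abs.comp continuous_fst).continuousAt.eventually_lt continuousAt_const hσ
  filter_upwards [h2] with p hp
  have e : A p.1 (F p.2) - A σ (F t) = A p.1 (F p.2 - F t) + (A p.1 (F t) - A σ (F t)) := by
    rw [map_sub]
    abel
  rw [e]
  exact (norm_add_le _ _).trans (add_le_add (hA.bound _ hp.le _) le_rfl)

theorem abs_sub_lt_of_mem {T t τ : ℝ} (ht : t ∈ Ioo 0 T) (hτ : τ ∈ Ioo 0 T) : |t - τ| < T := by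
  rw [abs_lt]
  constructor <;> linarith [ht.1, ht.2, hτ.1, hτ.2]

theorem StrongFam.continuousOn {T M C : ℝ} {A : ℝ → X →L[ℂ] E} (hA : StrongFam T A M) {F : ℝ → X}
    (hF : BddCurve T F C) {t : ℝ} (ht : t ∈ Ioo 0 T) :
    ContinuousOn (fun τ => A (t - τ) (F τ)) (Ioo 0 T) := fun τ hτ => by
  have h1 := hA.continuousAt (abs_sub_lt_of_mem ht hτ) (hF.cont.continuousAt (isOpen_Ioo.mem_nhds hτ))
  have h2 : ContinuousAt (fun τ : ℝ => (t - τ, τ)) τ := by fun_prop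
  exact (ContinuousAt.comp (f := fun τ : ℝ => (t - τ, τ)) h1 h2).continuousWithinAt

theorem StrongFam.norm_le {T M C : ℝ} {A : ℝ → X →L[ℂ] E} (hA : StrongFam T A M) {F : ℝ → X}
    (hF : BddCurve T F C) {t τ : ℝ} (ht : t ∈ Ioo 0 T) (hτ : τ ∈ Ioo 0 T) :
    ‖A (t - τ) (F τ)‖ ≤ M * C :=
  (hA.bound _ (abs_sub_lt_of_mem ht hτ).le _).trans
    (mul_le_mul_of_nonneg_left (hF.bound τ hτ) hA.nonneg)

theorem StrongFam.integrableOn {T M C : ℝ} {A : ℝ → X →L[ℂ] E} (hA : StrongFam T A M) {F : ℝ → X}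
    (hF : BddCurve T F C) {t : ℝ} (ht : t ∈ Ioo 0 T) :
    IntegrableOn (fun τ => A (t - τ) (F τ)) (Ioo 0 T) := by
  refine Integrable.of_bound ((hA.continuousOn hF ht).aestronglyMeasurable measurableSet_Ioo) (M * C) ?_
  filter_upwards [ae_restrict_mem measurableSet_Ioo] with τ hτ
  exact hA.norm_le hF ht hτ

theorem StrongFam.norm_duhamel_le {T M C : ℝ} {A : ℝ → X →L[ℂ] E} (hA : StrongFam T A M)
    {F : ℝ → X} (hF : BddCurve T F C) {t : ℝ} (ht : t ∈ Ioo 0 T) : ‖duhamel A F t‖ ≤ M * C * t := by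
  have h := norm_setIntegral_le_of_norm_le_const (μ := volume) (s := Ioo 0 t)
    (f := fun τ => A (t - τ) (F τ)) (C := M * C) (by simp)
    (fun τ hτ => hA.norm_le hF ht ⟨hτ.1, hτ.2.trans ht.2⟩)
  simpa [duhamel, ht.1.le] using h

theorem StrongFam.duhamel_sub {T M C D : ℝ} {A : ℝ → X →L[ℂ] E} (hA : StrongFam T A M)
    {F G : ℝ → X} (hF : BddCurve T F C) (hG : BddCurve T G D) {t : ℝ} (ht : t ∈ Ioo 0 T) :
    duhamel A (fun τ => F τ - G τ) t = duhamel A F t - duhamel A G t := by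
  have hs : Ioo 0 t ⊆ Ioo 0 T := Ioo_subset_Ioo_right ht.2.le
  rw [duhamel, duhamel, duhamel,
    ← integral_sub ((hA.integrableOn hF ht).mono_set hs) ((hA.integrableOn hG ht).mono_set hs)]
  simp only [map_sub]

theorem StrongFam.bddCurve_duhamel {T M C : ℝ} {A : ℝ → X →L[ℂ] E} (hA : StrongFam T A M)
    {F : ℝ → X} (hF : BddCurve T F C) (hT : 0 ≤ T) : BddCurve T (duhamel A F) (M * C * T) := by
  refine ⟨fun t ht => ContinuousAt.continuousWithinAt ?_,
    mul_nonneg (mul_nonneg hA.nonneg hF.nonneg) hT, fun t ht =>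
    (hA.norm_duhamel_le hF ht).trans
      (mul_le_mul_of_nonneg_left ht.2.le (mul_nonneg hA.nonneg hF.nonneg))⟩
  have e : ∀ᶠ s in 𝓝 t, duhamel A F s =
      ∫ τ in Ioo 0 T, (Ioo 0 s).indicator (fun τ => A (s - τ) (F τ)) τ := by
    filter_upwards [isOpen_Ioo.mem_nhds ht] with s hs
    rw [setIntegral_indicator measurableSet_Ioo, duhamel]
    congr 2
    ext τ
    simp only [mem_inter_iff, mem_Ioo]
    constructor
    · exact fun h => ⟨⟨h.1, h.2.trans hs.2⟩, h⟩
    · exact fun h => h.2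
  refine ContinuousAt.congr ?_ (e.mono fun _ h => h.symm)
  refine continuousAt_of_dominated (bound := fun _ => M * C) ?_ ?_ (integrable_const _) ?_
  · filter_upwards [isOpen_Ioo.mem_nhds ht] with s hs
    exact (hA.integrableOn hF hs).1.indicator measurableSet_Ioo
  · filter_upwards [isOpen_Ioo.mem_nhds ht] with s hs
    filter_upwards [ae_restrict_mem measurableSet_Ioo] with τ hτ
    by_cases h : τ ∈ Ioo 0 s
    · rw [indicator_of_mem h]
      exact hA.norm_le hF hs hτ
    · rw [indicator_of_notMem h, norm_zero]
      exact mul_nonneg hA.nonneg hF.nonneg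
  · have h0 : ∀ᵐ τ : ℝ, τ ≠ t := by simp [ae_iff, measure_singleton]
    filter_upwards [ae_restrict_mem measurableSet_Ioo, ae_restrict_of_ae h0] with τ hτ hne
    rcases lt_or_gt_of_ne hne with h | h
    · have : (fun s => A (s - τ) (F τ)) =ᶠ[𝓝 t]
          fun s => (Ioo 0 s).indicator (fun τ => A (s - τ) (F τ)) τ := by
        filter_upwards [lt_mem_nhds h] with s hs
        rw [indicator_of_mem (show τ ∈ Ioo 0 s from ⟨hτ.1, hs⟩)]
      refine ContinuousAt.congr ?_ this
      exact ((hA.cont (F τ)).comp (continuous_sub_right τ)).continuousAt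
    · have : (fun _ => (0 : E)) =ᶠ[𝓝 t]
          fun s => (Ioo 0 s).indicator (fun τ => A (s - τ) (F τ)) τ := by
        filter_upwards [gt_mem_nhds h] with s hs
        rw [indicator_of_notMem fun h' => h'.2.not_gt hs]
      exact continuousAt_const.congr this

variable [CompleteSpace E]

/-- The time derivative of a Duhamel integral. -/
theorem StrongFam.hasDerivAt_duhamel {T M M' C : ℝ} {A A' : ℝ → X →L[ℂ] E} (hA : StrongFam T A M)
    (hA' : StrongFam T A' M') (hd : ∀ x t, HasDerivAt (fun s => A s x) (A' t x) t)
    {F : ℝ → X} (hF : BddCurve T F C) {t : ℝ} (ht : t ∈ Ioo 0 T) :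
    HasDerivAt (duhamel A F) (A 0 (F t) + duhamel A' F t) t := by
  have hs : Ioo 0 t ⊆ Ioo 0 T := Ioo_subset_Ioo_right ht.2.le
  have hT : 0 < T := ht.1.trans ht.2
  -- the dependence on the time in the integrand
  have h1 : HasDerivAt (fun s => ∫ τ in Ioo 0 t, A (s - τ) (F τ)) (duhamel A' F t) t := by
    refine (hasDerivAt_integral_of_dominated_loc_of_deriv_le (μ := volume.restrict (Ioo 0 t))
      (F := fun s τ => A (s - τ) (F τ)) (F' := fun s τ => A' (s - τ) (F τ))
      (bound := fun _ => M' * C) (isOpen_Ioo.mem_nhds ht) ?_ ((hA.integrableOn hF ht).mono_set hs)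
      ((hA'.integrableOn hF ht).mono_set hs).1 ?_ (integrable_const _) ?_).2
    · filter_upwards [isOpen_Ioo.mem_nhds ht] with s hs'
      exact ((hA.integrableOn hF hs').mono_set hs).1
    · filter_upwards [ae_restrict_mem measurableSet_Ioo] with τ hτ s hs'
      exact hA'.norm_le hF hs' (hs hτ)
    · refine .of_forall fun τ s _ => ?_
      exact (hd (F τ) (s - τ)).comp_sub_const s τ
  -- the dependence on the upper limit of integration
  have h2 : HasDerivAt (fun s => ∫ τ in t..s, A (s - τ) (F τ)) (A 0 (F t)) t := by
    rw [hasDerivAt_iff_isLittleO, Asymptotics.isLittleO_iff]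
    intro ε hε
    have hc := hA.continuousAt (σ := 0) (by simpa using hT)
      (hF.cont.continuousAt (isOpen_Ioo.mem_nhds ht))
    obtain ⟨δ, hδ, hball⟩ := Metric.continuousAt_iff.1 hc ε hε
    filter_upwards [Metric.ball_mem_nhds t hδ, isOpen_Ioo.mem_nhds ht] with s hs1 hs2
    have hsub : uIcc t s ⊆ Ioo 0 T := (convex_Ioo 0 T).ordConnected.uIcc_subset ht hs2
    have hint : IntervalIntegrable (fun τ => A (s - τ) (F τ)) volume t s :=
      ((hA.continuousOn hF hs2).mono hsub).intervalIntegrable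
    have e : (∫ τ in t..s, A (s - τ) (F τ)) - (∫ τ in t..t, A (t - τ) (F τ)) - (s - t) • A 0 (F t)
        = ∫ τ in t..s, (A (s - τ) (F τ) - A 0 (F t)) := by
      rw [intervalIntegral.integral_same, sub_zero, intervalIntegral.integral_sub hint (by simp),
        intervalIntegral.integral_const]
    rw [e, Real.norm_eq_abs]
    refine intervalIntegral.norm_integral_le_of_norm_le_const fun τ hτ => ?_
    have hτ' : τ ∈ uIcc t s := uIoc_subset_uIcc hτ
    have h3 : dist ((s - τ, τ) : ℝ × ℝ) (0, t) < δ := by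
      rw [Metric.mem_ball, Real.dist_eq] at hs1
      rw [Prod.dist_eq, max_lt_iff, Real.dist_eq, Real.dist_eq, sub_zero]
      refine ⟨?_, (abs_sub_left_of_mem_uIcc hτ').trans_lt hs1⟩
      have h5 := abs_sub_left_of_mem_uIcc (uIcc_comm t s ▸ hτ')
      rw [abs_sub_comm τ s, abs_sub_comm t s] at h5
      exact h5.trans_lt hs1
    have h4 := hball h3
    rw [dist_eq_norm] at h4
    exact h4.le
  have h3 : duhamel A F =ᶠ[𝓝 t] fun s =>
      (∫ τ in t..s, A (s - τ) (F τ)) + ∫ τ in Ioo 0 t, A (s - τ) (F τ) := by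
    filter_upwards [isOpen_Ioo.mem_nhds ht] with s hs'
    have hI := hA.integrableOn hF hs'
    have i1 : IntervalIntegrable (fun τ => A (s - τ) (F τ)) volume 0 t := by
      rw [intervalIntegrable_iff_integrableOn_Ioo_of_le ht.1.le]
      exact hI.mono_set hs
    have i2 : IntervalIntegrable (fun τ => A (s - τ) (F τ)) volume t s :=
      ((hA.continuousOn hF hs').mono
        ((convex_Ioo 0 T).ordConnected.uIcc_subset ht hs')).intervalIntegrable
    have := intervalIntegral.integral_add_adjacent_intervals i1 i2
    rw [intervalIntegral.integral_of_le ht.1.le, intervalIntegral.integral_of_le hs'.1.le,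
      integral_Ioc_eq_integral_Ioo, integral_Ioc_eq_integral_Ioo] at this
    rw [duhamel, ← this, add_comm]
  exact (h2.add h1).congr_of_eventuallyEq h3

/-- Bounded operators commute with Duhamel integrals. -/
theorem StrongFam.clm_duhamel {Y : Type*} [NormedAddCommGroup Y] [NormedSpace ℂ Y] [CompleteSpace Y]
    {T M C : ℝ} {A : ℝ → X →L[ℂ] E} (hA : StrongFam T A M) {F : ℝ → X} (hF : BddCurve T F C)
    (L : E →L[ℂ] Y) {t : ℝ} (ht : t ∈ Ioo 0 T) :
    L (duhamel A F t) = ∫ τ in Ioo 0 t, L (A (t - τ) (F τ)) :=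
  (L.integral_comp_comm ((hA.integrableOn hF ht).mono_set (Ioo_subset_Ioo_right ht.2.le))).symm

end Duhamel

section Volterra

variable {E : Type*} [NormedAddCommGroup E] [NormedSpace ℂ E]

/-- A family of operators that maps continuous curves on `(0,T)` to continuous curves and is
bounded by `N`. -/
structure OpFam (T : ℝ) (B : ℝ → E →L[ℂ] E) (N : ℝ) : Prop where
  cont : ∀ u : ℝ → E, ContinuousOn u (Ioo 0 T) → ContinuousOn (fun t => B t (u t)) (Ioo 0 T)
  nonneg : 0 ≤ N
  bound : ∀ t ∈ Ioo 0 T, ∀ x, ‖B t x‖ ≤ N * ‖x‖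

theorem OpFam.bddCurve {T N C : ℝ} {B : ℝ → E →L[ℂ] E} (hB : OpFam T B N) {u : ℝ → E}
    (hu : BddCurve T u C) : BddCurve T (fun t => B t (u t)) (N * C) :=
  ⟨hB.cont u hu.cont, mul_nonneg hB.nonneg hu.nonneg, fun t ht =>
    (hB.bound t ht _).trans (mul_le_mul_of_nonneg_left (hu.bound t ht) hB.nonneg)⟩

/-- In the norm with weight `exp (-lam t)`, `lam` large, the Volterra operator is a contraction. -/
theorem volterra_weighted {T M N K : ℝ} {S B : ℝ → E →L[ℂ] E} (hS : StrongFam T S M)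
    (hB : OpFam T B N) {d : ℝ → E}
    (hK : ∀ t ∈ Ioo 0 T, ‖d t‖ ≤ K * Real.exp ((2 * (M * N) + 1) * t)) {t : ℝ} (ht : t ∈ Ioo 0 T) :
    ‖duhamel S (fun τ => B τ (d τ)) t‖ ≤ K / 2 * Real.exp ((2 * (M * N) + 1) * t) := by
  set l : ℝ := 2 * (M * N) + 1 with hl
  have hMN : 0 ≤ M * N := mul_nonneg hS.nonneg hB.nonneg
  have hl0 : 0 < l := by linarith
  have hK0 : 0 ≤ K := by
    have := (norm_nonneg _).trans (hK t ht)
    exact nonneg_of_mul_nonneg_left this (Real.exp_pos _)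
  have hc : Continuous fun τ => M * (N * (K * Real.exp (l * τ))) := by fun_prop
  have h1 : ‖duhamel S (fun τ => B τ (d τ)) t‖ ≤ ∫ τ in Ioo 0 t, M * (N * (K * Real.exp (l * τ))) := by
    refine norm_integral_le_of_norm_le ?_ ?_
    · exact (hc.integrableOn_Icc (a := 0) (b := t)).mono_set Ioo_subset_Icc_self
    · filter_upwards [ae_restrict_mem measurableSet_Ioo] with τ hτ
      have hτ' : τ ∈ Ioo 0 T := ⟨hτ.1, hτ.2.trans ht.2⟩
      refine (hS.bound _ (abs_sub_lt_of_mem ht hτ').le _).trans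
        (mul_le_mul_of_nonneg_left ?_ hS.nonneg)
      exact (hB.bound τ hτ' _).trans (mul_le_mul_of_nonneg_left (hK τ hτ') hB.nonneg)
  have h2 : ∫ τ in Ioo 0 t, M * (N * (K * Real.exp (l * τ))) =
      M * (N * (K * ((Real.exp (l * t) - 1) / l))) := by
    simp_rw [integral_const_mul]
    rw [← integral_Ioc_eq_integral_Ioo, ← intervalIntegral.integral_of_le ht.1.le,
      intervalIntegral.integral_comp_mul_left (fun x => Real.exp x) hl0.ne', integral_exp]
    simp only [mul_zero, Real.exp_zero, smul_eq_mul]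
    rw [inv_mul_eq_div]
  rw [h2] at h1
  refine h1.trans ?_
  have h3 : M * N / l ≤ 1 / 2 := by
    rw [div_le_iff₀ hl0]
    linarith
  calc M * (N * (K * ((Real.exp (l * t) - 1) / l)))
      = M * N / l * (K * (Real.exp (l * t) - 1)) := by ring
    _ ≤ 1 / 2 * (K * Real.exp (l * t)) := by
      have : 1 ≤ Real.exp (l * t) := Real.one_le_exp (mul_nonneg hl0.le ht.1.le)
      refine mul_le_mul h3 ?_ (mul_nonneg hK0 (by linarith)) (by norm_num)
      exact mul_le_mul_of_nonneg_left (by linarith) hK0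
    _ = _ := by ring

/-- Solutions of a Volterra equation are unique: iterating `volterra_weighted`, the difference of two
of them is at most `C 2⁻ⁿ` in the weighted norm. -/
theorem volterra_unique {T M N C D : ℝ} {S B : ℝ → E →L[ℂ] E} (hS : StrongFam T S M)
    (hB : OpFam T B N) {f u v : ℝ → E} {Cf : ℝ} (hf : BddCurve T f Cf) (hu : BddCurve T u C)
    (hv : BddCurve T v D)
    (eu : ∀ t ∈ Ioo 0 T, u t = duhamel S (fun τ => f τ - B τ (u τ)) t)
    (ev : ∀ t ∈ Ioo 0 T, v t = duhamel S (fun τ => f τ - B τ (v τ)) t) :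
    ∀ t ∈ Ioo 0 T, u t = v t := by
  have hd := hu.sub hv
  have e : ∀ t ∈ Ioo 0 T, (u - v) t = - duhamel S (fun τ => B τ ((u - v) τ)) t := fun t ht => by
    rw [Pi.sub_apply, eu t ht, ev t ht, hS.duhamel_sub hf (hB.bddCurve hu) ht,
      hS.duhamel_sub hf (hB.bddCurve hv) ht]
    have := hS.duhamel_sub (hB.bddCurve hu) (hB.bddCurve hv) ht
    simp only [← map_sub] at this
    rw [show (fun τ => B τ ((u - v) τ)) = fun τ => B τ (u τ - v τ) from rfl, this]
    abel
  have key : ∀ n : ℕ, ∀ t ∈ Ioo 0 T,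
      ‖(u - v) t‖ ≤ (C + D) / 2 ^ n * Real.exp ((2 * (M * N) + 1) * t) := by
    intro n
    induction n with
    | zero =>
      intro t ht
      rw [pow_zero, div_one]
      refine (hd.bound t ht).trans (le_mul_of_one_le_right hd.nonneg (Real.one_le_exp ?_))
      have := mul_nonneg hS.nonneg hB.nonneg
      exact mul_nonneg (by linarith) ht.1.le
    | succ n ih =>
      intro t ht
      rw [e t ht, norm_neg, pow_succ, ← div_div]
      exact volterra_weighted hS hB ih ht
  intro t ht
  have hlim : Tendsto (fun n : ℕ => (C + D) / 2 ^ n * Real.exp ((2 * (M * N) + 1) * t)) atTop (𝓝 0) := by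
    have := ((tendsto_pow_atTop_nhds_zero_of_lt_one (r := (1 / 2 : ℝ)) (by norm_num)
      (by norm_num)).const_mul (C + D)).mul_const (Real.exp ((2 * (M * N) + 1) * t))
    simpa [div_eq_mul_inv] using this
  have h0 : ‖(u - v) t‖ ≤ 0 := ge_of_tendsto' hlim fun n => key n t ht
  rw [norm_le_zero_iff, Pi.sub_apply, sub_eq_zero] at h0
  exact h0

/-- A Volterra equation in a Banach space has a bounded solution operator. -/
theorem volterra_exists [CompleteSpace E] {T M N : ℝ} (hT : 0 ≤ T) {S B : ℝ → E →L[ℂ] E}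
    (hS : StrongFam T S M) (hB : OpFam T B N) : ∃ c : ℝ, 0 ≤ c ∧ ∀ (f : ℝ → E) (C : ℝ),
      BddCurve T f C → ∃ u, BddCurve T u (c * C) ∧
        ∀ t ∈ Ioo 0 T, u t = duhamel S (fun τ => f τ - B τ (u τ)) t := by
  set l : ℝ := 2 * (M * N) + 1 with hl
  have hMN : 0 ≤ M * N := mul_nonneg hS.nonneg hB.nonneg
  have hl0 : 0 < l := by linarith
  have hM := hS.nonneg
  refine ⟨Real.exp (l * T) * (2 * (M * T)), by positivity, fun f C hf => ?_⟩
  have hC := hf.nonneg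
  -- the curve with weight removed
  let ext : BoundedContinuousFunction (Ioo 0 T) E → ℝ → E := fun v τ =>
    if h : τ ∈ Ioo 0 T then Real.exp (l * τ) • v ⟨τ, h⟩ else 0
  have hext : ∀ v, BddCurve T (ext v) (Real.exp (l * T) * ‖v‖) := fun v => by
    refine ⟨?_, by positivity, fun t ht => ?_⟩
    · rw [continuousOn_iff_continuous_domRestrict]
      have : (Ioo 0 T).domRestrict (ext v) = fun t : Ioo 0 T => Real.exp (l * t) • v t := by
        ext1 t
        rw [domRestrict_apply]
        exact dif_pos t.2
      rw [this]
      exact (by fun_prop : Continuous fun t : Ioo 0 T => Real.exp (l * t)).smul v.continuous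
    · simp only [ext, dif_pos ht]
      rw [norm_smul, Real.norm_of_nonneg (Real.exp_pos _).le]
      exact mul_le_mul (Real.exp_le_exp.2 (mul_le_mul_of_nonneg_left ht.2.le hl0.le))
        (v.norm_coe_le_norm _) (norm_nonneg _) (Real.exp_pos _).le
  have hcurve : ∀ v, BddCurve T (fun τ => f τ - B τ (ext v τ)) (C + N * (Real.exp (l * T) * ‖v‖)) :=
    fun v => hf.sub (hB.bddCurve (hext v))
  -- the fixed point map for `exp (-l t) u(t)`, in the space of bounded continuous curves
  let Φ : BoundedContinuousFunction (Ioo 0 T) E → BoundedContinuousFunction (Ioo 0 T) E := fun v =>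
    BoundedContinuousFunction.ofNormedAddCommGroup
      (fun t : Ioo 0 T => Real.exp (-(l * t)) • duhamel S (fun τ => f τ - B τ (ext v τ)) t)
      ((by fun_prop : Continuous fun t : Ioo 0 T => Real.exp (-(l * t))).smul
        (continuousOn_iff_continuous_domRestrict.1 (hS.bddCurve_duhamel (hcurve v) hT).cont))
      (M * (C + N * (Real.exp (l * T) * ‖v‖)) * T) (fun t => by
        rw [norm_smul, Real.norm_of_nonneg (Real.exp_pos _).le]
        refine (mul_le_of_le_one_left (norm_nonneg _) ?_).trans
          ((hS.bddCurve_duhamel (hcurve v) hT).bound t t.2)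
        exact Real.exp_le_one_iff.2 (neg_nonpos.2 (mul_nonneg hl0.le t.2.1.le)))
  have hΦ : ∀ v t, Φ v t = Real.exp (-(l * t)) • duhamel S (fun τ => f τ - B τ (ext v τ)) t :=
    fun _ _ => rfl
  have hhalf : ∀ v w : BoundedContinuousFunction (Ioo 0 T) E, ∀ t : Ioo 0 T,
      ‖Φ v t - Φ w t‖ ≤ ‖v - w‖ / 2 := fun v w t => by
    have hdiff : ∀ τ, ext v τ - ext w τ = ext (v - w) τ := fun τ => by
      by_cases h : τ ∈ Ioo 0 T
      · simp only [ext, dif_pos h, BoundedContinuousFunction.coe_sub, Pi.sub_apply, smul_sub]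
      · simp only [ext, dif_neg h, sub_zero]
    have e : Φ v t - Φ w t =
        -(Real.exp (-(l * t)) • duhamel S (fun τ => B τ (ext (v - w) τ)) t) := by
      rw [hΦ, hΦ, ← smul_sub, ← smul_neg, hS.duhamel_sub hf (hB.bddCurve (hext v)) t.2,
        hS.duhamel_sub hf (hB.bddCurve (hext w)) t.2]
      have := hS.duhamel_sub (hB.bddCurve (hext v)) (hB.bddCurve (hext w)) t.2
      simp only [← map_sub, hdiff] at this
      rw [this]
      congr 1
      abel
    have h1 := volterra_weighted (d := ext (v - w)) (K := ‖v - w‖) hS hB (fun τ hτ => by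
      simp only [ext, dif_pos hτ]
      rw [norm_smul, Real.norm_of_nonneg (Real.exp_pos _).le, mul_comm]
      exact mul_le_mul_of_nonneg_right ((v - w).norm_coe_le_norm _) (Real.exp_pos _).le) t.2
    rw [e, norm_neg, norm_smul, Real.norm_of_nonneg (Real.exp_pos _).le]
    refine (mul_le_mul_of_nonneg_left h1 (Real.exp_pos _).le).trans (le_of_eq ?_)
    rw [mul_left_comm, ← Real.exp_add]
    simp [hl]
  have hcontr : ContractingWith (1 / 2) Φ := by
    refine ⟨by rw [← NNReal.coe_lt_coe]; norm_num, LipschitzWith.of_dist_le_mul fun v w => ?_⟩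
    rw [dist_eq_norm, dist_eq_norm, BoundedContinuousFunction.norm_le (by positivity)]
    intro t
    refine (hhalf v w t).trans (le_of_eq ?_)
    push_cast
    ring
  set v := hcontr.fixedPoint Φ with hv
  have hfix : Φ v = v := hcontr.fixedPoint_isFixedPt
  have hvn : ‖v‖ ≤ 2 * (M * C * T) := by
    have h1 : ‖v‖ ≤ M * C * T + ‖v‖ / 2 := by
      refine (BoundedContinuousFunction.norm_le (by positivity)).2 fun t => ?_
      have h2 := hhalf v 0 t
      rw [hfix, sub_zero] at h2
      have h3 : ‖Φ 0 t‖ ≤ M * C * T := by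
        rw [hΦ, norm_smul, Real.norm_of_nonneg (Real.exp_pos _).le]
        have e0 : (fun τ => f τ - B τ (ext 0 τ)) = f := by
          ext1 τ
          have : ext 0 τ = 0 := by
            by_cases h : τ ∈ Ioo 0 T
            · simp [ext]
            · simp only [ext, dif_neg h]
          rw [this, map_zero, sub_zero]
        rw [e0]
        refine (mul_le_of_le_one_left (norm_nonneg _) ?_).trans
          ((hS.bddCurve_duhamel hf hT).bound t t.2)
        exact Real.exp_le_one_iff.2 (neg_nonpos.2 (mul_nonneg hl0.le t.2.1.le))
      calc ‖v t‖ = ‖Φ 0 t + (v t - Φ 0 t)‖ := by rw [add_sub_cancel]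
        _ ≤ _ := (norm_add_le _ _).trans (add_le_add h3 h2)
    linarith
  refine ⟨ext v, (hext v).mono ?_, fun t ht => ?_⟩
  · calc Real.exp (l * T) * ‖v‖ ≤ Real.exp (l * T) * (2 * (M * C * T)) :=
        mul_le_mul_of_nonneg_left hvn (Real.exp_pos _).le
      _ = _ := by ring
  · have h1 := congrArg (fun w => Real.exp (l * t) • w ⟨t, ht⟩) hfix
    simp only [hΦ, smul_smul, ← Real.exp_add, add_neg_cancel, Real.exp_zero, one_smul] at h1
    have h2 : ext v t = Real.exp (l * t) • v ⟨t, ht⟩ := by simp only [ext, dif_pos ht]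
    rw [h2, ← h1]

end Volterra

end

noncomputable section

/-! ### Space-time regularity of curves in `L²(ℝ³)` -/

/-- `v` is a first derivative of the curve `u` on `(0,T)`: the time derivative for `none`, the weak
space derivative `∂ᵢ` for `some i`. -/
def IsD (T : ℝ) : Option (Fin 3) → (ℝ → L2R3) → (ℝ → L2R3) → Prop
  | none, u, v => ∀ t ∈ Ioo 0 T, HasDerivAt u (v t) t
  | some i, u, v => ∀ t ∈ Ioo 0 T, HasWeakDeriv i (u t) (v t)

/-- The direction in space-time in which `IsD` differentiates. -/
def dirVec : Option (Fin 3) → ℝ × R3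
  | none => (1, 0)
  | some i => (0, e3 i)

/-- All mixed derivatives of `u` in time and space, of order at most `m`, are continuous curves in
`L²(ℝ³)` on `(0,T)` that are bounded by `C`. -/
def Reg (T : ℝ) : ℕ → (ℝ → L2R3) → ℝ → Prop
  | 0, u, C => BddCurve T u C
  | m + 1, u, C => BddCurve T u C ∧ ∀ μ, ∃ v, IsD T μ u v ∧ Reg T m v C

/-- Multiplication of a curve by a coefficient. -/
def coeffMul (W : ℝ × R3 → ℂ) (u : ℝ → L2R3) (t : ℝ) : L2R3 := mulB (slice W t) (u t)

section

variable {T : ℝ}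

theorem IsD.add {μ : Option (Fin 3)} {u v u' v' : ℝ → L2R3} (hu : IsD T μ u u')
    (hv : IsD T μ v v') : IsD T μ (u + v) (u' + v') := by
  cases μ with
  | none => exact fun t ht => (hu t ht).add (hv t ht)
  | some i => exact fun t ht => (hu t ht).add (hv t ht)

theorem IsD.smul (c : ℂ) {μ : Option (Fin 3)} {u u' : ℝ → L2R3} (hu : IsD T μ u u') :
    IsD T μ (c • u) (c • u') := by
  cases μ with
  | none => exact fun t ht => (hu t ht).const_smul c
  | some i => exact fun t ht => (hu t ht).smul c

theorem IsD.congr {μ : Option (Fin 3)} {u v u' v' : ℝ → L2R3} (hu : IsD T μ u u')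
    (h : ∀ t ∈ Ioo 0 T, v t = u t) (h' : ∀ t ∈ Ioo 0 T, v' t = u' t) : IsD T μ v v' := by
  cases μ with
  | none =>
    intro t ht
    rw [h' t ht]
    refine HasDerivAt.congr_of_eventuallyEq (hu t ht) ?_
    filter_upwards [isOpen_Ioo.mem_nhds ht] with s hs
    exact h s hs
  | some i =>
    intro t ht
    rw [h' t ht, h t ht]
    exact hu t ht

theorem IsD.unique {μ : Option (Fin 3)} {u v w : ℝ → L2R3} (hv : IsD T μ u v) (hw : IsD T μ u w) :
    ∀ t ∈ Ioo 0 T, v t = w t := by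
  cases μ with
  | none => exact fun t ht => HasDerivAt.unique (hv t ht) (hw t ht)
  | some i => exact fun t ht => HasWeakDeriv.unique (hv t ht) (hw t ht)

theorem IsD.coeffMul {W : ℝ × R3 → ℂ} (hW : IsCoeff W) {μ : Option (Fin 3)} {u v : ℝ → L2R3}
    (h : IsD T μ u v) :
    IsD T μ (coeffMul W u) (_root_.coeffMul (dirD (dirVec μ) W) u + _root_.coeffMul W v) := by
  cases μ with
  | none => exact fun t ht => hW.hasDerivAt (h t ht)
  | some i => exact fun t ht => hW.hasWeakDeriv (h t ht) t

/-- Mixed second derivatives commute. -/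
theorem IsD.comm {i : Fin 3} {u v u' v' : ℝ → L2R3} (hv : IsD T (some i) u v)
    (hu' : IsD T none u u') (hv' : IsD T none v v') : IsD T (some i) u' v' := fun t ht =>
  HasWeakDeriv.of_hasDerivAt (by
    filter_upwards [isOpen_Ioo.mem_nhds ht] with s hs
    exact hv s hs) (hu' t ht) (hv' t ht)

theorem Reg.bdd {m : ℕ} {u : ℝ → L2R3} {C : ℝ} (h : Reg T m u C) : BddCurve T u C := by
  cases m with
  | zero => exact h
  | succ m => exact h.1

theorem Reg.nonneg {m : ℕ} {u : ℝ → L2R3} {C : ℝ} (h : Reg T m u C) : 0 ≤ C := h.bdd.nonneg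

theorem Reg.mono {m : ℕ} {u : ℝ → L2R3} {C D : ℝ} (h : Reg T m u C) (hD : C ≤ D) :
    Reg T m u D := by
  induction m generalizing u with
  | zero => exact BddCurve.mono h hD
  | succ m ih =>
    refine ⟨h.1.mono hD, fun μ => ?_⟩
    obtain ⟨v, h1, h2⟩ := h.2 μ
    exact ⟨v, h1, ih h2⟩

theorem Reg.pred {m : ℕ} {u : ℝ → L2R3} {C : ℝ} (h : Reg T (m + 1) u C) : Reg T m u C := by
  induction m generalizing u with
  | zero => exact h.1
  | succ m ih =>
    refine ⟨h.1, fun μ => ?_⟩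
    obtain ⟨v, h1, h2⟩ := h.2 μ
    exact ⟨v, h1, ih h2⟩

theorem Reg.of_le {m n : ℕ} {u : ℝ → L2R3} {C : ℝ} (h : Reg T m u C) (hn : n ≤ m) :
    Reg T n u C := by
  induction m, hn using Nat.le_induction with
  | base => exact h
  | succ m _ ih => exact ih h.pred

theorem Reg.congr {m : ℕ} {u v : ℝ → L2R3} {C : ℝ} (h : Reg T m u C)
    (huv : ∀ t ∈ Ioo 0 T, v t = u t) : Reg T m v C := by
  cases m with
  | zero => exact BddCurve.congr h huv
  | succ m =>
    refine ⟨h.1.congr huv, fun μ => ?_⟩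
    obtain ⟨w, h1, h2⟩ := h.2 μ
    exact ⟨w, h1.congr huv fun _ _ => rfl, h2⟩

theorem Reg.add {m : ℕ} {u v : ℝ → L2R3} {C D : ℝ} (hu : Reg T m u C) (hv : Reg T m v D) :
    Reg T m (u + v) (C + D) := by
  induction m generalizing u v with
  | zero => exact BddCurve.add hu hv
  | succ m ih =>
    refine ⟨hu.1.add hv.1, fun μ => ?_⟩
    obtain ⟨u', h1, h2⟩ := hu.2 μ
    obtain ⟨v', h3, h4⟩ := hv.2 μ
    exact ⟨u' + v', h1.add h3, ih h2 h4⟩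

theorem Reg.smul {m : ℕ} {u : ℝ → L2R3} {C : ℝ} (c : ℂ) (hu : Reg T m u C) :
    Reg T m (c • u) (‖c‖ * C) := by
  induction m generalizing u with
  | zero =>
    have hu : BddCurve T u C := hu
    exact ⟨hu.cont.const_smul c, mul_nonneg (norm_nonneg _) hu.nonneg, fun t ht => by
      rw [Pi.smul_apply, norm_smul]
      exact mul_le_mul_of_nonneg_left (hu.bound t ht) (norm_nonneg _)⟩
  | succ m ih =>
    refine ⟨⟨hu.1.cont.const_smul c, mul_nonneg (norm_nonneg _) hu.1.nonneg, fun t ht => by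
      rw [Pi.smul_apply, norm_smul]
      exact mul_le_mul_of_nonneg_left (hu.1.bound t ht) (norm_nonneg _)⟩, fun μ => ?_⟩
    obtain ⟨u', h1, h2⟩ := hu.2 μ
    exact ⟨c • u', h1.smul c, ih h2⟩

theorem Reg.sub {m : ℕ} {u v : ℝ → L2R3} {C D : ℝ} (hu : Reg T m u C) (hv : Reg T m v D) :
    Reg T m (u - v) (C + D) := by
  have h := hu.add (hv.smul (-1))
  rw [neg_one_smul, ← sub_eq_add_neg, norm_neg, norm_one, one_mul] at h
  exact h

theorem IsCoeff.opFam {W : ℝ × R3 → ℂ} (hW : IsCoeff W) (T : ℝ) :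
    ∃ N, OpFam T (fun t => mulB (slice W t)) N := by
  obtain ⟨M, hM⟩ := hW.exists_bound
  exact ⟨M, fun u hu => hW.continuous_mulB.continuousOn.clm_apply hu, (hM 0).nonneg,
    fun t _ x => (hM t).norm_mulB_le x⟩

/-- Multiplication by a smooth compactly supported coefficient preserves regularity. -/
theorem IsCoeff.reg (T : ℝ) (m : ℕ) : ∀ {W : ℝ × R3 → ℂ}, IsCoeff W → ∃ c : ℝ, 0 ≤ c ∧
    ∀ u C, Reg T m u C → Reg T m (coeffMul W u) (c * C) := by
  induction m with
  | zero =>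
    intro W hW
    obtain ⟨N, hN⟩ := hW.opFam T
    exact ⟨N, hN.nonneg, fun u C hu => hN.bddCurve hu⟩
  | succ m ih =>
    intro W hW
    obtain ⟨N, hN⟩ := hW.opFam T
    obtain ⟨c, hc0, hc⟩ := ih hW
    choose c' hc0' hc' using fun μ => ih (hW.dirD (dirVec μ))
    have hs : ∀ μ, c' μ ≤ ∑ ν, c' ν := fun μ =>
      Finset.single_le_sum (fun ν _ => hc0' ν) (Finset.mem_univ μ)
    have hs0 : 0 ≤ ∑ ν, c' ν := Finset.sum_nonneg fun ν _ => hc0' ν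
    have hN0 := hN.nonneg
    refine ⟨N + c + ∑ μ, c' μ, by positivity, fun u C hu => ?_⟩
    have hC := hu.nonneg
    refine ⟨(hN.bddCurve hu.1).mono ?_, fun μ => ?_⟩
    · exact mul_le_mul_of_nonneg_right (by linarith) hC
    · obtain ⟨v, h1, h2⟩ := hu.2 μ
      refine ⟨_, h1.coeffMul hW, ((hc' μ _ _ hu.pred).add (hc _ _ h2)).mono ?_⟩
      rw [← add_mul]
      exact mul_le_mul_of_nonneg_right (by linarith [hs μ]) hC

/-! ### Products of regular curves -/

/-- The product of two `L²` functions, zero if it is not square integrable. -/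
def prodL2 (f g : L2R3) : L2R3 := toL2 fun x => f x * g x

theorem prodL2_comm (f g : L2R3) : prodL2 f g = prodL2 g f := by
  simp only [prodL2, mul_comm]

theorem EssBdd.prodL2_eq {f : L2R3} {M : ℝ} (hf : EssBdd f M) (g : L2R3) :
    prodL2 f g = mulB f g :=
  Lp.ext ((coe_toL2 (hf.memLp_mul (Lp.memLp g))).trans (hf.coe_mulB g).symm)

/-- On regular curves, the Sobolev embedding `H² ⊂ L^∞`. -/
theorem exists_reg_two_bound : ∃ c : ℝ, 0 ≤ c ∧ ∀ {T : ℝ} {u : ℝ → L2R3} {C : ℝ}, Reg T 2 u C →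
    (∀ t ∈ Ioo 0 T, EssBdd (u t) (c * C)) ∧ ContinuousOn (fun t => mulB (u t)) (Ioo 0 T) := by
  obtain ⟨c, hc0, hc⟩ := sobolev_embedding
  refine ⟨c * 4, by positivity, fun {T u C} hu => ?_⟩
  choose d hd hd' using fun i => hu.2 (some i)
  choose dd hdd hdd' using fun i => (hd' i).2 (some i)
  have hdd0 : ∀ i, BddCurve T (dd i) C := hdd'
  have hE : ∀ t ∈ Ioo 0 T, EssBdd (u t) (c * 4 * C) := fun t ht => by
    refine (hc (u t) (fun i => d i t) (fun i => dd i t) (fun i => hd i t ht)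
      (fun i => hdd i t ht)).mono ?_
    rw [mul_assoc]
    refine mul_le_mul_of_nonneg_left ?_ hc0
    rw [Fin.sum_univ_three]
    linarith [hu.bdd.bound t ht, (hdd0 0).bound t ht, (hdd0 1).bound t ht, (hdd0 2).bound t ht]
  refine ⟨hE, fun t ht => ?_⟩
  refine tendsto_iff_norm_sub_tendsto_zero.2 ?_
  have hlim : Tendsto (fun s => c * (‖u s - u t‖ + ∑ i, ‖dd i s - dd i t‖)) (𝓝[Ioo 0 T] t)
      (𝓝 (c * (0 + ∑ _i : Fin 3, 0))) := by
    refine Tendsto.const_mul c (Tendsto.add ?_ (tendsto_finsetSum _ fun i _ => ?_))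
    · exact tendsto_iff_norm_sub_tendsto_zero.1 (hu.bdd.cont t ht)
    · exact tendsto_iff_norm_sub_tendsto_zero.1 ((hdd0 i).cont t ht)
  simp only [Finset.sum_const_zero, add_zero, mul_zero] at hlim
  refine squeeze_zero' (.of_forall fun _ => norm_nonneg _) ?_ hlim
  filter_upwards [self_mem_nhdsWithin] with s hs
  have h1 := hc (u s - u t) (fun i => d i s - d i t) (fun i => dd i s - dd i t)
    (fun i => HasWeakDeriv.sub (hd i s hs) (hd i t ht))
    (fun i => HasWeakDeriv.sub (hdd i s hs) (hdd i t ht))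
  have h2 : EssBdd (⇑(u s) - ⇑(u t)) (c * (‖u s - u t‖ + ∑ i, ‖dd i s - dd i t‖)) :=
    h1.congr (Lp.coeFn_sub _ _)
  rw [← mulB_sub (hE s hs) (hE t ht)]
  exact h2.opNorm_mulB_le

theorem Reg.memLp_mul {a b : ℕ} {u v : ℝ → L2R3} {A B : ℝ} (hu : Reg T a u A) (hv : Reg T b v B)
    (hab : 3 ≤ a + b) {t : ℝ} (ht : t ∈ Ioo 0 T) : MemLp (fun x => u t x * v t x) 2 leb3 := by
  obtain ⟨c, _, hc⟩ := exists_reg_two_bound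
  rcases (by omega : 2 ≤ a ∨ 2 ≤ b) with h | h
  · exact ((hc (hu.of_le h)).1 t ht).memLp_mul (Lp.memLp _)
  · simpa only [mul_comm] using ((hc (hv.of_le h)).1 t ht).memLp_mul (Lp.memLp (u t))

/-- The product of two regular curves is a continuous curve in `L²`: for `3 ≤ a + b` one of the
factors has two derivatives, hence is bounded. -/
theorem exists_bddCurve_prod : ∃ c : ℝ, 0 ≤ c ∧ ∀ {T : ℝ} {a b : ℕ} {u v : ℝ → L2R3} {A B : ℝ},
    3 ≤ a + b → Reg T a u A → Reg T b v B →
      BddCurve T (fun t => prodL2 (u t) (v t)) (c * (A * B)) := by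
  obtain ⟨c, hc0, hc⟩ := exists_reg_two_bound
  have key : ∀ {T : ℝ} {b : ℕ} {u v : ℝ → L2R3} {A B : ℝ}, Reg T 2 u A → Reg T b v B →
      BddCurve T (fun t => prodL2 (u t) (v t)) (c * (A * B)) := fun {T b u v A B} hu hv => by
    obtain ⟨h1, h2⟩ := hc hu
    refine BddCurve.congr (F := fun t => mulB (u t) (v t)) ⟨h2.clm_apply hv.bdd.cont, ?_, ?_⟩
      fun t ht => (h1 t ht).prodL2_eq _
    · exact mul_nonneg hc0 (mul_nonneg hu.nonneg hv.nonneg)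
    · intro t ht
      rw [← mul_assoc]
      exact ((h1 t ht).norm_mulB_le _).trans
        (mul_le_mul_of_nonneg_left (hv.bdd.bound t ht) (mul_nonneg hc0 hu.nonneg))
  refine ⟨c, hc0, fun {T a b u v A B} hab hu hv => ?_⟩
  rcases (by omega : 2 ≤ a ∨ 2 ≤ b) with h | h
  · exact key (hu.of_le h) hv
  · rw [mul_comm A B]
    simp_rw [prodL2_comm (u _) (v _)]
    exact key (hv.of_le h) hu

/-- A product, tested against `φ`, is a bounded bilinear form on `L²(ℝ³)`. -/
theorem tpair_prodL2 {φ : R3 → ℝ} (hφ : IsTest φ) {f g : L2R3}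
    (h : MemLp (fun x => f x * g x) 2 leb3) :
    tpair (ofR φ) (prodL2 f g) = pair (mulB (ofR φ) f) g := by
  obtain ⟨M, hM⟩ := hφ.ofReal.essBdd
  rw [tpair_apply hφ.ofReal.memLp, pair_apply]
  refine integral_congr_ae ?_
  filter_upwards [coe_toL2 h, hM.coe_mulB f] with x h1 h2
  rw [prodL2, h1, h2, mul_assoc]

/-- The Leibniz rule for products of regular curves. It holds in `L¹`, hence in `L²` as soon as its
right side is a continuous curve in `L²`. -/
theorem IsD.prodL2 {μ : Option (Fin 3)} {u v u' v' : ℝ → L2R3} (hu : IsD T μ u u')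
    (hv : IsD T μ v v')
    (h0 : ∀ t ∈ Ioo 0 T, MemLp (fun x => u t x * v t x) 2 leb3)
    (h1 : ∀ t ∈ Ioo 0 T, MemLp (fun x => u' t x * v t x) 2 leb3)
    (h2 : ∀ t ∈ Ioo 0 T, MemLp (fun x => u t x * v' t x) 2 leb3)
    (hc : ContinuousOn (fun t => _root_.prodL2 (u' t) (v t) + _root_.prodL2 (u t) (v' t)) (Ioo 0 T)) :
    IsD T μ (fun t => _root_.prodL2 (u t) (v t))
      (fun t => _root_.prodL2 (u' t) (v t) + _root_.prodL2 (u t) (v' t)) := by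
  cases μ with
  | some i =>
    intro t ht φ hφ
    rw [map_add, tpair_prodL2 hφ (h1 t ht), tpair_prodL2 hφ (h2 t ht),
      tpair_prodL2 (hφ.pd i) (h0 t ht)]
    have := HasWeakDeriv.pair_mulB (hu t ht) (hv t ht) hφ.ofReal
    rwa [show pd i (ofR φ) = ofR (pd i φ) from funext fun x => pd_ofReal hφ.smooth i x] at this
  | none =>
    intro t ht
    refine hasDerivAt_of_tpair hc (fun φ hφ s hs => ?_) ht
    rw [map_add, tpair_prodL2 hφ (h1 s hs), tpair_prodL2 hφ (h2 s hs)]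
    have e : (fun r => tpair (ofR φ) (_root_.prodL2 (u r) (v r))) =ᶠ[𝓝 s]
        fun r => pair (mulB (ofR φ) (u r)) (v r) := by
      filter_upwards [isOpen_Ioo.mem_nhds hs] with r hr
      rw [tpair_prodL2 hφ (h0 r hr)]
    refine HasDerivAt.congr_of_eventuallyEq ?_ e
    have d1 : HasDerivAt (fun r => (pair (mulB (ofR φ) (u r))).restrictScalars ℝ)
        ((pair (mulB (ofR φ) (u' s))).restrictScalars ℝ) s :=
      ((ContinuousLinearMap.restrictScalarsL ℂ L2R3 ℂ ℝ ℝ).comp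
        ((pair.comp (mulB (ofR φ))).restrictScalars ℝ)).hasFDerivAt.comp_hasDerivAt s (hu s hs)
    exact d1.clm_apply (hv s hs)

/-- Products of regular curves are regular. -/
theorem exists_reg_prod (n : ℕ) : ∀ a b : ℕ, n ≤ a → n ≤ b → n + 3 ≤ a + b → ∃ c : ℝ, 0 ≤ c ∧
    ∀ {T : ℝ} {u v : ℝ → L2R3} {A B : ℝ}, Reg T a u A → Reg T b v B →
      Reg T n (fun t => prodL2 (u t) (v t)) (c * (A * B)) := by
  obtain ⟨c₀, hc₀, hb⟩ := exists_bddCurve_prod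
  induction n with
  | zero => exact fun a b _ _ hab => ⟨c₀, hc₀, fun hu hv => hb (by omega) hu hv⟩
  | succ n ih =>
    intro a b ha hb' hab
    obtain ⟨a, rfl⟩ : ∃ k, a = k + 1 := ⟨a - 1, by omega⟩
    obtain ⟨b, rfl⟩ : ∃ k, b = k + 1 := ⟨b - 1, by omega⟩
    obtain ⟨c₁, hc₁, h₁⟩ := ih a (b + 1) (by omega) (by omega) (by omega)
    obtain ⟨c₂, hc₂, h₂⟩ := ih (a + 1) b (by omega) (by omega) (by omega)
    refine ⟨c₀ + c₁ + c₂, by positivity, fun {T u v A B} hu hv => ?_⟩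
    have hAB : 0 ≤ A * B := mul_nonneg hu.nonneg hv.nonneg
    refine ⟨(hb (by omega) hu hv).mono (mul_le_mul_of_nonneg_right (by linarith) hAB), fun μ => ?_⟩
    obtain ⟨u', hu1, hu2⟩ := hu.2 μ
    obtain ⟨v', hv1, hv2⟩ := hv.2 μ
    have hr := (h₁ hu2 hv).add (h₂ hu hv2)
    refine ⟨_, hu1.prodL2 hv1 (fun t ht => hu.memLp_mul hv (by omega) ht)
      (fun t ht => hu2.memLp_mul hv (by omega) ht) (fun t ht => hu.memLp_mul hv2 (by omega) ht)
      hr.bdd.cont, hr.mono ?_⟩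
    rw [← add_mul]
    exact mul_le_mul_of_nonneg_right (by linarith) hAB

end

end

noncomputable section

/-! ### Regularity of mild solutions of the wave equation -/

variable {T : ℝ}

theorem strongFam_sinProp (hT : 0 ≤ T) : StrongFam T sinProp T :=
  ⟨fun g => continuous_iff_continuousAt.2 fun t => (hasDerivAt_sinProp g t).continuousAt, hT,
    fun t ht g => (norm_sinProp_le t g).trans (mul_le_mul_of_nonneg_right ht (norm_nonneg g))⟩

theorem strongFam_cosProp (T : ℝ) : StrongFam T cosProp 1 :=
  ⟨continuous_cosProp, zero_le_one, fun t _ g => by rw [one_mul]; exact norm_cosProp_le t g⟩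

theorem StrongFam.comp {X E Y : Type*} [NormedAddCommGroup X] [NormedSpace ℂ X]
    [NormedAddCommGroup E] [NormedSpace ℂ E] [NormedAddCommGroup Y] [NormedSpace ℂ Y] {M : ℝ}
    {A : ℝ → X →L[ℂ] E} (hA : StrongFam T A M) (L : E →L[ℂ] Y) :
    StrongFam T (fun t => L.comp (A t)) (‖L‖ * M) :=
  ⟨fun x => L.continuous.comp (hA.cont x), mul_nonneg (norm_nonneg _) hA.nonneg, fun t ht x =>
    (L.le_opNorm _).trans (by
      rw [mul_assoc]
      exact mul_le_mul_of_nonneg_left (hA.bound t ht x) (norm_nonneg _))⟩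

/-- `u` is the mild solution of `∂ₜ²u - Δu + W u = f` with zero initial values: it satisfies
Duhamel's formula. -/
def IsMild (T : ℝ) (W : ℝ × R3 → ℂ) (f u : ℝ → L2R3) : Prop :=
  ∀ t ∈ Ioo 0 T, u t = duhamel sinProp (f - coeffMul W u) t

theorem exists_isMild (hT : 0 ≤ T) {W : ℝ × R3 → ℂ} (hW : IsCoeff W) : ∃ c : ℝ, 0 ≤ c ∧
    ∀ f C, BddCurve T f C → ∃ u, BddCurve T u (c * C) ∧ IsMild T W f u := by
  obtain ⟨N, hN⟩ := hW.opFam T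
  exact volterra_exists hT (strongFam_sinProp hT) hN

theorem IsMild.unique (hT : 0 ≤ T) {W : ℝ × R3 → ℂ} (hW : IsCoeff W) {f u v : ℝ → L2R3}
    {C A B : ℝ} (hf : BddCurve T f C) (hu : BddCurve T u A) (hv : BddCurve T v B)
    (h : IsMild T W f u) (h' : IsMild T W f v) : ∀ t ∈ Ioo 0 T, u t = v t := by
  obtain ⟨N, hN⟩ := hW.opFam T
  exact volterra_unique (strongFam_sinProp hT) hN hf hu hv h h'

theorem IsCoeff.bddCurve {W : ℝ × R3 → ℂ} (hW : IsCoeff W) {u : ℝ → L2R3} {C : ℝ}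
    (hu : BddCurve T u C) : ∃ D, BddCurve T (coeffMul W u) D := by
  obtain ⟨N, hN⟩ := hW.opFam T
  exact ⟨_, hN.bddCurve hu⟩

/-- The graph of the weak derivative `∂ᵢ` in `L²(ℝ³)`. -/
def weakGraph (i : Fin 3) : Submodule ℂ (L2R3 × L2R3) where
  carrier := {p | HasWeakDeriv i p.1 p.2}
  zero_mem' := HasWeakDeriv.zero i
  add_mem' := fun ha hb => HasWeakDeriv.add ha hb
  smul_mem' := fun c _ ha => HasWeakDeriv.smul c ha

instance (i : Fin 3) : CompleteSpace (weakGraph i) :=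
  (isClosed_hasWeakDeriv i).completeSpace_coe

/-- The propagator `S(t)` on the graph of `∂ᵢ`, with which it commutes. -/
def graphProp (i : Fin 3) (t : ℝ) : weakGraph i →L[ℂ] weakGraph i :=
  (((sinProp t).prodMap (sinProp t)).comp (weakGraph i).subtypeL).codRestrict (weakGraph i)
    fun p => (essBdd_sinSymbol t).hasWeakDeriv_fmul p.2

/-- Multiplication by `W(t,·)` on the graph of `∂ᵢ`, by the Leibniz rule. -/
def graphMul {W : ℝ × R3 → ℂ} (hW : IsCoeff W) (i : Fin 3) (t : ℝ) :
    weakGraph i →L[ℂ] weakGraph i :=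
  (((mulB (slice W t)).comp ((ContinuousLinearMap.fst ℂ L2R3 L2R3).comp (weakGraph i).subtypeL)).prod
    ((mulB (slice (dirD (0, e3 i) W) t)).comp
        ((ContinuousLinearMap.fst ℂ L2R3 L2R3).comp (weakGraph i).subtypeL) +
      (mulB (slice W t)).comp
        ((ContinuousLinearMap.snd ℂ L2R3 L2R3).comp (weakGraph i).subtypeL))).codRestrict
    (weakGraph i) fun p => hW.hasWeakDeriv p.2 t

theorem strongFam_graphProp (hT : 0 ≤ T) (i : Fin 3) : StrongFam T (graphProp i) T := by
  have h := strongFam_sinProp hT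
  refine ⟨fun p => Continuous.subtype_mk ((h.cont p.1.1).prodMk (h.cont p.1.2)) _, hT,
    fun t ht p => ?_⟩
  exact max_le ((h.bound t ht p.1.1).trans (mul_le_mul_of_nonneg_left (norm_fst_le p.1) hT))
    ((h.bound t ht p.1.2).trans (mul_le_mul_of_nonneg_left (norm_snd_le p.1) hT))

theorem opFam_graphMul {W : ℝ × R3 → ℂ} (hW : IsCoeff W) (i : Fin 3) (T : ℝ) :
    ∃ N, OpFam T (graphMul hW i) N := by
  obtain ⟨N, hN⟩ := hW.opFam T
  obtain ⟨N', hN'⟩ := (hW.dirD (0, e3 i)).opFam T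
  refine ⟨N' + N, fun u hu => ?_, add_nonneg hN'.nonneg hN.nonneg, fun t ht p => ?_⟩
  · rw [Topology.IsInducing.subtypeVal.continuousOn_iff] at hu ⊢
    have h1 : ContinuousOn (fun t => (u t).1.1) (Ioo 0 T) := continuous_fst.comp_continuousOn hu
    have h2 : ContinuousOn (fun t => (u t).1.2) (Ioo 0 T) := continuous_snd.comp_continuousOn hu
    exact (hN.cont _ h1).prodMk ((hN'.cont _ h1).add (hN.cont _ h2))
  · have h1 : ‖p.1.1‖ ≤ ‖p‖ := norm_fst_le p.1
    have h2 : ‖p.1.2‖ ≤ ‖p‖ := norm_snd_le p.1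
    have h3 := mul_le_mul_of_nonneg_left h1 hN.nonneg
    have h4 := mul_le_mul_of_nonneg_left h1 hN'.nonneg
    have h5 := mul_le_mul_of_nonneg_left h2 hN.nonneg
    have h6 := hN.bound t ht p.1.1
    have h7 := hN'.bound t ht p.1.1
    have h8 := hN.bound t ht p.1.2
    have h9 : 0 ≤ N' * ‖p‖ := mul_nonneg hN'.nonneg (norm_nonneg _)
    refine max_le ?_ ((norm_add_le _ _).trans ?_)
    · change ‖mulB (slice W t) p.1.1‖ ≤ _
      linarith
    · change ‖mulB (slice (dirD (0, e3 i) W) t) p.1.1‖ + ‖mulB (slice W t) p.1.2‖ ≤ _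
      linarith

/-- The spatial derivative of a mild solution is the mild solution of the differentiated
equation. -/
theorem IsMild.isD_space (hT : 0 ≤ T) {W : ℝ × R3 → ℂ} (hW : IsCoeff W) {i : Fin 3}
    {f f' u v : ℝ → L2R3} {C C' A B : ℝ} (hf : BddCurve T f C) (hf' : BddCurve T f' C')
    (hff : IsD T (some i) f f') (hu : BddCurve T u A) (h : IsMild T W f u) (hv : BddCurve T v B)
    (h' : IsMild T W (f' - coeffMul (dirD (0, e3 i) W) u) v) : IsD T (some i) u v := by
  classical
  obtain ⟨N, hN⟩ := opFam_graphMul hW i T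
  have hS := strongFam_graphProp hT i
  obtain ⟨c, -, hc⟩ := volterra_exists hT hS hN
  -- solve the Volterra equation in the graph of `∂ᵢ`; its components are then `u` and `v`
  let F : ℝ → weakGraph i := fun t => if ht : t ∈ Ioo 0 T then ⟨(f t, f' t), hff t ht⟩ else 0
  have eF : ∀ t ∈ Ioo 0 T, (F t).1 = (f t, f' t) := fun t ht => by simp only [F, dif_pos ht]
  have hF : BddCurve T F (max C C') := by
    refine ⟨?_, le_max_of_le_left hf.nonneg, fun t ht => ?_⟩
    · rw [Topology.IsInducing.subtypeVal.continuousOn_iff]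
      exact (hf.cont.prodMk hf'.cont).congr eF
    · change ‖(F t).1‖ ≤ _
      rw [eF t ht]
      exact max_le_max (hf.bound t ht) (hf'.bound t ht)
  obtain ⟨U, hU, eU⟩ := hc F _ hF
  have hFU : BddCurve T (fun τ => F τ - graphMul hW i τ (U τ)) _ := hF.sub (hN.bddCurve hU)
  have hU1 : BddCurve T (fun t => (U t).1.1) (c * max C C') := by
    refine ⟨?_, hU.nonneg, fun t ht => (norm_fst_le (U t).1).trans (hU.bound t ht)⟩
    exact continuous_fst.comp_continuousOn (continuous_subtype_val.comp_continuousOn hU.cont)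
  have hU2 : BddCurve T (fun t => (U t).1.2) (c * max C C') := by
    refine ⟨?_, hU.nonneg, fun t ht => (norm_snd_le (U t).1).trans (hU.bound t ht)⟩
    exact continuous_snd.comp_continuousOn (continuous_subtype_val.comp_continuousOn hU.cont)
  have m1 : IsMild T W f (fun t => (U t).1.1) := fun t ht => by
    have h1 := hS.clm_duhamel hFU ((ContinuousLinearMap.fst ℂ L2R3 L2R3).comp (weakGraph i).subtypeL) ht
    rw [← eU t ht] at h1
    refine h1.trans (setIntegral_congr_fun measurableSet_Ioo fun τ hτ => ?_)
    change sinProp (t - τ) ((F τ).1.1 - mulB (slice W τ) (U τ).1.1) = _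
    rw [eF τ ⟨hτ.1, hτ.2.trans ht.2⟩]
    rfl
  have e1 := IsMild.unique hT hW hf hU1 hu m1 h
  have m2 : IsMild T W (f' - coeffMul (dirD (0, e3 i) W) u) (fun t => (U t).1.2) := fun t ht => by
    have h1 := hS.clm_duhamel hFU ((ContinuousLinearMap.snd ℂ L2R3 L2R3).comp (weakGraph i).subtypeL) ht
    rw [← eU t ht] at h1
    refine h1.trans (setIntegral_congr_fun measurableSet_Ioo fun τ hτ => ?_)
    have hτT : τ ∈ Ioo 0 T := ⟨hτ.1, hτ.2.trans ht.2⟩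
    change sinProp (t - τ) ((F τ).1.2 - (mulB (slice (dirD (0, e3 i) W) τ) (U τ).1.1 +
      mulB (slice W τ) (U τ).1.2)) = sinProp (t - τ) (f' τ - mulB (slice (dirD (0, e3 i) W) τ) (u τ) -
        mulB (slice W τ) (U τ).1.2)
    rw [eF τ hτT, ← e1 τ hτT, sub_sub]
  obtain ⟨D, hD⟩ := (hW.dirD (0, e3 i)).bddCurve hu
  have e2 := IsMild.unique hT hW (hf'.sub hD) hU2 hv m2 h'
  exact fun t ht => by
    rw [← e1 t ht, ← e2 t ht]
    exact (U t).2

/-- The time derivative of a mild solution. -/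
theorem IsMild.isD_time (hT : 0 ≤ T) {W : ℝ × R3 → ℂ} {f u : ℝ → L2R3} {C : ℝ}
    (hF : BddCurve T (f - coeffMul W u) C) (h : IsMild T W f u) :
    IsD T none u (duhamel cosProp (f - coeffMul W u)) :=
  IsD.congr (u := duhamel sinProp (f - coeffMul W u)) (fun t ht => by
    have h1 := (strongFam_sinProp hT).hasDerivAt_duhamel (strongFam_cosProp T)
      hasDerivAt_sinProp hF ht
    rw [sinProp_zero, show (0 : L2R3 →L[ℂ] L2R3) ((f - coeffMul W u) t) = 0 from rfl,
      zero_add] at h1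
    exact h1) h fun _ _ => rfl

/-- A mild solution satisfies `∂ₜ²u = Δu + f - W u`. -/
theorem IsMild.isD_time_time (hT : 0 ≤ T) {W : ℝ × R3 → ℂ} {f u : ℝ → L2R3} {C : ℝ}
    (hF : BddCurve T (f - coeffMul W u) C) (h : IsMild T W f u) {d dd : Fin 3 → ℝ → L2R3}
    (hd : ∀ i, IsD T (some i) u (d i)) (hdd : ∀ i, IsD T (some i) (d i) (dd i))
    (hc : ∀ i, ContinuousOn (dd i) (Ioo 0 T)) :
    IsD T none (duhamel cosProp (f - coeffMul W u)) (f - coeffMul W u + ∑ i, dd i) := by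
  set F := f - coeffMul W u with hFdef
  have hs : ContinuousOn (∑ i, dd i) (Ioo 0 T) := by
    have := continuousOn_finsetSum Finset.univ fun i _ => hc i
    exact this.congr fun t _ => by simp
  intro t ht
  refine hasDerivAt_of_tpair (hF.cont.add hs) (fun φ hφ t ht => ?_) ht
  have h1 := ((strongFam_cosProp T).comp (tpair (ofR φ))).hasDerivAt_duhamel
    ((strongFam_sinProp hT).comp (tpair (ofR (lap3 φ)))) (fun g t => hφ.hasDerivAt_cosProp g t) hF ht
  have e1 : duhamel (fun t => (tpair (ofR (lap3 φ))).comp (sinProp t)) F t =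
      tpair (ofR (lap3 φ)) (u t) := by
    rw [h t ht, (strongFam_sinProp hT).clm_duhamel hF _ ht]
    rfl
  have e2 : tpair (ofR (lap3 φ)) (u t) = ∑ i, tpair (ofR φ) (dd i t) := by
    have e3 : tpair (ofR (lap3 φ)) (u t) = ∑ i, tpair (ofR (pd i (pd i φ))) (u t) := by
      simp only [Fin.sum_univ_three]
      rw [← _root_.add_apply, ← _root_.add_apply,
        ← tpair_add ((hφ.pd 0).pd 0).ofReal.memLp ((hφ.pd 1).pd 1).ofReal.memLp,
        ← tpair_add (φ := fun x => ofR (pd 0 (pd 0 φ)) x + ofR (pd 1 (pd 1 φ)) x)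
          (((hφ.pd 0).pd 0).ofReal.memLp.add ((hφ.pd 1).pd 1).ofReal.memLp)
          ((hφ.pd 2).pd 2).ofReal.memLp]
      congr 2
      ext x
      simp [ofR, lap3, Fin.sum_univ_three]
    rw [e3]
    refine Finset.sum_congr rfl fun i _ => ?_
    rw [hd i t ht _ (hφ.pd i), hdd i t ht φ hφ, neg_neg]
  refine (h1.congr_of_eventuallyEq ?_).congr_deriv ?_
  · filter_upwards [isOpen_Ioo.mem_nhds ht] with s hs
    rw [(strongFam_cosProp T).clm_duhamel hF _ hs]
    rfl
  · rw [e1, e2, Pi.add_apply, map_add, Finset.sum_apply, map_sum, ContinuousLinearMap.comp_apply,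
      cosProp_zero]

/-- The mild solution is as regular as the source. -/
theorem exists_isMild_reg (hT : 0 ≤ T) {W : ℝ × R3 → ℂ} (hW : IsCoeff W) (s : ℕ) :
    ∃ c : ℝ, 0 ≤ c ∧ ∀ f C u A, Reg T s f C → BddCurve T u A → IsMild T W f u →
      Reg T s u (c * C) := by
  obtain ⟨c₀, hc₀, h₀⟩ := exists_isMild hT hW
  have h₀' : ∀ f C u A, BddCurve T f C → BddCurve T u A → IsMild T W f u →
      BddCurve T u (c₀ * C) := fun f C u A hf hu h => by
    obtain ⟨v, hv, hv'⟩ := h₀ f C hf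
    exact hv.congr (IsMild.unique hT hW hf hu hv h hv')
  induction s with
  | zero => exact ⟨c₀, hc₀, h₀'⟩
  | succ s ih =>
    obtain ⟨c, hc, h⟩ := ih
    choose w hw hw' using fun i => (hW.dirD (0, e3 i)).reg T s
    obtain ⟨w₀, hw₀, hw₀'⟩ := hW.reg T s
    -- bounds for `u`, for `f - W u`, for the spatial derivatives of `u`, and for `∂ₜu` and `∂ₜ²u`
    set k : ℝ := c + (1 + w₀ * c) * (T + 1) + 4 * ∑ i, c * (1 + w i * c) with hk
    have hwn : ∀ i, 0 ≤ c * (1 + w i * c) := fun i =>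
      mul_nonneg hc (add_nonneg zero_le_one (mul_nonneg (hw i) hc))
    have hsn : ∀ i, c * (1 + w i * c) ≤ ∑ i, c * (1 + w i * c) := fun i =>
      Finset.single_le_sum (f := fun i => c * (1 + w i * c)) (fun i _ => hwn i) (Finset.mem_univ i)
    have hw1 : 0 ≤ w₀ * c := mul_nonneg hw₀ hc
    have hw2 : 0 ≤ w₀ * c * T := mul_nonneg hw1 hT
    have hs0 : 0 ≤ ∑ i, c * (1 + w i * c) := Finset.sum_nonneg fun i _ => hwn i
    have hk0 : 0 ≤ k := by positivity
    refine ⟨k, hk0, fun f C u A hf hu hm => ?_⟩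
    have hC := hf.nonneg
    have hur : Reg T s u (c * C) := h f C u A hf.pred hu hm
    have hFr : Reg T s (f - coeffMul W u) (C + w₀ * (c * C)) := hf.pred.sub (hw₀' _ _ hur)
    have hsp : ∀ i, ∃ v, IsD T (some i) u v ∧ Reg T s v (c * (C + w i * (c * C))) := fun i => by
      obtain ⟨f', hff, hf'⟩ := hf.2 (some i)
      have hg : Reg T s (f' - coeffMul (dirD (0, e3 i) W) u) (C + w i * (c * C)) :=
        hf'.sub (hw' i _ _ hur)
      obtain ⟨v, hv, hvm⟩ := h₀ _ _ hg.bdd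
      exact ⟨v, hm.isD_space hT hW hf.bdd hf'.bdd hff hu hv hvm, h _ _ v _ hg hv hvm⟩
    choose d hd hdr using hsp
    have hdr' : ∀ i, Reg T s (d i) ((∑ i, c * (1 + w i * c)) * C) := fun i =>
      (hdr i).mono (by
        have := mul_le_mul_of_nonneg_right (hsn i) hC
        linarith)
    have hdk : (∑ i, c * (1 + w i * c)) * C ≤ k * C := mul_le_mul_of_nonneg_right (by
      rw [hk]; nlinarith) hC
    have hck : c * C ≤ k * C := mul_le_mul_of_nonneg_right (by
      rw [hk]; nlinarith) hC
    refine ⟨hur.bdd.mono hck, fun μ => ?_⟩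
    cases μ with
    | some i => exact ⟨d i, hd i, (hdr' i).mono hdk⟩
    | none =>
      have hv : BddCurve T (duhamel cosProp (f - coeffMul W u)) (k * C) :=
        ((strongFam_cosProp T).bddCurve_duhamel hFr.bdd hT).mono (by
          have : 1 * (C + w₀ * (c * C)) * T = ((1 + w₀ * c) * T) * C := by ring
          rw [this]
          exact mul_le_mul_of_nonneg_right (by rw [hk]; nlinarith) hC)
      refine ⟨_, hm.isD_time hT hFr.bdd, ?_⟩
      cases s with
      | zero => exact hv
      | succ n =>
        choose dd hdd hddr using fun i => (hdr' i).2 (some i)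
        choose e he her using fun i => (hdr' i).2 none
        refine ⟨hv, fun μ => ?_⟩
        cases μ with
        | some i =>
          exact ⟨e i, IsD.comm (hd i) (hm.isD_time hT hFr.bdd) (he i), (her i).mono hdk⟩
        | none =>
          refine ⟨_, hm.isD_time_time hT hFr.bdd hd hdd fun i => (hddr i).bdd.cont, ?_⟩
          rw [Fin.sum_univ_three]
          refine (hFr.pred.add (((hddr 0).add (hddr 1)).add (hddr 2))).mono ?_
          have : C + w₀ * (c * C) = (1 + w₀ * c) * C := by ring
          rw [this, ← add_mul, ← add_mul, ← add_mul]
          exact mul_le_mul_of_nonneg_right (by rw [hk]; nlinarith) hC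

end

noncomputable section

/-! ### Energy estimate on backward cones -/

/-- The real number `r` is the integral over `ℝ³` of the integrable function `g`. -/
structure IsIntegralOf (r : ℝ) (g : R3 → ℝ) : Prop where
  int : Integrable g leb3
  eq : r = ∫ x, g x ∂leb3

theorem IsIntegralOf.add {r s : ℝ} {f g : R3 → ℝ} (hf : IsIntegralOf r f) (hg : IsIntegralOf s g) :
    IsIntegralOf (r + s) fun x => f x + g x :=
  ⟨hf.int.add hg.int, by rw [hf.eq, hg.eq, integral_add hf.int hg.int]⟩

theorem IsIntegralOf.const_mul {r : ℝ} {f : R3 → ℝ} (hf : IsIntegralOf r f) (c : ℝ) :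
    IsIntegralOf (c * r) fun x => c * f x :=
  ⟨hf.int.const_mul c, by rw [hf.eq, integral_const_mul]⟩

/-- The real inner product on `ℂ`. -/
def rp (z w : ℂ) : ℝ := z.re * w.re + z.im * w.im

/-- The real part of `∫ conj f · a · g`. -/
def wInner (a : R3 → ℂ) (f g : L2R3) : ℝ := (inner ℂ f (mulB a g) : ℂ).re

theorem EssBdd.isIntegralOf {a : R3 → ℝ} {M : ℝ} (ha : EssBdd (ofR a) M) (f g : L2R3) :
    IsIntegralOf (wInner (ofR a) f g) fun x => a x * rp (f x) (g x) := by
  have h1 : Integrable (fun x => (inner ℂ (f x) (mulB (ofR a) g x) : ℂ)) leb3 :=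
    L2.integrable_inner f _
  have h2 : (fun x => RCLike.re (inner ℂ (f x) (mulB (ofR a) g x) : ℂ)) =ᵐ[leb3]
      fun x => a x * rp (f x) (g x) := by
    filter_upwards [ha.coe_mulB g] with x hx
    rw [hx]
    simp only [RCLike.inner_apply, ofR, rp, RCLike.re_to_complex, Complex.mul_re, Complex.conj_re,
      Complex.conj_im, Complex.ofReal_re, Complex.ofReal_im, Complex.mul_im]
    ring
  refine ⟨h1.re.congr h2, ?_⟩
  rw [wInner, L2.inner_def, ← RCLike.re_to_complex, ← integral_re h1]
  exact integral_congr_ae h2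

theorem EssBdd.wInner_comm {a : R3 → ℝ} {M : ℝ} (ha : EssBdd (ofR a) M) (f g : L2R3) :
    wInner (ofR a) f g = wInner (ofR a) g f := by
  rw [(ha.isIntegralOf f g).eq, (ha.isIntegralOf g f).eq]
  simp only [rp, mul_comm]

theorem IsCoeff.hasDerivAt_wInner {W : ℝ × R3 → ℂ} (h : IsCoeff W) {f g : ℝ → L2R3} {f' g' : L2R3}
    {t : ℝ} (hf : HasDerivAt f f' t) (hg : HasDerivAt g g' t) :
    HasDerivAt (fun s => wInner (slice W s) (f s) (g s))
      (wInner (slice (_root_.dirD (1, 0) W) t) (f t) (g t) + wInner (slice W t) (f t) g' +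
        wInner (slice W t) f' (g t)) t := by
  have h1 : HasDerivAt (fun s => (inner ℂ (f s) (mulB (slice W s) (g s)) : ℂ))
      (inner ℂ (f t) (mulB (slice (_root_.dirD (1, 0) W) t) (g t) + mulB (slice W t) g') +
        inner ℂ f' (mulB (slice W t) (g t))) t := HasDerivAt.inner ℂ hf (h.hasDerivAt hg)
  have h2 := Complex.reCLM.hasFDerivAt.comp_hasDerivAt t h1
  rw [inner_add_right] at h2
  exact h2

/-- A weight on space-time whose gradient at times in `(0,T)` is a nonnegative multiple `g` of the
vector `-(1, n)` with `|n| ≤ 1`: the flux of the energy with this weight has a sign. -/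
structure ConeWeight (T : ℝ) (η : ℝ × R3 → ℂ) (a g : ℝ → R3 → ℝ) (n : R3 → Fin 3 → ℝ) :
    Prop where
  coeff : IsCoeff η
  eq : ∀ t ∈ Ioo 0 T, slice η t = ofR (a t)
  time : ∀ t ∈ Ioo 0 T, slice (dirD (1, 0) η) t = ofR fun x => -g t x
  space : ∀ t ∈ Ioo 0 T, ∀ i, slice (dirD (0, e3 i) η) t = ofR fun x => -(g t x * n x i)
  nonneg : ∀ t x, 0 ≤ a t x
  grad_nonneg : ∀ t x, 0 ≤ g t x
  normal : ∀ x, n x 0 ^ 2 + n x 1 ^ 2 + n x 2 ^ 2 ≤ 1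

/-- A curve `u` in `L²(ℝ³)` with its derivatives: `u1`, `u2` in time, `d i`, `dd i` in the direction
`i`, and the mixed derivatives `e i`. -/
structure WaveJet (T : ℝ) (u u1 u2 : ℝ → L2R3) (d dd e : Fin 3 → ℝ → L2R3) (C : ℝ) : Prop where
  dt : IsD T none u u1
  dtt : IsD T none u1 u2
  dx : ∀ i, IsD T (some i) u (d i)
  dxx : ∀ i, IsD T (some i) (d i) (dd i)
  dxt : ∀ i, IsD T none (d i) (e i)
  bdd : BddCurve T u C
  bdd1 : BddCurve T u1 C
  bdd2 : BddCurve T u2 C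
  bddx : ∀ i, BddCurve T (d i) C
  bddxx : ∀ i, BddCurve T (dd i) C
  bddxt : ∀ i, BddCurve T (e i) C

theorem Reg.exists_waveJet {T : ℝ} {u : ℝ → L2R3} {C : ℝ} (h : Reg T 2 u C) :
    ∃ u1 u2 d dd e, WaveJet T u u1 u2 d dd e C := by
  obtain ⟨u1, h1, h1'⟩ := h.2 none
  obtain ⟨u2, h2, h2'⟩ := h1'.2 none
  choose d hd hd' using fun i => h.2 (some i)
  choose dd hdd hdd' using fun i => (hd' i).2 (some i)
  choose e he he' using fun i => (hd' i).2 none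
  exact ⟨u1, u2, d, dd, e, h1, h2, hd, hdd, he, h.1, h1'.1, h2', fun i => (hd' i).1, hdd', he'⟩

/-- The pointwise inequality behind the energy estimate: the first line holds the flux terms, which
the condition on the weight makes nonpositive. -/
theorem energy_pointwise {a g K V : ℝ} {n : Fin 3 → ℝ} {u u1 u2 : ℂ} {d dd : Fin 3 → ℂ}
    (ha : 0 ≤ a) (hg : 0 ≤ g) (hn : n 0 ^ 2 + n 1 ^ 2 + n 2 ^ 2 ≤ 1) (hV : a ≠ 0 → |V| ≤ K)
    (heq : a ≠ 0 → u2 - ∑ i, dd i + V * u = 0) :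
    (-g * rp u1 u1 + ∑ i, (-g * rp (d i) (d i) + 2 * (g * n i) * rp u1 (d i))) +
      (2 * a * rp u1 u2 - ∑ i, 2 * a * rp u1 (dd i)) + (-g * rp u u + 2 * a * rp u u1) ≤
    (1 + K) * (a * rp u1 u1 + ∑ i, a * rp (d i) (d i) + a * rp u u) := by
  simp only [Fin.sum_univ_three] at *
  have rp0 : ∀ z : ℂ, 0 ≤ rp z z := fun z => add_nonneg (mul_self_nonneg _) (mul_self_nonneg _)
  have f1 : -g * rp u1 u1 + (-g * rp (d 0) (d 0) + 2 * (g * n 0) * rp u1 (d 0) +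
      (-g * rp (d 1) (d 1) + 2 * (g * n 1) * rp u1 (d 1)) +
      (-g * rp (d 2) (d 2) + 2 * (g * n 2) * rp u1 (d 2))) ≤ 0 := by
    have e : -g * rp u1 u1 + (-g * rp (d 0) (d 0) + 2 * (g * n 0) * rp u1 (d 0) +
      (-g * rp (d 1) (d 1) + 2 * (g * n 1) * rp u1 (d 1)) +
      (-g * rp (d 2) (d 2) + 2 * (g * n 2) * rp u1 (d 2))) =
      -(g * ((1 - (n 0 ^ 2 + n 1 ^ 2 + n 2 ^ 2)) * rp u1 u1 +
        (rp (d 0 - n 0 * u1) (d 0 - n 0 * u1) + rp (d 1 - n 1 * u1) (d 1 - n 1 * u1) +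
          rp (d 2 - n 2 * u1) (d 2 - n 2 * u1)))) := by
      simp only [rp, Complex.sub_re, Complex.sub_im, Complex.mul_re, Complex.mul_im,
        Complex.ofReal_re, Complex.ofReal_im]
      ring
    rw [e, neg_nonpos]
    exact mul_nonneg hg (add_nonneg (mul_nonneg (by linarith) (rp0 _))
      (add_nonneg (add_nonneg (rp0 _) (rp0 _)) (rp0 _)))
  have f2 : -g * rp u u ≤ 0 := by
    have := mul_nonneg hg (rp0 u)
    linarith
  rcases eq_or_ne a 0 with h0 | h0
  · subst h0
    simp only [mul_zero, zero_mul, add_zero, sub_zero]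
    linarith
  have hVK := hV h0
  have hK : 0 ≤ K := (abs_nonneg V).trans hVK
  have e2 : u2 = dd 0 + dd 1 + dd 2 - V * u := by linear_combination heq h0
  have f3 : 2 * a * rp u1 u2 - (2 * a * rp u1 (dd 0) + 2 * a * rp u1 (dd 1) + 2 * a * rp u1 (dd 2)) =
      a * (-V * (2 * rp u1 u)) := by
    rw [e2]
    simp only [rp, Complex.sub_re, Complex.sub_im, Complex.add_re, Complex.add_im, Complex.mul_re,
      Complex.mul_im, Complex.ofReal_re, Complex.ofReal_im]
    ring
  have f4 : |2 * rp u1 u| ≤ rp u1 u1 + rp u u := by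
    rw [abs_le]
    simp only [rp]
    constructor
    · nlinarith [sq_nonneg (u1.re + u.re), sq_nonneg (u1.im + u.im)]
    · nlinarith [sq_nonneg (u1.re - u.re), sq_nonneg (u1.im - u.im)]
  have f5 : -V * (2 * rp u1 u) ≤ K * (rp u1 u1 + rp u u) :=
    (le_abs_self _).trans (by
      rw [abs_mul, abs_neg]
      exact mul_le_mul hVK f4 (abs_nonneg _) hK)
  have f6 : rp u u1 = rp u1 u := by simp only [rp, mul_comm]
  have f7 := mul_le_mul_of_nonneg_left f5 ha
  have f8 := mul_le_mul_of_nonneg_left ((le_abs_self _).trans f4) ha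
  have f9 : 0 ≤ (1 + K) * (a * rp (d 0) (d 0) + a * rp (d 1) (d 1) + a * rp (d 2) (d 2)) :=
    mul_nonneg (by linarith) (add_nonneg (add_nonneg (mul_nonneg ha (rp0 _)) (mul_nonneg ha (rp0 _)))
      (mul_nonneg ha (rp0 _)))
  rw [f3, f6]
  linarith

/-- Gronwall's inequality with vanishing initial value. -/
theorem nonpos_of_deriv_le {T L : ℝ} {E E' : ℝ → ℝ} (hE : ∀ t ∈ Ioo 0 T, HasDerivAt E (E' t) t)
    (hle : ∀ t ∈ Ioo 0 T, E' t ≤ L * E t) (h0 : Tendsto E (𝓝[>] 0) (𝓝 0)) {t : ℝ}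
    (ht : t ∈ Ioo 0 T) : E t ≤ 0 := by
  have hd : ∀ t ∈ Ioo 0 T, HasDerivAt (fun s => Real.exp (-L * s) * E s)
      (Real.exp (-L * t) * (-L * 1) * E t + Real.exp (-L * t) * E' t) t := fun t ht =>
    (((hasDerivAt_id t).const_mul (-L)).exp).mul (hE t ht)
  have hanti : AntitoneOn (fun s => Real.exp (-L * s) * E s) (Ioo 0 T) := by
    refine antitoneOn_of_deriv_nonpos (convex_Ioo 0 T)
      (fun t ht => (hd t ht).continuousAt.continuousWithinAt)
      (fun t ht => (hd t (by rwa [interior_Ioo] at ht)).differentiableAt.differentiableWithinAt)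
      fun t ht => ?_
    rw [interior_Ioo] at ht
    rw [(hd t ht).deriv]
    have := mul_nonneg (Real.exp_pos (-L * t)).le (sub_nonneg.2 (hle t ht))
    linarith
  have hlim : Tendsto (fun s => Real.exp (-L * s) * E s) (𝓝[>] 0) (𝓝 (Real.exp (-L * 0) * 0)) := by
    refine Tendsto.mul ?_ h0
    exact ((Continuous.tendsto (by fun_prop) 0).mono_left nhdsWithin_le_nhds)
  rw [mul_zero] at hlim
  have h1 : Real.exp (-L * t) * E t ≤ 0 := by
    refine ge_of_tendsto hlim ?_
    filter_upwards [Ioo_mem_nhdsGT ht.1] with s hs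
    exact hanti ⟨hs.1, hs.2.trans ht.2⟩ ht hs.2.le
  exact nonpos_of_mul_nonpos_right h1 (Real.exp_pos _)

theorem tendsto_wInner {W : ℝ × R3 → ℂ} (h : IsCoeff W) {f : ℝ → L2R3}
    (hf : Tendsto f (𝓝[>] 0) (𝓝 0)) :
    Tendsto (fun s => wInner (slice W s) (f s) (f s)) (𝓝[>] 0) (𝓝 0) := by
  obtain ⟨M, hM⟩ := h.exists_bound
  have h1 : Tendsto (fun s => M * ‖f s‖ * ‖f s‖) (𝓝[>] 0) (𝓝 0) := by
    simpa using (hf.norm.const_mul M).mul hf.norm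
  refine squeeze_zero_norm (fun s => ?_) h1
  refine (Complex.abs_re_le_norm _).trans ((norm_inner_le_norm _ _).trans ?_)
  rw [mul_comm]
  exact mul_le_mul_of_nonneg_right ((hM s).norm_mulB_le _) (norm_nonneg _)

/-- A wave with zero initial values that solves the homogeneous equation where the weight is
nonzero vanishes there. -/
theorem WaveJet.eq_zero_of_weight {T : ℝ} {u u1 u2 : ℝ → L2R3} {d dd e : Fin 3 → ℝ → L2R3} {C : ℝ}
    (hj : WaveJet T u u1 u2 d dd e C) (h0 : Tendsto u (𝓝[>] 0) (𝓝 0))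
    (h1 : Tendsto u1 (𝓝[>] 0) (𝓝 0)) (hd : ∀ i, Tendsto (d i) (𝓝[>] 0) (𝓝 0))
    {η : ℝ × R3 → ℂ} {a g : ℝ → R3 → ℝ} {n : R3 → Fin 3 → ℝ} (hη : ConeWeight T η a g n)
    {V : ℝ × R3 → ℝ} {K : ℝ} (hV : ∀ t ∈ Ioo 0 T, ∀ x, a t x ≠ 0 → |V (t, x)| ≤ K)
    (heq : ∀ t ∈ Ioo 0 T, ∀ᵐ x ∂leb3, a t x ≠ 0 →
      u2 t x - ∑ i, dd i t x + V (t, x) * u t x = 0) {t : ℝ} (ht : t ∈ Ioo 0 T) :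
    ∀ᵐ x ∂leb3, a t x ≠ 0 → u t x = 0 := by
  have hc := hη.coeff
  obtain ⟨M, hM⟩ := hc.exists_bound
  obtain ⟨M0, hM0⟩ := (hc.dirD (1, 0)).exists_bound
  choose Mi hMi using fun i => (hc.dirD (0, e3 i)).exists_bound
  set w : ℝ → L2R3 → L2R3 → ℝ := fun t => wInner (slice η t) with hw
  set w0 : ℝ → L2R3 → L2R3 → ℝ := fun t => wInner (slice (dirD (1, 0) η) t) with hw0
  set wi : Fin 3 → ℝ → L2R3 → L2R3 → ℝ := fun i t => wInner (slice (dirD (0, e3 i) η) t) with hwi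
  -- the weighted energy `∫ η (|∂ₜu|² + |∇u|² + |u|²)` and its time derivative
  set E : ℝ → ℝ := fun t => w t (u1 t) (u1 t) + ∑ i, w t (d i t) (d i t) + w t (u t) (u t) with hE
  set E' : ℝ → ℝ := fun t => (w0 t (u1 t) (u1 t) + ∑ i, (w0 t (d i t) (d i t) +
      (-2) * wi i t (u1 t) (d i t))) +
    (2 * w t (u1 t) (u2 t) + ∑ i, (-2) * w t (u1 t) (dd i t)) +
      (w0 t (u t) (u t) + 2 * w t (u t) (u1 t)) with hE'
  have hcomm : ∀ t ∈ Ioo 0 T, ∀ f g, w t f g = w t g f := fun t ht f g => by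
    have h2 := hM t
    simp only [hw]
    rw [hη.eq t ht] at h2 ⊢
    exact h2.wInner_comm f g
  have hder : ∀ t ∈ Ioo 0 T, HasDerivAt E (E' t) t := fun t ht => by
    have a1 := hc.hasDerivAt_wInner (hj.dtt t ht) (hj.dtt t ht)
    have a2 := fun i => hc.hasDerivAt_wInner (hj.dxt i t ht) (hj.dxt i t ht)
    have a3 := hc.hasDerivAt_wInner (hj.dt t ht) (hj.dt t ht)
    have a4 := (a1.add (HasDerivAt.fun_sum (u := Finset.univ) fun i _ => a2 i)).add a3
    refine a4.congr_deriv ?_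
    -- integration by parts moves the derivative off `∂ᵢ∂ₜu`
    have b : ∀ i, w t (e i t) (d i t) = -(wi i t (u1 t) (d i t) + w t (u1 t) (dd i t)) := fun i => by
      have b1 := IsD.comm (hj.dx i) hj.dt (hj.dxt i) t ht
      have b2 := b1.inner_eq (hc.hasWeakDeriv (hj.dxx i t ht) t)
      simp only [hw, hwi, wInner]
      rw [b2, inner_add_right, Complex.neg_re, Complex.add_re]
    have b' : ∀ i, w t (d i t) (e i t) = -(wi i t (u1 t) (d i t) + w t (u1 t) (dd i t)) := fun i => by
      rw [hcomm t ht, b]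
    have c1 := hcomm t ht (u2 t) (u1 t)
    have c2 := hcomm t ht (u1 t) (u t)
    simp only [hE', hw, hw0, hwi] at b b' c1 c2 ⊢
    simp only [Fin.sum_univ_three, b, b', c1, c2]
    ring
  have hle : ∀ t ∈ Ioo 0 T, E' t ≤ (1 + K) * E t := fun t ht => by
    have r : ∀ f g, IsIntegralOf (w t f g) fun x => a t x * rp (f x) (g x) := fun f g' => by
      have h2 := hM t
      simp only [hw]
      rw [hη.eq t ht] at h2 ⊢
      exact h2.isIntegralOf f g'
    have r0 : ∀ f g', IsIntegralOf (w0 t f g') fun x => -g t x * rp (f x) (g' x) := fun f g' => by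
      have h2 := hM0 t
      simp only [hw0]
      rw [hη.time t ht] at h2 ⊢
      exact h2.isIntegralOf f g'
    have ri : ∀ i f g', IsIntegralOf (wi i t f g') fun x => -(g t x * n x i) * rp (f x) (g' x) :=
      fun i f g' => by
        have h2 := hMi i t
        simp only [hwi]
        rw [hη.space t ht] at h2 ⊢
        exact h2.isIntegralOf f g'
    have q := ((((r0 (u1 t) (u1 t)).add ((((r0 (d 0 t) (d 0 t)).add ((ri 0 (u1 t) (d 0 t)).const_mul (-2))).add
      ((r0 (d 1 t) (d 1 t)).add ((ri 1 (u1 t) (d 1 t)).const_mul (-2)))).add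
      ((r0 (d 2 t) (d 2 t)).add ((ri 2 (u1 t) (d 2 t)).const_mul (-2))))).add
      (((r (u1 t) (u2 t)).const_mul 2).add ((((r (u1 t) (dd 0 t)).const_mul (-2)).add
        ((r (u1 t) (dd 1 t)).const_mul (-2))).add ((r (u1 t) (dd 2 t)).const_mul (-2))))).add
      ((r0 (u t) (u t)).add ((r (u t) (u1 t)).const_mul 2))).add
      ((((r (u1 t) (u1 t)).add (((r (d 0 t) (d 0 t)).add (r (d 1 t) (d 1 t))).add
        (r (d 2 t) (d 2 t)))).add (r (u t) (u t))).const_mul (-(1 + K)))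
    have q2 : E' t + -(1 + K) * E t ≤ 0 := by
      simp only [hE, hE', Fin.sum_univ_three]
      refine q.eq.trans_le ?_
      refine integral_nonpos_of_ae ?_
      filter_upwards [heq t ht] with x hx
      have := energy_pointwise (u := u t x) (u1 := u1 t x) (u2 := u2 t x) (d := fun i => d i t x)
        (dd := fun i => dd i t x) (hη.nonneg t x) (hη.grad_nonneg t x) (hη.normal x) (hV t ht x) hx
      simp only [Fin.sum_univ_three] at this
      simp only [Pi.zero_apply]
      linarith
    linarith
  have hlim : Tendsto E (𝓝[>] 0) (𝓝 0) := by
    have := ((tendsto_wInner hc h1).add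
      (tendsto_finsetSum Finset.univ fun i _ => tendsto_wInner hc (hd i))).add (tendsto_wInner hc h0)
    simpa using this
  have hE0 := nonpos_of_deriv_le hder hle hlim ht
  have r : ∀ f, IsIntegralOf (w t f f) fun x => a t x * rp (f x) (f x) := fun f => by
    have h2 := hM t
    simp only [hw]
    rw [hη.eq t ht] at h2 ⊢
    exact h2.isIntegralOf f f
  have pos : ∀ (f : L2R3) x, 0 ≤ a t x * rp (f x) (f x) := fun f x =>
    mul_nonneg (hη.nonneg t x) (add_nonneg (mul_self_nonneg _) (mul_self_nonneg _))
  have hp : ∀ f, 0 ≤ w t f f := fun f => by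
    rw [(r f).eq]
    exact integral_nonneg (pos f)
  have hz : ∫ x, a t x * rp (u t x) (u t x) ∂leb3 = 0 := by
    rw [← (r (u t)).eq]
    refine le_antisymm ?_ (hp _)
    have := Finset.sum_nonneg fun i (_ : i ∈ Finset.univ) => hp (d i t)
    have := hp (u1 t)
    simp only [hE] at hE0
    linarith
  rw [integral_eq_zero_iff_of_nonneg (pos (u t)) (r (u t)).int] at hz
  filter_upwards [hz] with x hx hax
  have h2 : rp (u t x) (u t x) = 0 := by
    simpa [hax] using hx
  rw [rp] at h2
  refine Complex.ext ?_ ?_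
  · rw [Complex.zero_re]
    nlinarith [mul_self_nonneg (u t x).re, mul_self_nonneg (u t x).im]
  · rw [Complex.zero_im]
    nlinarith [mul_self_nonneg (u t x).re, mul_self_nonneg (u t x).im]

end

noncomputable section

/-! ### Strong solutions: uniqueness, finite speed of propagation, existence -/

/-- The function `√(1 + |x - x₀|²)`, a smooth substitute for the distance to `x₀`. -/
def japDist (x₀ x : R3) : ℝ := √(1 + ‖x - x₀‖ ^ 2)

theorem contDiff_japDist (x₀ : R3) : ContDiff ℝ ∞ (japDist x₀) :=
  ContDiff.sqrt (contDiff_const.add ((contDiff_id.sub contDiff_const).norm_sq ℝ))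
    fun x => by positivity

theorem one_le_japDist (x₀ x : R3) : 1 ≤ japDist x₀ x :=
  Real.one_le_sqrt.2 (by linarith [sq_nonneg ‖x - x₀‖])

theorem norm_sub_le_japDist (x₀ x : R3) : ‖x - x₀‖ ≤ japDist x₀ x :=
  Real.le_sqrt_of_sq_le (by linarith)

theorem fderiv_japDist (x₀ x v : R3) :
    fderiv ℝ (japDist x₀) x v = inner ℝ (x - x₀) v / japDist x₀ x := by
  have h1 : HasFDerivAt (fun x : R3 => x - x₀) (ContinuousLinearMap.id ℝ R3) x :=
    (hasFDerivAt_id x).sub_const x₀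
  have h2 := ((h1.norm_sq).const_add 1).sqrt (by positivity)
  have h3 : HasFDerivAt (japDist x₀) _ x := h2
  rw [h3.fderiv]
  have h0 : japDist x₀ x ≠ 0 := (zero_lt_one.trans_le (one_le_japDist x₀ x)).ne'
  simp only [_root_.smul_apply, ContinuousLinearMap.comp_apply, ContinuousLinearMap.id_apply,
    innerSL_apply_apply, smul_eq_mul, nsmul_eq_mul]
  change 1 / (2 * japDist x₀ x) * _ = _
  field_simp
  push_cast
  ring

/-- Weights supported in backward cones exist. -/
theorem exists_coneWeight {T : ℝ} (hT : 0 < T) (x₀ : R3) (R : ℝ) :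
    ∃ η a g n, ConeWeight T η a g n ∧ ∀ t x, a t x ≠ 0 ↔ japDist x₀ x < R - t := by
  let κ : ContDiffBump (T / 2 : ℝ) := ⟨T, 2 * T, hT, by linarith⟩
  set p : ℝ × R3 → ℝ := fun z => R - z.1 - japDist x₀ z.2 with hp
  have hpd : ContDiff ℝ ∞ p :=
    (contDiff_const.sub contDiff_fst).sub ((contDiff_japDist x₀).comp contDiff_snd)
  have hθ : ContDiff ℝ ∞ expNegInvGlue := expNegInvGlue.contDiff
  set η : ℝ × R3 → ℂ := fun z => ((κ z.1 * expNegInvGlue (p z) : ℝ) : ℂ) with hη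
  have hp' : ∀ z v, fderiv ℝ p z v = - v.1 - fderiv ℝ (japDist x₀) z.2 v.2 := fun z v => by
    have h1 : HasFDerivAt (fun z : ℝ × R3 => R - z.1) (-ContinuousLinearMap.fst ℝ ℝ R3) z :=
      (ContinuousLinearMap.fst ℝ ℝ R3).hasFDerivAt.const_sub R
    have h2 := ((contDiff_japDist x₀).differentiable (by simp) z.2).hasFDerivAt.comp z
      (ContinuousLinearMap.snd ℝ ℝ R3).hasFDerivAt
    have h3 : HasFDerivAt p _ z := h1.sub h2
    rw [h3.fderiv]
    rfl
  have hd : ∀ t ∈ Ioo 0 T, ∀ x v, dirD v η (t, x) =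
      ((deriv expNegInvGlue (p (t, x)) * fderiv ℝ p (t, x) v : ℝ) : ℂ) := fun t ht x v => by
    have h1 : HasFDerivAt (fun z => expNegInvGlue (p z))
        (deriv expNegInvGlue (p (t, x)) • fderiv ℝ p (t, x)) (t, x) :=
      ((hθ.differentiable (by simp) _).hasDerivAt).comp_hasFDerivAt (t, x)
        (hpd.differentiable (by simp) _).hasFDerivAt
    have h2 : η =ᶠ[𝓝 (t, x)] fun z => ((expNegInvGlue (p z) : ℝ) : ℂ) := by
      have : ∀ᶠ z : ℝ × R3 in 𝓝 (t, x), z.1 ∈ Ioo 0 T :=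
        continuous_fst.continuousAt.eventually (isOpen_Ioo.mem_nhds ht)
      filter_upwards [this] with z hz
      have h3 : κ z.1 = 1 := κ.one_of_mem_closedBall (by
        rw [Metric.mem_closedBall, Real.dist_eq, abs_le]
        change -T ≤ _ ∧ _ ≤ T
        constructor <;> linarith [hz.1, hz.2])
      simp only [hη, h3, one_mul]
    have h3 := (Complex.ofRealCLM.hasFDerivAt.comp (t, x) h1).congr_of_eventuallyEq h2
    rw [dirD, h3.fderiv]
    simp
  have hpos : ∀ x, 0 < japDist x₀ x := fun x => zero_lt_one.trans_le (one_le_japDist x₀ x)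
  refine ⟨η, fun t x => expNegInvGlue (p (t, x)), fun t x => deriv expNegInvGlue (p (t, x)),
    fun x i => (x - x₀) i / japDist x₀ x, ⟨⟨?_, ?_⟩, ?_, ?_, ?_, ?_, ?_, ?_⟩, fun t x => ?_⟩
  · exact Complex.ofRealCLM.contDiff.comp
      ((κ.contDiff.comp contDiff_fst).mul (hθ.comp hpd))
  · refine HasCompactSupport.intro
      (K := Metric.closedBall (T / 2) (2 * T) ×ˢ Metric.closedBall x₀ (|R| + 2 * T))
      ((isCompact_closedBall _ _).prod (isCompact_closedBall _ _)) fun z hz => ?_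
    simp only [hη, Complex.ofReal_eq_zero, mul_eq_zero]
    by_contra! hne
    refine hz ⟨?_, ?_⟩
    · have h1 : z.1 ∈ Function.support κ := hne.1
      rw [κ.support_eq] at h1
      exact Metric.ball_subset_closedBall h1
    · have h1 : z.1 ∈ Function.support κ := hne.1
      rw [κ.support_eq, Metric.mem_ball, Real.dist_eq, abs_lt] at h1
      have h1' : -(2 * T) < z.1 - T / 2 := h1.1
      have h2 : 0 < p z := by
        by_contra hcon
        exact hne.2 (expNegInvGlue.zero_of_nonpos (not_lt.1 hcon))
      rw [Metric.mem_closedBall, dist_eq_norm]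
      refine (norm_sub_le_japDist x₀ z.2).trans ?_
      simp only [hp] at h2
      linarith [le_abs_self R]
  · intro t ht
    ext x
    have h3 : κ t = 1 := κ.one_of_mem_closedBall (by
      rw [Metric.mem_closedBall, Real.dist_eq, abs_le]
      change -T ≤ _ ∧ _ ≤ T
      constructor <;> linarith [ht.1, ht.2])
    simp only [slice, hη, ofR, h3, one_mul]
  · intro t ht
    ext x
    rw [slice, hd t ht, hp', ofR, map_zero]
    simp
  · intro t ht i
    ext x
    rw [slice, hd t ht, hp', fderiv_japDist, ofR]
    simp [EuclideanSpace.inner_single_right]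
  · exact fun t x => expNegInvGlue.nonneg _
  · exact fun t x => expNegInvGlue.monotone.deriv_nonneg
  · intro x
    have h1 := EuclideanSpace.real_norm_sq_eq (x - x₀)
    rw [Fin.sum_univ_three] at h1
    have h2 : japDist x₀ x ^ 2 = 1 + ‖x - x₀‖ ^ 2 := Real.sq_sqrt (by positivity)
    rw [div_pow, div_pow, div_pow, ← add_div, ← add_div, ← h1, h2, div_le_one (by positivity)]
    linarith
  · rw [ne_eq, expNegInvGlue.zero_iff_nonpos, not_le]
    simp only [hp]
    constructor <;> intro h <;> linarith

/-- A curve with bounded derivative has a limit at the initial time. -/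
theorem IsD.exists_tendsto {T : ℝ} (hT : 0 < T) {u v : ℝ → L2R3} {C : ℝ} (h : IsD T none u v)
    (hv : BddCurve T v C) : ∃ l, Tendsto u (𝓝[>] 0) (𝓝 l) := by
  have h1 : LipschitzOnWith ⟨C, hv.nonneg⟩ u (Ioo 0 T) :=
    (convex_Ioo 0 T).lipschitzOnWith_of_nnnorm_hasDerivWithin_le
      (fun t ht => HasDerivAt.hasDerivWithinAt (h t ht)) fun t ht => hv.bound t ht
  have h2 : 𝓝[>] (0 : ℝ) ≤ 𝓟 (Ioo 0 T) := le_principal_iff.2 (Ioo_mem_nhdsGT hT)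
  have h3 : Cauchy (map u (𝓝[>] (0 : ℝ))) :=
    (cauchy_nhds.mono nhdsWithin_le_nhds).map_of_le h1.uniformContinuousOn h2
  exact CompleteSpace.complete h3

theorem WaveJet.tendsto_space {T : ℝ} (hT : 0 < T) {u u1 u2 : ℝ → L2R3}
    {d dd e : Fin 3 → ℝ → L2R3} {C : ℝ} (hj : WaveJet T u u1 u2 d dd e C)
    (h0 : Tendsto u (𝓝[>] 0) (𝓝 0)) (i : Fin 3) : Tendsto (d i) (𝓝[>] 0) (𝓝 0) := by
  obtain ⟨l, hl⟩ := (hj.dxt i).exists_tendsto hT (hj.bddxt i)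
  have h1 : HasWeakDeriv i 0 l := by
    refine (isClosed_hasWeakDeriv i).mem_of_tendsto (h0.prodMk_nhds hl) ?_
    filter_upwards [Ioo_mem_nhdsGT hT] with t ht
    exact hj.dx i t ht
  rwa [h1.unique (HasWeakDeriv.zero i)] at hl

/-- `u` solves `∂ₜ²u - Δu + V u = F` on `(0,T)` with zero initial values, almost everywhere in
space at each time. -/
def StrongSol (T : ℝ) (V : ℝ × R3 → ℝ) (F : ℝ → R3 → ℂ) (u : ℝ → L2R3) : Prop :=
  ∃ u1 u2 d dd e C, WaveJet T u u1 u2 d dd e C ∧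
    (∀ t ∈ Ioo 0 T, ∀ᵐ x ∂leb3, u2 t x - ∑ i, dd i t x + V (t, x) * u t x = F t x) ∧
    Tendsto u (𝓝[>] 0) (𝓝 0) ∧ Tendsto u1 (𝓝[>] 0) (𝓝 0)

theorem WaveJet.add {T : ℝ} {u u1 u2 v v1 v2 : ℝ → L2R3} {d dd e d' dd' e' : Fin 3 → ℝ → L2R3}
    {C D : ℝ} (hu : WaveJet T u u1 u2 d dd e C) (hv : WaveJet T v v1 v2 d' dd' e' D) :
    WaveJet T (u + v) (u1 + v1) (u2 + v2) (d + d') (dd + dd') (e + e') (C + D) :=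
  ⟨hu.dt.add hv.dt, hu.dtt.add hv.dtt, fun i => (hu.dx i).add (hv.dx i),
    fun i => (hu.dxx i).add (hv.dxx i), fun i => (hu.dxt i).add (hv.dxt i), hu.bdd.add hv.bdd,
    hu.bdd1.add hv.bdd1, hu.bdd2.add hv.bdd2, fun i => (hu.bddx i).add (hv.bddx i),
    fun i => (hu.bddxx i).add (hv.bddxx i), fun i => (hu.bddxt i).add (hv.bddxt i)⟩

theorem BddCurve.smul {T : ℝ} {u : ℝ → L2R3} {C : ℝ} (hu : BddCurve T u C) (c : ℂ) :
    BddCurve T (c • u) (‖c‖ * C) := Reg.smul (m := 0) c hu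

theorem WaveJet.smul {T : ℝ} {u u1 u2 : ℝ → L2R3} {d dd e : Fin 3 → ℝ → L2R3} {C : ℝ} (c : ℂ)
    (hu : WaveJet T u u1 u2 d dd e C) :
    WaveJet T (c • u) (c • u1) (c • u2) (c • d) (c • dd) (c • e) (‖c‖ * C) :=
  ⟨hu.dt.smul c, hu.dtt.smul c, fun i => (hu.dx i).smul c,
    fun i => (hu.dxx i).smul c, fun i => (hu.dxt i).smul c, hu.bdd.smul c,
    hu.bdd1.smul c, hu.bdd2.smul c, fun i => (hu.bddx i).smul c,
    fun i => (hu.bddxx i).smul c, fun i => (hu.bddxt i).smul c⟩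

section

variable {T : ℝ} {V : ℝ × R3 → ℝ}

theorem StrongSol.add {F G : ℝ → R3 → ℂ} {u v : ℝ → L2R3} (hu : StrongSol T V F u)
    (hv : StrongSol T V G v) : StrongSol T V (fun t x => F t x + G t x) (u + v) := by
  obtain ⟨u1, u2, d, dd, e, C, h1, h2, h3, h4⟩ := hu
  obtain ⟨v1, v2, d', dd', e', D, g1, g2, g3, g4⟩ := hv
  refine ⟨_, _, _, _, _, _, h1.add g1, fun t ht => ?_, add_zero (0 : L2R3) ▸ h3.add g3,
    add_zero (0 : L2R3) ▸ h4.add g4⟩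
  filter_upwards [h2 t ht, g2 t ht, Lp.coeFn_add (u t) (v t), Lp.coeFn_add (u2 t) (v2 t),
    Lp.coeFn_add (dd 0 t) (dd' 0 t), Lp.coeFn_add (dd 1 t) (dd' 1 t),
    Lp.coeFn_add (dd 2 t) (dd' 2 t)] with x a1 a2 a3 a4 a5 a6 a7
  simp only [Fin.sum_univ_three, Pi.add_apply] at *
  rw [a3, a4, a5, a6, a7, ← a1, ← a2]
  ring

theorem StrongSol.smul {F : ℝ → R3 → ℂ} {u : ℝ → L2R3} (c : ℂ) (hu : StrongSol T V F u) :
    StrongSol T V (fun t x => c * F t x) (c • u) := by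
  obtain ⟨u1, u2, d, dd, e, C, h1, h2, h3, h4⟩ := hu
  refine ⟨_, _, _, _, _, _, h1.smul c, fun t ht => ?_, smul_zero (A := L2R3) c ▸ h3.const_smul c,
    smul_zero (A := L2R3) c ▸ h4.const_smul c⟩
  filter_upwards [h2 t ht, Lp.coeFn_smul c (u t), Lp.coeFn_smul c (u2 t),
    Lp.coeFn_smul c (dd 0 t), Lp.coeFn_smul c (dd 1 t),
    Lp.coeFn_smul c (dd 2 t)] with x a1 a3 a4 a5 a6 a7
  simp only [Fin.sum_univ_three, Pi.smul_apply, smul_eq_mul] at *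
  rw [a3, a4, a5, a6, a7, ← a1]
  ring

theorem StrongSol.congr {F G : ℝ → R3 → ℂ} {u : ℝ → L2R3} (hu : StrongSol T V F u)
    (h : ∀ t ∈ Ioo 0 T, ∀ᵐ x ∂leb3, G t x = F t x) : StrongSol T V G u := by
  obtain ⟨u1, u2, d, dd, e, C, h1, h2, h3⟩ := hu
  refine ⟨u1, u2, d, dd, e, C, h1, fun t ht => ?_, h3⟩
  filter_upwards [h2 t ht, h t ht] with x a1 a2
  rw [a1, a2]

/-- If the source vanishes in a backward cone, so does the wave. -/
theorem StrongSol.eq_zero_on_cone (hT : 0 < T) (hV : Continuous V) {F : ℝ → R3 → ℂ}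
    {u : ℝ → L2R3} (hu : StrongSol T V F u) (x₀ : R3) (R : ℝ)
    (hF : ∀ t ∈ Ioo 0 T, ∀ᵐ x ∂leb3, japDist x₀ x < R - t → F t x = 0) {t : ℝ}
    (ht : t ∈ Ioo 0 T) : ∀ᵐ x ∂leb3, japDist x₀ x < R - t → u t x = 0 := by
  obtain ⟨u1, u2, d, dd, e, C, h1, h2, h3, h4⟩ := hu
  obtain ⟨η, a, g, n, hη, ha⟩ := exists_coneWeight hT x₀ R
  obtain ⟨K, hK⟩ := ((isCompact_Icc (a := 0) (b := T)).prod
    (isCompact_closedBall x₀ R)).exists_bound_of_continuousOn hV.continuousOn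
  have := h1.eq_zero_of_weight h3 h4 (fun i => h1.tendsto_space hT h3 i) hη (V := V) (K := K)
    (fun t ht x hx => hK (t, x) ⟨⟨ht.1.le, ht.2.le⟩, by
      rw [Metric.mem_closedBall, dist_eq_norm]
      have := (ha t x).1 hx
      linarith [norm_sub_le_japDist x₀ x, ht.1]⟩)
    (fun t ht => by
      filter_upwards [h2 t ht, hF t ht] with x b1 b2 hx
      rw [b1, b2 ((ha t x).1 hx)]) ht
  filter_upwards [this] with x hx h
  exact hx ((ha t x).2 h)

/-- Strong solutions are unique: the backward cones on which the difference of two of them vanishes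
exhaust `(0,T) × ℝ³`. -/
theorem StrongSol.unique (hT : 0 < T) (hV : Continuous V) {F : ℝ → R3 → ℂ} {u v : ℝ → L2R3}
    (hu : StrongSol T V F u) (hv : StrongSol T V F v) {t : ℝ} (ht : t ∈ Ioo 0 T) :
    u t = v t := by
  have h := hu.add (hv.smul (-1))
  have h0 : ∀ n : ℕ, ∀ᵐ x ∂leb3, japDist 0 x < n - t → (u + (-1 : ℂ) • v) t x = 0 := fun n =>
    h.eq_zero_on_cone hT hV 0 n (fun t _ => .of_forall fun x _ => by ring) ht
  have h1 : (u + (-1 : ℂ) • v) t = 0 := by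
    refine Lp.ext ?_
    filter_upwards [ae_all_iff.2 h0, Lp.coeFn_zero ℂ 2 leb3] with x hx h0
    obtain ⟨n, hn⟩ := exists_nat_gt (japDist 0 x + t)
    rw [hx n (by linarith), h0]
    rfl
  rw [Pi.add_apply, Pi.smul_apply, neg_one_smul, ← sub_eq_add_neg, sub_eq_zero] at h1
  exact h1

/-- Finite speed of propagation. The sharp radius is `r + t`; the radius `r + T + 2` leaves room for
the smooth cones of `japDist`. -/
theorem StrongSol.eq_zero_of_source (hT : 0 < T) (hV : Continuous V) {F : ℝ → R3 → ℂ}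
    {u : ℝ → L2R3} (hu : StrongSol T V F u) {r : ℝ}
    (hF : ∀ t ∈ Ioo 0 T, ∀ᵐ x ∂leb3, r < ‖x‖ → F t x = 0) {t : ℝ} (ht : t ∈ Ioo 0 T) :
    ∀ᵐ x ∂leb3, r + T + 2 < ‖x‖ → u t x = 0 := by
  rw [ae_iff]
  refine measure_null_of_locally_null _ fun x₀ hx₀ => ?_
  have hx₀' : r + T + 2 < ‖x₀‖ := by
    by_contra hcon
    exact hx₀ fun h => absurd h hcon
  have h1 := hu.eq_zero_on_cone hT hV x₀ (T + 2) (fun t ht => by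
    filter_upwards [hF t ht] with x hx hlt
    refine hx ?_
    have h2 := norm_sub_le_japDist x₀ x
    have h3 := norm_sub_norm_le x₀ x
    rw [norm_sub_rev] at h3
    linarith [ht.1]) ht
  rw [ae_iff] at h1
  refine ⟨_, ?_, h1⟩
  have h2 : ∀ᶠ x in 𝓝 x₀, japDist x₀ x < T + 2 - t :=
    ((contDiff_japDist x₀).continuous.tendsto x₀).eventually_lt_const (by
      simp only [japDist, sub_self, norm_zero]
      norm_num
      linarith [ht.2])
  filter_upwards [nhdsWithin_le_nhds h2, self_mem_nhdsWithin] with x h3 h4 h5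
  exact h4 fun _ => h5 h3

/-- For sources supported in a fixed ball there are waves, as regular as the source. -/
theorem exists_strongSol (hT : 0 < T) (hV : ContDiff ℝ ∞ V) (r : ℝ) {s : ℕ} (hs : 2 ≤ s) :
    ∃ c : ℝ, 0 ≤ c ∧ ∀ f C, Reg T s f C →
      (∀ t ∈ Ioo 0 T, ∀ᵐ x ∂leb3, r < ‖x‖ → f t x = 0) →
        ∃ u, Reg T s u (c * C) ∧ StrongSol T V (fun t => f t) u ∧
          ∀ t ∈ Ioo 0 T, ∀ᵐ x ∂leb3, r + T + 2 < ‖x‖ → u t x = 0 := by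
  let κ : ContDiffBump (T / 2 : ℝ) := ⟨T, 2 * T, hT, by linarith⟩
  let χ : ContDiffBump (0 : R3) := ⟨|r| + T + 2, |r| + T + 3, by positivity, by linarith⟩
  have hκ : ∀ t ∈ Ioo 0 T, κ t = 1 := fun t ht => κ.one_of_mem_closedBall (by
    rw [Metric.mem_closedBall, Real.dist_eq, abs_le]
    change -T ≤ _ ∧ _ ≤ T
    constructor <;> linarith [ht.1, ht.2])
  -- the potential, cut off where the wave does not reach
  set V' : ℝ × R3 → ℝ := fun z => κ z.1 * χ z.2 * V z with hV'
  have hV's : ContDiff ℝ ∞ V' :=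
    ((κ.contDiff.comp contDiff_fst).mul (χ.contDiff.comp contDiff_snd)).mul hV
  have hW : IsCoeff fun z => (V' z : ℂ) := by
    refine ⟨Complex.ofRealCLM.contDiff.comp hV's, ?_⟩
    refine HasCompactSupport.intro (κ.hasCompactSupport.prod χ.hasCompactSupport) fun z hz => ?_
    rw [mem_prod, not_and_or] at hz
    simp only [hV', Complex.ofReal_eq_zero]
    rcases hz with h | h
    · rw [image_eq_zero_of_notMem_tsupport h, zero_mul, zero_mul]
    · rw [image_eq_zero_of_notMem_tsupport h, mul_zero, zero_mul]
  obtain ⟨c₀, hc₀, h₀⟩ := exists_isMild hT.le hW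
  obtain ⟨c, hc, h⟩ := exists_isMild_reg hT.le hW s
  obtain ⟨M, hM⟩ := hW.exists_bound
  refine ⟨c, hc, fun f C hf hsupp => ?_⟩
  obtain ⟨u, hu, hm⟩ := h₀ f C hf.bdd
  have hur := h f C u _ hf hu hm
  have hu' : StrongSol T V' (fun t => f t) u := by
    obtain ⟨u1, u2, d, dd, e, hj⟩ := (hur.of_le hs).exists_waveJet
    obtain ⟨D, hD⟩ := hW.bddCurve hu
    have hF := hf.bdd.sub hD
    have e1 := hj.dt.unique (hm.isD_time hT.le hF)
    have e2 := (hj.dtt.congr (fun t ht => (e1 t ht).symm) fun _ _ => rfl).unique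
      (hm.isD_time_time hT.le hF hj.dx hj.dxx fun i => (hj.bddxx i).cont)
    have lim : ∀ (A : ℝ → L2R3 →L[ℂ] L2R3) (K : ℝ), StrongFam T A K → ∀ v : ℝ → L2R3,
        (∀ t ∈ Ioo 0 T, v t = duhamel A (f - coeffMul (fun z => (V' z : ℂ)) u) t) →
        Tendsto v (𝓝[>] 0) (𝓝 0) := fun A K hA v hv => by
      have h1 : Tendsto (fun t => K * (C + D) * t) (𝓝[>] 0) (𝓝 (K * (C + D) * 0)) :=
        (Continuous.tendsto (by fun_prop) _).mono_left nhdsWithin_le_nhds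
      rw [mul_zero] at h1
      refine squeeze_zero_norm' ?_ h1
      filter_upwards [Ioo_mem_nhdsGT hT] with t ht
      rw [hv t ht]
      exact hA.norm_duhamel_le hF ht
    refine ⟨u1, u2, d, dd, e, _, hj, fun t ht => ?_, lim _ _ (strongFam_sinProp hT.le) u hm,
      lim _ _ (strongFam_cosProp T) u1 e1⟩
    have e3 : u2 t = f t - coeffMul (fun z => (V' z : ℂ)) u t + (dd 0 t + dd 1 t + dd 2 t) := by
      rw [e2 t ht, Fin.sum_univ_three]
      rfl
    filter_upwards [Lp.coeFn_add (f t - coeffMul (fun z => (V' z : ℂ)) u t)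
      (dd 0 t + dd 1 t + dd 2 t), Lp.coeFn_sub (f t) (coeffMul (fun z => (V' z : ℂ)) u t),
      Lp.coeFn_add (dd 0 t + dd 1 t) (dd 2 t), Lp.coeFn_add (dd 0 t) (dd 1 t),
      (hM t).coe_mulB (u t)] with x a1 a2 a3 a4 a5
    rw [e3, a1, Pi.add_apply, a2, Pi.sub_apply, a3, Pi.add_apply, a4, Pi.add_apply,
      Fin.sum_univ_three, coeffMul, a5, slice]
    ring
  have hz : ∀ t ∈ Ioo 0 T, ∀ᵐ x ∂leb3, r + T + 2 < ‖x‖ → u t x = 0 := fun t ht =>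
    hu'.eq_zero_of_source hT hV's.continuous hsupp ht
  refine ⟨u, hur, ?_, hz⟩
  obtain ⟨u1, u2, d, dd, e, D, hj, heq, hlim⟩ := hu'
  refine ⟨u1, u2, d, dd, e, D, hj, fun t ht => ?_, hlim⟩
  filter_upwards [heq t ht, hz t ht] with x a1 a2
  rw [← a1]
  by_cases hx : r + T + 2 < ‖x‖
  · rw [a2 hx, mul_zero, mul_zero]
  · have hχ : χ x = 1 := χ.one_of_mem_closedBall (by
      rw [mem_closedBall_zero_iff]
      change ‖x‖ ≤ |r| + T + 2
      linarith [le_abs_self r, not_lt.1 hx])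
    simp only [hV', hκ t ht, hχ, one_mul]

end

end

noncomputable section

/-! ### Distributional and strong solutions -/

theorem IsCoeff.mul_left {W a : ℝ × R3 → ℂ} (h : IsCoeff W) (ha : ContDiff ℝ ∞ a) :
    IsCoeff fun z => a z * W z :=
  ⟨ha.mul h.smooth, h.cpt.mul_left⟩

theorem IsCoeff.isTest_slice {W : ℝ × R3 → ℂ} (h : IsCoeff W) (t : ℝ) : IsTest (slice W t) := by
  refine ⟨contDiff_slice h.smooth t, ?_⟩
  refine HasCompactSupport.intro (h.cpt.isCompact.image continuous_snd) fun x hx => ?_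
  exact image_eq_zero_of_notMem_tsupport (f := W) (x := (t, x)) fun h' => hx ⟨(t, x), h', rfl⟩

theorem IsCoeff.exists_cutoff {W : ℝ × R3 → ℂ} (h : IsCoeff W) :
    ∃ χ : R3 → ℝ, IsTest χ ∧ ∀ z ∈ tsupport W, χ z.2 = 1 := by
  obtain ⟨R, hR⟩ := (h.cpt.isCompact.image continuous_snd).isBounded.subset_closedBall (0 : R3)
  let χ : ContDiffBump (0 : R3) := ⟨|R| + 1, |R| + 2, by positivity, by linarith⟩
  refine ⟨χ, ⟨χ.contDiff, χ.hasCompactSupport⟩, fun z hz => χ.one_of_mem_closedBall ?_⟩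
  refine Metric.closedBall_subset_closedBall ?_ (hR ⟨z, hz, rfl⟩)
  change R ≤ |R| + 1
  linarith [le_abs_self R]

theorem tpair_slice_eq {W : ℝ × R3 → ℂ} {χ : R3 → ℝ} (hχ : IsTest χ) (hW : IsCoeff W)
    (h : ∀ z ∈ tsupport W, χ z.2 = 1) (t : ℝ) (g : L2R3) :
    tpair (slice W t) g = tpair (ofR χ) (mulB (slice W t) g) := by
  obtain ⟨M, hM⟩ := hW.exists_bound
  rw [tpair_mulB hχ.ofReal.memLp (hM t)]
  congr 2
  ext x
  by_cases hx : (t, x) ∈ tsupport W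
  · rw [ofR, show χ x = 1 from h _ hx, Complex.ofReal_one, one_mul]
  · rw [slice, image_eq_zero_of_notMem_tsupport hx, mul_zero]

theorem tsupport_dirD_subset (v : ℝ × R3) (W : ℝ × R3 → ℂ) : tsupport (dirD v W) ⊆ tsupport W :=
  tsupport_fderiv_apply_subset ℝ v

theorem IsCoeff.hasDerivAt_tpair {W : ℝ × R3 → ℂ} (h : IsCoeff W) {u : ℝ → L2R3} {u' : L2R3}
    {t : ℝ} (hu : HasDerivAt u u' t) : HasDerivAt (fun s => tpair (slice W s) (u s))
      (tpair (slice (_root_.dirD (1, 0) W) t) (u t) + tpair (slice W t) u') t := by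
  obtain ⟨χ, hχ, h1⟩ := h.exists_cutoff
  simp only [tpair_slice_eq hχ h h1,
    tpair_slice_eq hχ (h.dirD (1, 0)) fun z hz => h1 z (tsupport_dirD_subset _ _ hz)]
  rw [← map_add]
  exact tpair_hasDerivAt _ (h.hasDerivAt hu)

theorem IsCoeff.bddCurve_tpair {T : ℝ} {W : ℝ × R3 → ℂ} (h : IsCoeff W) {u : ℝ → L2R3} {C : ℝ}
    (hu : BddCurve T u C) : ∃ D, BddCurve T (fun t => tpair (slice W t) (u t)) D := by
  obtain ⟨χ, hχ, h1⟩ := h.exists_cutoff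
  obtain ⟨D, hD⟩ := h.bddCurve hu
  simp only [tpair_slice_eq hχ h h1]
  exact ⟨‖tpair (ofR χ)‖ * D, (tpair (ofR χ)).continuous.comp_continuousOn hD.cont,
    mul_nonneg (norm_nonneg _) hD.nonneg, fun t ht => ((tpair (ofR χ)).le_opNorm _).trans
      (mul_le_mul_of_nonneg_left (hD.bound t ht) (norm_nonneg _))⟩

theorem IsCoeff.tendsto_tpair {W : ℝ × R3 → ℂ} (h : IsCoeff W) {u : ℝ → L2R3} {l : L2R3}
    (hu : Tendsto u (𝓝[>] 0) (𝓝 l)) :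
    Tendsto (fun t => tpair (slice W t) (u t)) (𝓝[>] 0) (𝓝 (tpair (slice W 0) l)) := by
  obtain ⟨χ, hχ, h1⟩ := h.exists_cutoff
  simp only [tpair_slice_eq hχ h h1]
  refine ((tpair (ofR χ)).continuous.tendsto _).comp ?_
  have h2 : Tendsto (fun t => mulB (slice W t)) (𝓝[>] 0) (𝓝 (mulB (slice W 0))) :=
    (h.continuous_mulB.tendsto 0).mono_left nhdsWithin_le_nhds
  have h3 := (isBoundedBilinearMap_apply (𝕜 := ℂ) (E := L2R3) (F := L2R3)).continuous.tendsto
    (mulB (slice W 0), l)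
  exact h3.comp (h2.prodMk_nhds hu)

theorem BddCurve.integrableOn {E : Type*} [NormedAddCommGroup E] {T : ℝ} {u : ℝ → E}
    [SecondCountableTopologyEither ℝ E] {C : ℝ} (hu : BddCurve T u C) : IntegrableOn u (Ioo 0 T) := by
  refine Integrable.of_bound (hu.cont.aestronglyMeasurable measurableSet_Ioo) C ?_
  filter_upwards [ae_restrict_mem measurableSet_Ioo] with τ hτ
  exact hu.bound τ hτ

/-- A real test function on space-time, seen as a coefficient. -/
def stC (φ : ℝ × R3 → ℝ) (z : ℝ × R3) : ℂ := (φ z : ℂ)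

theorem isCoeff_stC {φ : ℝ × R3 → ℝ} (h : ContDiff ℝ ∞ φ) (hc : HasCompactSupport φ) :
    IsCoeff (stC φ) :=
  ⟨Complex.ofRealCLM.contDiff.comp h, hc.comp_left (g := ((↑) : ℝ → ℂ)) rfl⟩

theorem dirD_stC {φ : ℝ × R3 → ℝ} (h : ContDiff ℝ ∞ φ) (v : ℝ × R3) :
    dirD v (stC φ) = stC fun z => fderiv ℝ φ z v := by
  ext z
  have := (Complex.ofRealCLM.hasFDerivAt.comp z
    (h.differentiable (by simp) z).hasFDerivAt).fderiv
  rw [dirD, show stC φ = Complex.ofRealCLM ∘ φ from rfl, this]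
  rfl

theorem contDiff_fderiv_apply {φ : ℝ × R3 → ℝ} (h : ContDiff ℝ ∞ φ) (v : ℝ × R3) :
    ContDiff ℝ ∞ fun z => fderiv ℝ φ z v :=
  (h.fderiv_right (m := ∞) (by simp)).clm_apply contDiff_const

theorem laplacian_eq_lap3 {f : R3 → ℝ} (h : ContDiff ℝ ∞ f) : Δ f = lap3 f := by
  rw [InnerProductSpace.laplacian_eq_iteratedFDeriv_orthonormalBasis f
    (EuclideanSpace.basisFun (Fin 3) ℝ)]
  ext x
  refine Finset.sum_congr rfl fun i _ => ?_
  rw [iteratedFDeriv_two_apply]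
  have h1 : DifferentiableAt ℝ (fderiv ℝ f) x :=
    (h.fderiv_right (m := ∞) (by simp)).differentiable (by simp) x
  have h2 := (h1.hasFDerivAt.clm_apply (hasFDerivAt_const (e3 i) x)).fderiv
  change _ = fderiv ℝ (fun y => fderiv ℝ f y (e3 i)) x (e3 i)
  rw [h2]
  simp

theorem hasDerivAt_fst {φ : ℝ × R3 → ℝ} (h : ContDiff ℝ ∞ φ) (t : ℝ) (x : R3) :
    HasDerivAt (fun s => φ (s, x)) (fderiv ℝ φ (t, x) (1, 0)) t := by
  have h1 : HasFDerivAt (fun s : ℝ => (s, x)) (ContinuousLinearMap.inl ℝ ℝ R3) t := by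
    exact hasFDerivAt_prodMk_left t x
  have := ((h.differentiable (by simp) (t, x)).hasFDerivAt.comp t h1).hasDerivAt
  simpa [Function.comp_def] using this

/-- The d'Alembertian through directional derivatives on space-time. -/
theorem dAlembertian_eq {φ : ℝ × R3 → ℝ} (h : ContDiff ℝ ∞ φ) (t : ℝ) (x : R3) :
    (dAlembertian φ (t, x) : ℂ) = slice (dirD (1, 0) (dirD (1, 0) (stC φ))) t x -
      ∑ i, slice (dirD (0, e3 i) (dirD (0, e3 i) (stC φ))) t x := by
  have e1 : iteratedDeriv 2 (fun t => φ (t, x)) t =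
      fderiv ℝ (fun z => fderiv ℝ φ z (1, 0)) (t, x) (1, 0) := by
    rw [iteratedDeriv_succ, iteratedDeriv_one]
    have : deriv (fun t => φ (t, x)) = fun t => fderiv ℝ φ (t, x) (1, 0) :=
      funext fun t => (hasDerivAt_fst h t x).deriv
    rw [this]
    exact (hasDerivAt_fst (contDiff_fderiv_apply h (1, 0)) t x).deriv
  have hs : ContDiff ℝ ∞ fun x => φ (t, x) := h.comp (contDiff_const.prodMk contDiff_id)
  have e2 : ∀ i, slice (dirD (0, e3 i) (dirD (0, e3 i) (stC φ))) t x =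
      ((pd i (pd i fun x => φ (t, x)) x : ℝ) : ℂ) := fun i => by
    have hc : ContDiff ℝ ∞ (stC φ) := Complex.ofRealCLM.contDiff.comp h
    have h1 : slice (dirD (0, e3 i) (stC φ)) t = ofR (pd i fun x => φ (t, x)) := by
      rw [← pd_slice hc]
      exact funext fun x => pd_ofReal hs i x
    have hc' : ContDiff ℝ ∞ (dirD (0, e3 i) (stC φ)) :=
      (hc.fderiv_right (m := ∞) (by simp)).clm_apply contDiff_const
    rw [← pd_slice hc', h1, pd_ofReal (contDiff_pd hs i), ofR]
  rw [dAlembertian, e1, laplacian_eq_lap3 hs, lap3, Complex.ofReal_sub, Complex.ofReal_sum]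
  simp only [e2]
  rw [dirD_stC h, dirD_stC (contDiff_fderiv_apply h (1, 0))]
  rfl

/-- The zeroth order term of the equation, tested against `φ`. -/
def potC (V φ : ℝ × R3 → ℝ) (z : ℝ × R3) : ℂ := (V z : ℂ) * stC φ z

theorem isCoeff_potC {V φ : ℝ × R3 → ℝ} (hV : ContDiff ℝ ∞ V) (h : ContDiff ℝ ∞ φ)
    (hc : HasCompactSupport φ) : IsCoeff (potC V φ) :=
  (isCoeff_stC h hc).mul_left (a := fun z => (V z : ℂ)) (Complex.ofRealCLM.contDiff.comp hV)

theorem integral_eq_tpair {F : R3 → ℂ} {g : L2R3} (h : ∀ᵐ x ∂leb3, F x = g x) {c : R3 → ℝ}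
    {a : R3 → ℂ} (ha : MemLp a 2 leb3) (hca : ∀ x, (c x : ℂ) = a x) :
    ∫ x, c x • F x = tpair a g := by
  rw [tpair_apply ha, leb3_eq]
  rw [leb3_eq] at h
  refine integral_congr_ae ?_
  filter_upwards [h] with x hx
  rw [hx, ← hca, Complex.real_smul]

theorem tpair_sub {a b : R3 → ℂ} (ha : MemLp a 2 leb3) (hb : MemLp b 2 leb3) :
    tpair (fun x => a x - b x) = tpair a - tpair b := by
  have h := tpair_add ha (hb.const_mul (-1))
  rw [tpair_smul hb] at h
  ext g
  have h1 : tpair (fun x => a x + -1 * b x) g = tpair a g + -1 * tpair b g := by rw [h]; rfl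
  rw [_root_.sub_apply, sub_eq_add_neg, ← neg_one_mul, ← h1]
  simp only [neg_one_mul, ← sub_eq_add_neg]

section

variable {T : ℝ} {u u1 u2 : ℝ → L2R3} {d dd e : Fin 3 → ℝ → L2R3} {C : ℝ}

/-- The residual of the equation `∂ₜ²u - Δu + V u = G` at time `t`, tested against `φ`. -/
def waveResidual (V φ : ℝ × R3 → ℝ) (u u2 : ℝ → L2R3) (dd : Fin 3 → ℝ → L2R3) (G : ℝ → L2R3)
    (t : ℝ) : ℂ :=
  tpair (slice (stC φ) t) (u2 t - (dd 0 t + dd 1 t + dd 2 t) - G t) + tpair (slice (potC V φ) t) (u t)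

theorem WaveJet.bddCurve_waveResidual (hj : WaveJet T u u1 u2 d dd e C) {V φ : ℝ × R3 → ℝ}
    (hV : ContDiff ℝ ∞ V) (h : ContDiff ℝ ∞ φ) (hc : HasCompactSupport φ) {G : ℝ → L2R3} {D : ℝ}
    (hG : BddCurve T G D) : ∃ K, BddCurve T (waveResidual V φ u u2 dd G) K := by
  obtain ⟨K, hK⟩ := (isCoeff_stC h hc).bddCurve_tpair
    ((hj.bdd2.sub (((hj.bddxx 0).add (hj.bddxx 1)).add (hj.bddxx 2))).sub hG)
  obtain ⟨K', hK'⟩ := (isCoeff_potC hV h hc).bddCurve_tpair hj.bdd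
  exact ⟨K + K', hK.add hK'⟩

/-- Integration by parts in time: the initial values of the wave enter the weak form of the wave
equation. -/
theorem WaveJet.weak_sub (hT : 0 < T) (hj : WaveJet T u u1 u2 d dd e C) {V φ : ℝ × R3 → ℝ}
    (hV : ContDiff ℝ ∞ V) (h : ContDiff ℝ ∞ φ) (hc : HasCompactSupport φ)
    (hφT : tsupport φ ⊆ Iio T ×ˢ univ) {G : ℝ → L2R3} {D : ℝ} (hG : BddCurve T G D)
    {U F : ℝ → R3 → ℂ} (hU0 : ∀ t ∉ Ioo 0 T, ∀ x, U t x = 0) (hF0 : ∀ t ∉ Ioo 0 T, ∀ x, F t x = 0)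
    (hU : ∀ t ∈ Ioo 0 T, ∀ᵐ x ∂leb3, U t x = u t x)
    (hF : ∀ t ∈ Ioo 0 T, ∀ᵐ x ∂leb3, F t x = G t x) {a b : L2R3}
    (ha : Tendsto u (𝓝[>] 0) (𝓝 a)) (hb : Tendsto u1 (𝓝[>] 0) (𝓝 b)) :
    (∫ t, ∫ x, (dAlembertian φ (t, x) + V (t, x) * φ (t, x)) • U t x) - ∫ t, ∫ x, φ (t, x) • F t x =
      (∫ t in Ioo 0 T, waveResidual V φ u u2 dd G t) -
        (tpair (slice (dirD (1, 0) (stC φ)) 0) a - tpair (slice (stC φ) 0) b) := by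
  have hW := isCoeff_stC h hc
  have hVW := isCoeff_potC hV h hc
  have hWt := hW.dirD (1, 0)
  have hWtt := hWt.dirD (1, 0)
  have hWii := fun i => (hW.dirD (0, e3 i)).dirD (0, e3 i)
  set Q : ℝ → ℂ := fun t => tpair (slice (dirD (1, 0) (stC φ)) t) (u t) -
    tpair (slice (stC φ) t) (u1 t) with hQ
  set Q' : ℝ → ℂ := fun t => tpair (slice (dirD (1, 0) (dirD (1, 0) (stC φ))) t) (u t) -
    tpair (slice (stC φ) t) (u2 t) with hQ'
  have eF : ∀ t ∈ Ioo 0 T, ∫ x, φ (t, x) • F t x = tpair (slice (stC φ) t) (G t) := fun t ht =>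
    integral_eq_tpair (hF t ht) (hW.isTest_slice t).memLp fun x => rfl
  have eU : ∀ t ∈ Ioo 0 T, ∫ x, (dAlembertian φ (t, x) + V (t, x) * φ (t, x)) • U t x =
      Q' t + (waveResidual V φ u u2 dd G t + tpair (slice (stC φ) t) (G t)) := fun t ht => by
    have m0 := (hWtt.isTest_slice t).memLp
    have mi := fun i => ((hWii i).isTest_slice t).memLp
    have mV := (hVW.isTest_slice t).memLp
    have e1 := integral_eq_tpair (hU t ht)
      (c := fun x => dAlembertian φ (t, x) + V (t, x) * φ (t, x))
      (a := fun x => (slice (dirD (1, 0) (dirD (1, 0) (stC φ))) t x -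
        ((slice (dirD (0, e3 0) (dirD (0, e3 0) (stC φ))) t x +
          slice (dirD (0, e3 1) (dirD (0, e3 1) (stC φ))) t x) +
          slice (dirD (0, e3 2) (dirD (0, e3 2) (stC φ))) t x)) + slice (potC V φ) t x)
      ((m0.sub (((mi 0).add (mi 1)).add (mi 2))).add mV) fun x => by
        rw [Complex.ofReal_add, dAlembertian_eq h, Fin.sum_univ_three, Complex.ofReal_mul]
        rfl
    have s1 := tpair_add (m0.sub (((mi 0).add (mi 1)).add (mi 2))) mV
    have s2 := tpair_sub m0 (((mi 0).add (mi 1)).add (mi 2))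
    have s3 := tpair_add ((mi 0).add (mi 1)) (mi 2)
    have s4 := tpair_add (mi 0) (mi 1)
    have s5 : ∀ i, tpair (slice (dirD (0, e3 i) (dirD (0, e3 i) (stC φ))) t) (u t) =
        tpair (slice (stC φ) t) (dd i t) := fun i => by
      rw [← pd_slice (hW.dirD (0, e3 i)).smooth, ← pd_slice hW.smooth]
      have a1 := (hj.dx i t ht).complex ((hW.isTest_slice t).pd i)
      have a2 := (hj.dxx i t ht).complex (hW.isTest_slice t)
      rw [a1, a2, neg_neg]
    have e2 : tpair (fun x => (slice (dirD (1, 0) (dirD (1, 0) (stC φ))) t x -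
        ((slice (dirD (0, e3 0) (dirD (0, e3 0) (stC φ))) t x +
          slice (dirD (0, e3 1) (dirD (0, e3 1) (stC φ))) t x) +
          slice (dirD (0, e3 2) (dirD (0, e3 2) (stC φ))) t x)) + slice (potC V φ) t x) =
        tpair (slice (dirD (1, 0) (dirD (1, 0) (stC φ))) t) -
          (tpair (slice (dirD (0, e3 0) (dirD (0, e3 0) (stC φ))) t) +
          tpair (slice (dirD (0, e3 1) (dirD (0, e3 1) (stC φ))) t) +
          tpair (slice (dirD (0, e3 2) (dirD (0, e3 2) (stC φ))) t)) + tpair (slice (potC V φ) t) := by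
      rw [← s4]
      refine Eq.trans ?_ (congrArg₂ (· + ·) (congrArg₂ (· - ·) rfl s3) rfl)
      exact s1.trans (congrArg₂ (· + ·) s2 rfl)
    rw [e1, e2]
    simp only [_root_.add_apply, _root_.sub_apply, s5, hQ', waveResidual, map_sub, map_add]
    ring
  have hQd : ∀ t ∈ Ioo 0 T, HasDerivAt Q (Q' t) t := fun t ht => by
    have a1 := (hWt.hasDerivAt_tpair (hj.dt t ht)).sub (hW.hasDerivAt_tpair (hj.dtt t ht))
    refine a1.congr_deriv ?_
    simp only [hQ']
    ring
  obtain ⟨K1, hK1⟩ := hWtt.bddCurve_tpair hj.bdd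
  obtain ⟨K2, hK2⟩ := hW.bddCurve_tpair hj.bdd2
  obtain ⟨K3, hK3⟩ := hj.bddCurve_waveResidual hV h hc hG
  obtain ⟨K4, hK4⟩ := hW.bddCurve_tpair hG
  have hQi : IntegrableOn Q' (Ioo 0 T) := (hK1.sub hK2).integrableOn
  have hQ0 : Tendsto Q (𝓝[>] 0) (𝓝 (tpair (slice (dirD (1, 0) (stC φ)) 0) a -
      tpair (slice (stC φ) 0) b)) := (hWt.tendsto_tpair ha).sub (hW.tendsto_tpair hb)
  -- `φ` vanishes near time `T`
  have hQT : Tendsto Q (𝓝[<] T) (𝓝 0) := by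
    have hcl : IsClosed (Prod.fst '' tsupport φ) := (hc.isCompact.image continuous_fst).isClosed
    have hTn : T ∉ Prod.fst '' tsupport φ := by
      rintro ⟨z, hz, hzT⟩
      exact (ne_of_lt (show z.1 < T from (hφT hz).1)) hzT
    refine tendsto_const_nhds.congr' ?_
    filter_upwards [nhdsWithin_le_nhds (hcl.isOpen_compl.mem_nhds hTn)] with t ht
    have hz : ∀ x, (t, x) ∉ tsupport (stC φ) := fun x hx => ht ⟨(t, x),
      tsupport_comp_subset (g := ((↑) : ℝ → ℂ)) rfl φ hx, rfl⟩
    have z1 : slice (stC φ) t = fun x => 0 * slice (stC φ) t x := by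
      ext x
      rw [slice, image_eq_zero_of_notMem_tsupport (hz x), zero_mul]
    have z2 : slice (dirD (1, 0) (stC φ)) t = fun x => 0 * slice (dirD (1, 0) (stC φ)) t x := by
      ext x
      rw [slice, image_eq_zero_of_notMem_tsupport fun h' => hz x (tsupport_dirD_subset _ _ h'),
        zero_mul]
    simp only [hQ]
    rw [z1, z2, tpair_smul (hW.isTest_slice t).memLp, tpair_smul (hWt.isTest_slice t).memLp]
    change (0 : ℂ) = 0 * _ - 0 * _
    rw [zero_mul, zero_mul, sub_zero]
  have hint : ∫ t in Ioo 0 T, Q' t = 0 - (tpair (slice (dirD (1, 0) (stC φ)) 0) a -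
      tpair (slice (stC φ) 0) b) := by
    rw [← integral_Ioc_eq_integral_Ioo, ← intervalIntegral.integral_of_le hT.le]
    exact intervalIntegral.integral_eq_sub_of_hasDerivAt_of_tendsto hT hQd
      ((intervalIntegrable_iff_integrableOn_Ioo_of_le hT.le).2 hQi) hQ0 hQT
  have L1 : ∫ t, ∫ x, (dAlembertian φ (t, x) + V (t, x) * φ (t, x)) • U t x =
      ∫ t in Ioo 0 T, (Q' t + (waveResidual V φ u u2 dd G t + tpair (slice (stC φ) t) (G t))) := by
    rw [← setIntegral_eq_integral_of_forall_compl_eq_zero (s := Ioo 0 T) fun t ht => by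
      simp [hU0 t ht]]
    exact setIntegral_congr_fun measurableSet_Ioo eU
  have L2 : ∫ t, ∫ x, φ (t, x) • F t x = ∫ t in Ioo 0 T, tpair (slice (stC φ) t) (G t) := by
    rw [← setIntegral_eq_integral_of_forall_compl_eq_zero (s := Ioo 0 T) fun t ht => by
      simp [hF0 t ht]]
    exact setIntegral_congr_fun measurableSet_Ioo eF
  have I1 : IntegrableOn (fun t => waveResidual V φ u u2 dd G t + tpair (slice (stC φ) t) (G t))
      (Ioo 0 T) := (hK3.add hK4).integrableOn
  rw [L1, L2, integral_add hQi I1, integral_add hK3.integrableOn hK4.integrableOn, hint]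
  ring

end

end

noncomputable section

theorem memLp_test_mul {b : R3 → ℝ} (hb : IsTest b) {v : R3 → ℝ} (hv : Continuous v) :
    MemLp (fun x => (v x : ℂ) * ofR b x) 2 leb3 :=
  ((Complex.continuous_ofReal.comp hv).mul hb.ofReal.smooth.continuous).memLp_of_hasCompactSupport
    hb.ofReal.cpt.mul_left

theorem tpair_add_mul {b : R3 → ℝ} (hb : IsTest b) {v : R3 → ℝ} (hv : Continuous v) (p g : L2R3) :
    tpair (ofR b) p + tpair (fun x => (v x : ℂ) * ofR b x) g =
      ∫ x, b x • (p x + v x * g x) ∂leb3 := by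
  rw [tpair_apply hb.ofReal.memLp, tpair_apply (memLp_test_mul hb hv),
    ← integral_add (integrable_mul_L2 hb.ofReal.memLp p) (integrable_mul_L2 (memLp_test_mul hb hv) g)]
  refine integral_congr_ae (.of_forall fun x => ?_)
  simp only [ofR, Complex.real_smul]
  ring

/-- The pointwise equation and the equation tested against functions of space are equivalent. -/
theorem ae_add_mul_eq_zero_iff {v : R3 → ℝ} (hv : Continuous v) (p g : L2R3) :
    (∀ᵐ x ∂leb3, p x + v x * g x = 0) ↔ ∀ b : R3 → ℝ, IsTest b →
      tpair (ofR b) p + tpair (fun x => (v x : ℂ) * ofR b x) g = 0 := by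
  constructor
  · intro h b hb
    rw [tpair_add_mul hb hv]
    refine integral_eq_zero_of_ae ?_
    filter_upwards [h] with x hx
    rw [hx, smul_zero, Pi.zero_apply]
  · intro h
    have hl : LocallyIntegrable (fun x => p x + v x * g x) leb3 :=
      p.locallyIntegrable.add (g.locallyIntegrable.continuous_mul
        (Complex.continuous_ofReal.comp hv))
    have h1 := ae_eq_zero_of_integral_contDiff_smul_eq_zero hl fun b h1 h2 => by
      rw [← tpair_add_mul ⟨h1, h2⟩ hv]
      exact h b ⟨h1, h2⟩
    exact h1

section

variable {T : ℝ} {V : ℝ × R3 → ℝ} {G u : ℝ → L2R3} {U F : ℝ → R3 → ℂ}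

theorem coe_sub_sum_sub (u2 d0 d1 d2 G : L2R3) : ∀ᵐ x ∂leb3,
    (u2 - (d0 + d1 + d2) - G) x = u2 x - (d0 x + d1 x + d2 x) - G x := by
  filter_upwards [Lp.coeFn_sub (u2 - (d0 + d1 + d2)) G, Lp.coeFn_sub u2 (d0 + d1 + d2),
    Lp.coeFn_add (d0 + d1) d2, Lp.coeFn_add d0 d1] with x a1 a2 a3 a4
  rw [a1, Pi.sub_apply, a2, Pi.sub_apply, a3, Pi.add_apply, a4, Pi.add_apply]

theorem waveResidual_eq_zero (hV : Continuous V) {φ : ℝ × R3 → ℝ} (h : ContDiff ℝ ∞ φ)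
    (hc : HasCompactSupport φ) {u2 : ℝ → L2R3} {dd : Fin 3 → ℝ → L2R3} {t : ℝ}
    (heq : ∀ᵐ x ∂leb3, u2 t x - ∑ i, dd i t x + V (t, x) * u t x = G t x) :
    waveResidual V φ u u2 dd G t = 0 := by
  have hb : IsTest fun x => φ (t, x) := by
    have := ((isCoeff_stC h hc).isTest_slice t).re
    exact this
  refine (ae_add_mul_eq_zero_iff (v := fun x => V (t, x)) (by fun_prop) _ (u t)).1 ?_ _ hb
  filter_upwards [heq, coe_sub_sum_sub (u2 t) (dd 0 t) (dd 1 t) (dd 2 t) (G t)] with x a1 a2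
  rw [a2, ← a1, Fin.sum_univ_three]
  ring

/-- A strong solution, extended by zero, is a distributional solution. -/
theorem StrongSol.isWaveSolution (hT : 0 < T) (hV : ContDiff ℝ ∞ V) {D : ℝ} (hG : BddCurve T G D)
    (hs : StrongSol T V (fun t => G t) u) (hU0 : ∀ t ∉ Ioo 0 T, ∀ x, U t x = 0)
    (hF0 : ∀ t ∉ Ioo 0 T, ∀ x, F t x = 0) (hU : ∀ t ∈ Ioo 0 T, ∀ᵐ x ∂leb3, U t x = u t x)
    (hF : ∀ t ∈ Ioo 0 T, ∀ᵐ x ∂leb3, F t x = G t x) : IsWaveSolution T V F U := by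
  obtain ⟨u1, u2, d, dd, e, C, hj, heq, h0, h1⟩ := hs
  refine ⟨fun t ht => hU0 t fun h => absurd h.1 (not_lt.2 ht), fun φ h hc hφ => ?_⟩
  have key := hj.weak_sub hT hV h hc hφ hG hU0 hF0 hU hF h0 h1
  rw [setIntegral_congr_fun (g := fun _ => (0 : ℂ)) measurableSet_Ioo fun t ht =>
    waveResidual_eq_zero hV.continuous h hc (heq t ht), integral_zero, map_zero, map_zero, sub_zero,
    sub_zero, sub_eq_zero] at key
  exact key

/-- A product test function. -/
def prodTest (α : ℝ → ℝ) (b : R3 → ℝ) (z : ℝ × R3) : ℝ := α z.1 * b z.2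

theorem contDiff_prodTest {α : ℝ → ℝ} (hα : ContDiff ℝ ∞ α) {b : R3 → ℝ} (hb : IsTest b) :
    ContDiff ℝ ∞ (prodTest α b) :=
  (hα.comp contDiff_fst).mul (hb.smooth.comp contDiff_snd)

theorem tsupport_prodTest (α : ℝ → ℝ) (b : R3 → ℝ) :
    tsupport (prodTest α b) ⊆ tsupport α ×ˢ tsupport b := by
  refine closure_minimal (fun z hz => ?_) ((isClosed_tsupport α).prod (isClosed_tsupport b))
  exact ⟨subset_tsupport _ (left_ne_zero_of_mul hz), subset_tsupport _ (right_ne_zero_of_mul hz)⟩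

theorem hasCompactSupport_prodTest {α : ℝ → ℝ} (hα : HasCompactSupport α) {b : R3 → ℝ}
    (hb : IsTest b) : HasCompactSupport (prodTest α b) :=
  (hα.isCompact.prod hb.cpt.isCompact).of_isClosed_subset (isClosed_tsupport _)
    (tsupport_prodTest α b)

theorem tpair_slice_prodTest (α : ℝ → ℝ) {b : R3 → ℝ} (hb : IsTest b) (t : ℝ) (g : L2R3) :
    tpair (slice (stC (prodTest α b)) t) g = α t * tpair (ofR b) g := by
  have : slice (stC (prodTest α b)) t = fun x => (α t : ℂ) * ofR b x := by
    ext x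
    simp [slice, stC, prodTest, ofR]
  rw [this, tpair_smul hb.ofReal.memLp]
  rfl

theorem tpair_slice_dirD_prodTest {α : ℝ → ℝ} (hα : ContDiff ℝ ∞ α) {b : R3 → ℝ} (hb : IsTest b)
    (t : ℝ) (g : L2R3) :
    tpair (slice (dirD (1, 0) (stC (prodTest α b))) t) g = (deriv α t : ℝ) * tpair (ofR b) g := by
  have : slice (dirD (1, 0) (stC (prodTest α b))) t = fun x => ((deriv α t : ℝ) : ℂ) * ofR b x := by
    ext x
    have h1 := hasDerivAt_slice (W := stC (prodTest α b))
      (Complex.ofRealCLM.contDiff.comp (contDiff_prodTest hα hb)) t x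
    have h2 := (((hα.differentiable (by simp) t).hasDerivAt).mul_const (b x)).ofReal_comp
    rw [h1.unique h2, Complex.ofReal_mul, ofR]
  rw [this, tpair_smul hb.ofReal.memLp]
  rfl

theorem waveResidual_prodTest (hV : Continuous V) (α : ℝ → ℝ) {b : R3 → ℝ} (hb : IsTest b)
    (u2 : ℝ → L2R3) (dd : Fin 3 → ℝ → L2R3) (t : ℝ) :
    waveResidual V (prodTest α b) u u2 dd G t =
      α t * (tpair (ofR b) (u2 t - (dd 0 t + dd 1 t + dd 2 t) - G t) +
        tpair (fun x => (V (t, x) : ℂ) * ofR b x) (u t)) := by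
  have : slice (potC V (prodTest α b)) t =
      fun x => (α t : ℂ) * ((V (t, x) : ℂ) * ofR b x) := by
    ext x
    simp only [slice, potC, stC, prodTest, ofR, Complex.ofReal_mul]
    ring
  rw [waveResidual, tpair_slice_prodTest α hb, this,
    tpair_smul (memLp_test_mul hb (v := fun x => V (t, x)) (by fun_prop)), mul_add]
  rfl

/-- A regular distributional solution is a strong solution: testing inside `(0,T)` gives the
equation, and testing across `t = 0` the initial values. -/
theorem StrongSol.of_isWaveSolution (hT : 0 < T) (hV : ContDiff ℝ ∞ V) {C D : ℝ}
    (hu : Reg T 2 u C) (hG : BddCurve T G D) (hU0 : ∀ t ∉ Ioo 0 T, ∀ x, U t x = 0)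
    (hF0 : ∀ t ∉ Ioo 0 T, ∀ x, F t x = 0) (hU : ∀ t ∈ Ioo 0 T, ∀ᵐ x ∂leb3, U t x = u t x)
    (hF : ∀ t ∈ Ioo 0 T, ∀ᵐ x ∂leb3, F t x = G t x) (hw : IsWaveSolution T V F U) :
    StrongSol T V (fun t => G t) u := by
  obtain ⟨u1, u2, d, dd, e, hj⟩ := hu.exists_waveJet
  obtain ⟨a, ha⟩ := hj.dt.exists_tendsto hT hj.bdd1
  obtain ⟨a1, ha1⟩ := hj.dtt.exists_tendsto hT hj.bdd2
  have key : ∀ (α : ℝ → ℝ) (b : R3 → ℝ), ContDiff ℝ ∞ α → HasCompactSupport α →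
      tsupport α ⊆ Iio T → IsTest b →
      ∫ t in Ioo 0 T, waveResidual V (prodTest α b) u u2 dd G t =
        (deriv α 0 : ℝ) * tpair (ofR b) a - α 0 * tpair (ofR b) a1 := fun α b hα hαc hαT hb => by
    have hφ := contDiff_prodTest hα hb
    have hφc := hasCompactSupport_prodTest hαc hb
    have hφT : tsupport (prodTest α b) ⊆ Iio T ×ˢ univ := fun z hz =>
      ⟨hαT (tsupport_prodTest α b hz).1, mem_univ _⟩
    have h1 := hj.weak_sub hT hV hφ hφc hφT hG hU0 hF0 hU hF ha ha1
    rw [hw.2 _ hφ hφc hφT, sub_self, tpair_slice_dirD_prodTest hα hb, tpair_slice_prodTest α hb] at h1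
    exact (sub_eq_zero.1 h1.symm)
  -- test functions supported inside `(0,T)` do not see the initial values
  have hzero : ∀ b : R3 → ℝ, IsTest b → ∀ t ∈ Ioo 0 T,
      tpair (ofR b) (u2 t - (dd 0 t + dd 1 t + dd 2 t) - G t) +
        tpair (fun x => (V (t, x) : ℂ) * ofR b x) (u t) = 0 := fun b hb => by
    set r : ℝ → ℂ := fun t => tpair (ofR b) (u2 t - (dd 0 t + dd 1 t + dd 2 t) - G t) +
        tpair (fun x => (V (t, x) : ℂ) * ofR b x) (u t) with hr
    let κ : ContDiffBump (T / 2 : ℝ) := ⟨T, 2 * T, hT, by linarith⟩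
    have hκ : ∀ t ∈ Ioo 0 T, κ t = 1 := fun t ht => κ.one_of_mem_closedBall (by
      rw [Metric.mem_closedBall, Real.dist_eq, abs_le]
      change -T ≤ _ ∧ _ ≤ T
      constructor <;> linarith [ht.1, ht.2])
    obtain ⟨K, hK⟩ := hj.bddCurve_waveResidual hV (contDiff_prodTest κ.contDiff hb)
      (hasCompactSupport_prodTest κ.hasCompactSupport hb) hG
    have hrK : BddCurve T r K := by
      refine ⟨hK.cont.congr fun t ht => ?_, hK.nonneg, fun t ht => ?_⟩
      · rw [waveResidual_prodTest hV.continuous κ hb, hκ t ht, Complex.ofReal_one, one_mul]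
      · have := hK.bound t ht
        rwa [waveResidual_prodTest hV.continuous κ hb, hκ t ht, Complex.ofReal_one, one_mul] at this
    have h1 := isOpen_Ioo.ae_eq_zero_of_integral_contDiff_smul_eq_zero
      (μ := volume.restrict (Ioo 0 T)) (U := Ioo 0 T) (f := r)
      ((Integrable.locallyIntegrable hrK.integrableOn).locallyIntegrableOn _)
      fun α hα hαc hαU => by
        have h0 : (0 : ℝ) ∉ tsupport α := fun h => lt_irrefl _ (hαU h).1
        have h2 := key α b hα hαc (hαU.trans Ioo_subset_Iio_self) hb
        rw [image_eq_zero_of_notMem_tsupport h0, image_eq_zero_of_notMem_tsupport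
          fun h => h0 (tsupport_deriv_subset h)] at h2
        simp only [waveResidual_prodTest hV.continuous α hb] at h2
        simp only [Complex.real_smul, hr]
        rw [h2]
        simp
    have h3 : r =ᵐ[volume.restrict (Ioo 0 T)] fun _ => 0 := by
      filter_upwards [h1, ae_restrict_mem measurableSet_Ioo] with t h4 h5
      exact h4 h5
    exact Measure.eqOn_open_of_ae_eq h3 isOpen_Ioo hrK.cont continuousOn_const
  have heq : ∀ t ∈ Ioo 0 T, ∀ᵐ x ∂leb3, u2 t x - ∑ i, dd i t x + V (t, x) * u t x = G t x :=
    fun t ht => by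
      have h1 := (ae_add_mul_eq_zero_iff (v := fun x => V (t, x)) (by
        have := hV.continuous
        fun_prop) _ (u t)).2 fun b hb => hzero b hb t ht
      filter_upwards [h1, coe_sub_sum_sub (u2 t) (dd 0 t) (dd 1 t) (dd 2 t) (G t)] with x b1 b2
      rw [b2] at b1
      rw [Fin.sum_univ_three]
      linear_combination b1
  -- time factors with `β = 1` near `0`: `β` isolates `∂ₜu(0)` and `t β(t)` isolates `u(0)`
  let β : ContDiffBump (0 : ℝ) := ⟨T / 4, T / 2, by positivity, by linarith⟩
  have hβT : tsupport β ⊆ Iio T := by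
    rw [β.tsupport_eq, Real.closedBall_eq_Icc]
    intro t ht
    have h1 : t ≤ 0 + T / 2 := ht.2
    change t < T
    linarith
  have hβ0 : (β : ℝ → ℝ) =ᶠ[𝓝 0] fun _ => 1 := by
    filter_upwards [Metric.closedBall_mem_nhds (0 : ℝ) (show 0 < T / 4 by positivity)] with t ht
    exact β.one_of_mem_closedBall ht
  have key2 : ∀ (α : ℝ → ℝ) (b : R3 → ℝ), ContDiff ℝ ∞ α → HasCompactSupport α →
      tsupport α ⊆ Iio T → IsTest b →
      (deriv α 0 : ℝ) * tpair (ofR b) a - α 0 * tpair (ofR b) a1 = 0 := fun α b hα hαc hαT hb => by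
    rw [← key α b hα hαc hαT hb]
    rw [setIntegral_congr_fun (g := fun _ => (0 : ℂ)) measurableSet_Ioo fun t ht =>
      waveResidual_eq_zero hV.continuous (contDiff_prodTest hα hb)
        (hasCompactSupport_prodTest hαc hb) (heq t ht), integral_zero]
  have hz1 : a1 = 0 := eq_zero_of_tpair fun b hb => by
    have h1 := key2 β b β.contDiff β.hasCompactSupport hβT hb
    rw [hβ0.deriv_eq, hβ0.eq_of_nhds] at h1
    simpa using h1
  have hz0 : a = 0 := eq_zero_of_tpair fun b hb => by
    have h1 := key2 (fun t => t * β t) b (contDiff_id.mul β.contDiff) β.hasCompactSupport.mul_left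
      ((tsupport_mul_subset_right).trans hβT) hb
    have h2 : (fun t => t * β t) =ᶠ[𝓝 0] fun t => t := by
      filter_upwards [hβ0] with t ht
      rw [ht, mul_one]
    rw [h2.deriv_eq] at h1
    simpa using h1
  rw [hz0] at ha
  rw [hz1] at ha1
  exact ⟨u1, u2, d, dd, e, C, hj, heq, ha, ha1⟩

end

end

noncomputable section

/-! ### The norm of `𝓗^s` and mixed derivatives -/

theorem partialDeriv_zero (w : Fin 0 → Fin 3) (φ : R3 → ℝ) : partialDeriv w φ = φ :=
  funext fun _ => iteratedFDeriv_zero_apply _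

theorem partialDeriv_snoc {n : ℕ} (w : Fin n → Fin 3) (i : Fin 3) {φ : R3 → ℝ}
    (h : ContDiff ℝ ∞ φ) :
    partialDeriv (Fin.snoc w i : Fin (n + 1) → Fin 3) φ = partialDeriv w (pd i φ) := by
  ext x
  rw [partialDeriv, iteratedFDeriv_succ_apply_right, partialDeriv]
  have hd : ContDiff ℝ ∞ (fderiv ℝ φ) := h.fderiv_right (m := ∞) (by simp)
  have h1 := (ContinuousLinearMap.apply ℝ ℝ (e3 i)).iteratedFDeriv_comp_left (f := fderiv ℝ φ)
    (x := x) (hd.contDiffAt) (i := n) (by exact_mod_cast le_top)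
  have h2 : (ContinuousLinearMap.apply ℝ ℝ (e3 i)) ∘ fderiv ℝ φ = pd i φ := rfl
  rw [h2] at h1
  rw [h1]
  have h3 : (Fin.init fun k => EuclideanSpace.single ((Fin.snoc w i : Fin (n + 1) → Fin 3) k) 1) =
      fun k => (EuclideanSpace.single (w k) 1 : R3) := by
    ext1 k
    simp only [Fin.init, Fin.snoc_castSucc]
  rw [h3, Fin.snoc_last]
  rfl

theorem partialDeriv_eq_init {n : ℕ} (w : Fin (n + 1) → Fin 3) {φ : R3 → ℝ} (h : ContDiff ℝ ∞ φ) :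
    partialDeriv w φ = partialDeriv (Fin.init w) (pd (w (Fin.last n)) φ) := by
  rw [← partialDeriv_snoc _ _ h, Fin.snoc_init_self]

theorem tsupport_pd_subset (i : Fin 3) (φ : R3 → ℝ) : tsupport (pd i φ) ⊆ tsupport φ :=
  tsupport_fderiv_apply_subset ℝ (e3 i)

theorem IsTest.partialDeriv {n : ℕ} (w : Fin n → Fin 3) {φ : R3 → ℝ} (h : IsTest φ) :
    IsTest (partialDeriv w φ) ∧ tsupport (_root_.partialDeriv w φ) ⊆ tsupport φ := by
  induction n generalizing φ with
  | zero =>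
    rw [partialDeriv_zero]
    exact ⟨h, Subset.rfl⟩
  | succ n ih =>
    rw [partialDeriv_eq_init w h.smooth]
    obtain ⟨h1, h2⟩ := ih (Fin.init w) (h.pd (w (Fin.last n)))
    exact ⟨h1, h2.trans (tsupport_pd_subset _ _)⟩

/-- `g'` is the weak derivative `∂_w g`. -/
def WordDeriv {n : ℕ} (w : Fin n → Fin 3) (g g' : L2R3) : Prop :=
  ∀ φ : R3 → ℝ, IsTest φ → tpair (ofR (partialDeriv w φ)) g = (-1 : ℝ) ^ n • tpair (ofR φ) g'

theorem WordDeriv.eq_of_zero {w : Fin 0 → Fin 3} {g g' : L2R3} (h : WordDeriv w g g') : g' = g :=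
  eq_of_tpair fun φ hφ => by
    have := h φ hφ
    rwa [partialDeriv_zero, pow_zero, one_smul, eq_comm] at this

theorem WordDeriv.refl (w : Fin 0 → Fin 3) (g : L2R3) : WordDeriv w g g := fun φ _ => by
  rw [partialDeriv_zero, pow_zero, one_smul]

theorem WordDeriv.hasWeakDeriv {n : ℕ} {w : Fin n → Fin 3} {i : Fin 3} {g a b : L2R3}
    (ha : WordDeriv w g a) (hb : WordDeriv (Fin.snoc w i : Fin (n + 1) → Fin 3) g b) :
    HasWeakDeriv i a b := fun φ hφ => by
  have h1 := hb φ hφ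
  rw [partialDeriv_snoc w i hφ.smooth, ha _ (hφ.pd i), pow_succ, mul_smul] at h1
  have h2 := smul_right_injective ℂ (pow_ne_zero n (neg_ne_zero.2 (one_ne_zero (α := ℝ)))) h1
  rw [h2, neg_one_smul]

theorem WordDeriv.snoc {n : ℕ} {w : Fin (n + 1) → Fin 3} {g a b : L2R3}
    (ha : WordDeriv (Fin.init w) g a) (hb : HasWeakDeriv (w (Fin.last n)) a b) :
    WordDeriv w g b := fun φ hφ => by
  rw [partialDeriv_eq_init w hφ.smooth, ha _ (hφ.pd _), hb φ hφ, pow_succ, mul_smul, neg_one_smul]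

theorem iteratedDerivWithin_clm {E F : Type*} [NormedAddCommGroup E] [NormedSpace ℝ E]
    [NormedAddCommGroup F] [NormedSpace ℝ F] (L : E →L[ℝ] F) {f : ℝ → E} {s : Set ℝ} {x : ℝ} {n : ℕ}
    (hf : ContDiffOn ℝ n f s) (hs : UniqueDiffOn ℝ s) (hx : x ∈ s) :
    iteratedDerivWithin n (fun y => L (f y)) s x = L (iteratedDerivWithin n f s x) := by
  have h := L.iteratedFDerivWithin_comp_left (hf x hx) hs hx le_rfl
  have h1 := congrArg (fun A => A fun _ => (1 : ℝ)) h
  exact h1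

/-- `U` is a `C^m` curve on `(0,T)`, and its derivatives of order at most `m` are bounded by `C`. -/
structure CkBdd {E : Type*} [NormedAddCommGroup E] [NormedSpace ℝ E] (T : ℝ) (m : ℕ) (U : ℝ → E)
    (C : ℝ) : Prop where
  contDiff : ContDiffOn ℝ m U (Ioo 0 T)
  bound : ∀ j ≤ m, ∀ t ∈ Ioo 0 T, ‖iteratedDerivWithin j U (Ioo 0 T) t‖ ≤ C

section

variable {T : ℝ}

theorem CkBdd.clm {E F : Type*} [NormedAddCommGroup E] [NormedSpace ℝ E] [NormedAddCommGroup F]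
    [NormedSpace ℝ F] {m : ℕ} {U : ℝ → E} {C : ℝ} (h : CkBdd T m U C) (L : E →L[ℝ] F)
    (hL : ∀ x, ‖L x‖ ≤ ‖x‖) : CkBdd T m (fun t => L (U t)) C := by
  refine ⟨L.contDiff.comp_contDiffOn h.contDiff, fun j hj t ht => ?_⟩
  rw [iteratedDerivWithin_clm L (h.contDiff.of_le (by exact_mod_cast hj)) (uniqueDiffOn_Ioo 0 T) ht]
  exact (hL _).trans (h.bound j hj t ht)

/-- Regularity from the curves of all spatial derivatives. -/
theorem reg_of_words {s : ℕ} {u : ℝ → L2R3} {C : ℝ} (hC : 0 ≤ C)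
    (D : ∀ n, (Fin n → Fin 3) → ℝ → L2R3)
    (h : ∀ n ≤ s, ∀ w : Fin n → Fin 3, CkBdd T (s - n) (D n w) C ∧
      ∀ t ∈ Ioo 0 T, WordDeriv w (u t) (D n w t)) : Reg T s u C := by
  have hu := uniqueDiffOn_Ioo 0 T
  have hder : ∀ n j (w : Fin n → Fin 3), n + j + 1 ≤ s →
      IsD T none (iteratedDerivWithin j (D n w) (Ioo 0 T))
        (iteratedDerivWithin (j + 1) (D n w) (Ioo 0 T)) := fun n j w hs t ht => by
    have h1 := ((h n (by omega) w).1.contDiff.differentiableOn_iteratedDerivWithin (m := j)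
      (by exact_mod_cast (show j < s - n by omega)) hu t ht).hasDerivWithinAt.hasDerivAt
      (isOpen_Ioo.mem_nhds ht)
    rw [iteratedDerivWithin_succ]
    exact h1
  have hsp : ∀ j n (w : Fin n → Fin 3) (i : Fin 3), n + j + 1 ≤ s →
      IsD T (some i) (iteratedDerivWithin j (D n w) (Ioo 0 T))
        (iteratedDerivWithin j (D (n + 1) (Fin.snoc w i)) (Ioo 0 T)) := by
    intro j
    induction j with
    | zero =>
      intro n w i hs t ht
      rw [iteratedDerivWithin_zero, iteratedDerivWithin_zero]
      exact ((h n (by omega) w).2 t ht).hasWeakDeriv ((h (n + 1) (by omega) _).2 t ht)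
    | succ j ih =>
      intro n w i hs
      exact IsD.comm (ih n w i (by omega)) (hder n j w (by omega)) (hder (n + 1) j _ (by omega))
  have key : ∀ m n j (w : Fin n → Fin 3), n + j + m ≤ s →
      Reg T m (iteratedDerivWithin j (D n w) (Ioo 0 T)) C := by
    intro m
    have hb : ∀ n j (w : Fin n → Fin 3), n + j ≤ s →
        BddCurve T (iteratedDerivWithin j (D n w) (Ioo 0 T)) C := fun n j w hs =>
      ⟨(h n (by omega) w).1.contDiff.continuousOn_iteratedDerivWithin
        (by exact_mod_cast (show j ≤ s - n by omega)) hu, hC,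
        (h n (by omega) w).1.bound j (by omega)⟩
    induction m with
    | zero => exact fun n j w hs => hb n j w (by omega)
    | succ m ih =>
      refine fun n j w hs => ⟨hb n j w (by omega), fun μ => ?_⟩
      cases μ with
      | none => exact ⟨_, hder n j w (by omega), ih n (j + 1) w (by omega)⟩
      | some i => exact ⟨_, hsp j n w i (by omega), ih (n + 1) j _ (by omega)⟩
  refine (key s 0 0 (fun i => i.elim0) (by omega)).congr fun t ht => ?_
  rw [iteratedDerivWithin_zero]
  exact (((h 0 (by omega) _).2 t ht).eq_of_zero).symm

theorem Reg.ckBdd {m : ℕ} {u : ℝ → L2R3} {C : ℝ} (h : Reg T m u C) : CkBdd T m u C := by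
  have hu := uniqueDiffOn_Ioo 0 T
  induction m generalizing u with
  | zero =>
    have h : BddCurve T u C := h
    refine ⟨contDiffOn_zero.2 h.cont, fun j hj t ht => ?_⟩
    obtain rfl : j = 0 := by omega
    rw [iteratedDerivWithin_zero]
    exact h.bound t ht
  | succ m ih =>
    obtain ⟨v, hv, hv'⟩ := h.2 none
    have e : ∀ t ∈ Ioo 0 T, derivWithin u (Ioo 0 T) t = v t := fun t ht => by
      have h1 : HasDerivAt u (v t) t := hv t ht
      exact h1.hasDerivWithinAt.derivWithin (hu t ht)
    refine ⟨?_, fun j hj t ht => ?_⟩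
    · have h1 := (contDiffOn_succ_iff_derivWithin (n := (m : WithTop ℕ∞)) (f := u) hu).2
        ⟨fun t ht => (show HasDerivAt u (v t) t from hv t ht).differentiableAt.differentiableWithinAt,
          by simp, (ih hv').contDiff.congr e⟩
      exact_mod_cast h1
    · cases j with
      | zero =>
        rw [iteratedDerivWithin_zero]
        exact h.bdd.bound t ht
      | succ j =>
        rw [iteratedDerivWithin_succ', iteratedDerivWithin_congr e ht]
        exact (ih hv').bound j (by omega) t ht

/-- The curves of the spatial derivatives of a regular curve. -/
theorem Reg.exists_wordDeriv {s : ℕ} {u : ℝ → L2R3} {C : ℝ} (h : Reg T s u C) (n : ℕ)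
    (hn : n ≤ s) (w : Fin n → Fin 3) :
    ∃ D, Reg T (s - n) D C ∧ ∀ t ∈ Ioo 0 T, WordDeriv w (u t) (D t) := by
  induction n with
  | zero => exact ⟨u, h, fun t _ => WordDeriv.refl w (u t)⟩
  | succ n ih =>
    obtain ⟨D, h1, h2⟩ := ih (by omega) (Fin.init w)
    rw [show s - n = (s - (n + 1)) + 1 by omega] at h1
    obtain ⟨D', h3, h4⟩ := h1.2 (some (w (Fin.last n)))
    exact ⟨D', h4, fun t ht => (h2 t ht).snoc (h3 t ht)⟩

end

/-! ### Restriction and extension by zero -/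

theorem memLp_restrict {Ω : Set R3} {g : R3 → ℂ} (h : MemLp g 2 leb3) :
    MemLp g 2 (volume.restrict Ω) :=
  h.mono_measure (Measure.restrict_mono (subset_univ _) le_rfl)

theorem norm_toLp_restrict_le (Ω : Set R3) (g : L2R3) :
    ‖(memLp_restrict (Ω := Ω) (Lp.memLp g)).toLp‖ ≤ ‖g‖ := by
  rw [Lp.norm_toLp, Lp.norm_def]
  exact ENNReal.toReal_mono (Lp.eLpNorm_ne_top g)
    (eLpNorm_mono_measure _ (Measure.restrict_mono (subset_univ _) le_rfl))

/-- Restriction of square integrable functions to `Ω`. -/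
def restrictL2 (Ω : Set R3) : L2R3 →L[ℂ] L2 Ω :=
  LinearMap.mkContinuous
    { toFun := fun g => (memLp_restrict (Ω := Ω) (Lp.memLp g)).toLp
      map_add' := fun f g => by
        rw [← MemLp.toLp_add]
        refine MemLp.toLp_congr _ _ ?_
        exact ae_mono (Measure.restrict_mono (subset_univ _) le_rfl) (Lp.coeFn_add f g)
      map_smul' := fun c g => by
        rw [RingHom.id_apply, ← MemLp.toLp_const_smul]
        refine MemLp.toLp_congr _ _ ?_
        exact ae_mono (Measure.restrict_mono (subset_univ _) le_rfl) (Lp.coeFn_smul c g) } 1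
    fun g => (norm_toLp_restrict_le Ω g).trans_eq (one_mul _).symm

theorem coe_restrictL2 (Ω : Set R3) (g : L2R3) : restrictL2 Ω g =ᵐ[volume.restrict Ω] g :=
  MemLp.coeFn_toLp (memLp_restrict (Lp.memLp g))

theorem norm_restrictL2_le (Ω : Set R3) (g : L2R3) : ‖restrictL2 Ω g‖ ≤ ‖g‖ :=
  norm_toLp_restrict_le Ω g

theorem memLp_indicator {Ω : Set R3} (hΩ : MeasurableSet Ω) {g : R3 → ℂ}
    (h : MemLp g 2 (volume.restrict Ω)) : MemLp (Ω.indicator g) 2 leb3 := by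
  rw [leb3_eq]
  exact (memLp_indicator_iff_restrict hΩ).2 h

/-- Extension by zero of square integrable functions on `Ω`. -/
def zeroExt {Ω : Set R3} (hΩ : MeasurableSet Ω) : L2 Ω →ₗᵢ[ℂ] L2R3 where
  toFun g := (memLp_indicator hΩ (Lp.memLp g)).toLp
  map_add' f g := by
    rw [← MemLp.toLp_add]
    refine MemLp.toLp_congr _ _ ?_
    rw [leb3_eq]
    filter_upwards [ae_imp_of_ae_restrict (Lp.coeFn_add f g)] with x hx
    by_cases h : x ∈ Ω
    · simp only [Pi.add_apply, indicator_of_mem h, hx h]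
    · simp only [Pi.add_apply, indicator_of_notMem h, add_zero]
  map_smul' c g := by
    rw [RingHom.id_apply, ← MemLp.toLp_const_smul]
    refine MemLp.toLp_congr _ _ ?_
    rw [leb3_eq]
    filter_upwards [ae_imp_of_ae_restrict (Lp.coeFn_smul c g)] with x hx
    by_cases h : x ∈ Ω
    · simp only [Pi.smul_apply, indicator_of_mem h, hx h]
    · simp only [Pi.smul_apply, indicator_of_notMem h, smul_zero]
  norm_map' g := by
    rw [LinearMap.coe_mk, AddHom.coe_mk, Lp.norm_toLp, Lp.norm_def, leb3_eq,
      eLpNorm_indicator_eq_eLpNorm_restrict hΩ]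

theorem coe_zeroExt {Ω : Set R3} (hΩ : MeasurableSet Ω) (g : L2 Ω) :
    zeroExt hΩ g =ᵐ[leb3] Ω.indicator g :=
  MemLp.coeFn_toLp (memLp_indicator hΩ (Lp.memLp g))

theorem eq_zeroExt_iff {Ω : Set R3} (hΩ : MeasurableSet Ω) (g : L2 Ω) (h : L2R3) :
    h = zeroExt hΩ g ↔ ∀ᵐ x, h x = Ω.indicator g x := by
  rw [← ae_leb3]
  constructor
  · rintro rfl
    exact coe_zeroExt hΩ g
  · intro e
    exact Lp.ext (EventuallyEq.trans (show h =ᵐ[leb3] Ω.indicator g from e)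
      (coe_zeroExt hΩ g).symm)

theorem zeroExt_univ (g : L2R3) : zeroExt MeasurableSet.univ g = g :=
  ((eq_zeroExt_iff MeasurableSet.univ g g).2 (.of_forall fun x => by rw [indicator_univ])).symm

theorem setIntegral_smul_eq_tpair {Ω : Set R3} (hΩ : MeasurableSet Ω) {φ : R3 → ℝ} (h : IsTest φ)
    (g : L2 Ω) : ∫ x in Ω, φ x • g x = tpair (ofR φ) (zeroExt hΩ g) := by
  rw [tpair_ofReal h, ← integral_indicator hΩ]
  refine Eq.trans ?_ setIntegral_univ.symm
  have h1 := coe_zeroExt hΩ g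
  rw [leb3_eq] at h1
  refine integral_congr_ae ?_
  filter_upwards [h1] with x hx
  rw [hx]
  by_cases hxΩ : x ∈ Ω
  · rw [indicator_of_mem hxΩ, indicator_of_mem hxΩ]
  · rw [indicator_of_notMem hxΩ, indicator_of_notMem hxΩ, smul_zero]

theorem tpair_zeroExt_restrictL2 {Ω : Set R3} (hΩ : MeasurableSet Ω) {φ : R3 → ℝ} (h : IsTest φ)
    (hφ : tsupport φ ⊆ Ω) (g : L2R3) :
    tpair (ofR φ) (zeroExt hΩ (restrictL2 Ω g)) = tpair (ofR φ) g := by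
  rw [tpair_apply h.ofReal.memLp, tpair_apply h.ofReal.memLp]
  have h1 := coe_zeroExt hΩ (restrictL2 Ω g)
  have h2 := ae_imp_of_ae_restrict (coe_restrictL2 Ω g)
  rw [← ae_leb3] at h2
  refine integral_congr_ae ?_
  filter_upwards [h1, h2] with x a1 a2
  by_cases hx : x ∈ Ω
  · rw [a1, indicator_of_mem hx, a2 hx]
  · rw [ofR, image_eq_zero_of_notMem_tsupport fun h' => hx (hφ h'), Complex.ofReal_zero, zero_mul,
      zero_mul]

/-- Membership in the Sobolev space, through the extension by zero. -/
theorem mem_sobolevSpace_iff {Ω : Set R3} (hΩ : MeasurableSet Ω) {m : ℕ}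
    (G : PiLp 2 (fun _ : DerivWord m => L2 Ω)) : G ∈ SobolevSpace Ω m ↔
      ∀ (w : DerivWord m) (φ : R3 → ℝ), IsTest φ → tsupport φ ⊆ Ω →
        tpair (ofR (partialDeriv w.2 φ)) (zeroExt hΩ (G (emptyWord m))) =
          (-1 : ℝ) ^ (w.1 : ℕ) • tpair (ofR φ) (zeroExt hΩ (G w)) := by
  constructor
  · intro h w φ hφ hs
    rw [← setIntegral_smul_eq_tpair hΩ (hφ.partialDeriv w.2).1, ← setIntegral_smul_eq_tpair hΩ hφ]
    exact h w φ hφ.smooth hφ.cpt hs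
  · intro h w φ h1 h2 hs
    have hφ : IsTest φ := ⟨h1, h2⟩
    rw [setIntegral_smul_eq_tpair hΩ (hφ.partialDeriv w.2).1, setIntegral_smul_eq_tpair hΩ hφ]
    exact h w φ hφ hs

theorem isClosed_sobolevSpace {Ω : Set R3} (hΩ : MeasurableSet Ω) (m : ℕ) :
    IsClosed (SobolevSpace Ω m : Set (PiLp 2 (fun _ : DerivWord m => L2 Ω))) := by
  have : (SobolevSpace Ω m : Set (PiLp 2 (fun _ : DerivWord m => L2 Ω))) =
      ⋂ (w : DerivWord m) (φ : R3 → ℝ) (_ : IsTest φ) (_ : tsupport φ ⊆ Ω),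
        {G | tpair (ofR (partialDeriv w.2 φ)) (zeroExt hΩ (G (emptyWord m))) =
          (-1 : ℝ) ^ (w.1 : ℕ) • tpair (ofR φ) (zeroExt hΩ (G w))} := by
    ext G
    simp only [mem_iInter, mem_ofPred_eq]
    exact mem_sobolevSpace_iff hΩ G
  rw [this]
  refine isClosed_iInter fun w => isClosed_iInter fun φ => isClosed_iInter fun _ =>
    isClosed_iInter fun _ => isClosed_eq ?_ ?_
  · exact (tpair _).continuous.comp ((zeroExt hΩ).continuous.comp
      (PiLp.continuous_apply 2 (fun _ : DerivWord m => L2 Ω) (emptyWord m)))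
  · have hc : Continuous fun G : PiLp 2 (fun _ : DerivWord m => L2 Ω) =>
        tpair (ofR φ) (zeroExt hΩ (G w)) := (tpair _).continuous.comp
      ((zeroExt hΩ).continuous.comp (PiLp.continuous_apply 2 (fun _ : DerivWord m => L2 Ω) w))
    exact hc.const_smul ((-1 : ℝ) ^ (w.1 : ℕ))

/-- The component with index `w` of an element of the Sobolev space. -/
def sobolevProj (Ω : Set R3) (m : ℕ) (w : DerivWord m) : SobolevSpace Ω m →L[ℂ] L2 Ω :=
  (PiLp.proj 2 (fun _ : DerivWord m => L2 Ω) w).comp (SobolevSpace Ω m).subtypeL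

theorem norm_sobolevProj_le {Ω : Set R3} {m : ℕ} (w : DerivWord m) (G : SobolevSpace Ω m) :
    ‖sobolevProj Ω m w G‖ ≤ ‖G‖ := PiLp.norm_apply_le G.1 w

section

variable {T : ℝ} {Ω : Set R3} {s : ℕ}

/-- The curves of the spatial derivatives of an element of `𝓗^s`, extended by zero. -/
theorem HBound.exists_words (hΩ : MeasurableSet Ω) {u : Ioo 0 T → L2 Ω} {C : ℝ}
    (h : HBound T Ω s u C) (n : ℕ) (hn : n ≤ s) (w : Fin n → Fin 3) :
    ∃ D : ℝ → L2R3, CkBdd T (s - n) D C ∧ (∀ t, ∀ᵐ x, x ∉ Ω → D t x = 0) ∧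
      ∀ t (ht : t ∈ Ioo 0 T) (φ : R3 → ℝ), IsTest φ → tsupport φ ⊆ Ω →
        tpair (ofR (partialDeriv w φ)) (zeroExt hΩ (u ⟨t, ht⟩)) =
          (-1 : ℝ) ^ n • tpair (ofR φ) (D t) := by
  obtain ⟨U, h1, h2, h3⟩ := h.2 (s - n) (Nat.sub_le _ _)
  let W : DerivWord (s - (s - n)) := ⟨⟨n, by omega⟩, w⟩
  have hU : CkBdd T (s - n) U C := ⟨h2, h3⟩
  have hD := (hU.clm ((sobolevProj Ω _ W).restrictScalars ℝ) (norm_sobolevProj_le W)).clm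
    ((zeroExt hΩ).toContinuousLinearMap.restrictScalars ℝ) fun x => ((zeroExt hΩ).norm_map x).le
  refine ⟨_, hD, fun t => ?_, fun t ht φ hφ hs => ?_⟩
  · filter_upwards [ae_leb3.1 (coe_zeroExt hΩ (sobolevProj Ω _ W (U t)))] with x hx hxΩ
    exact hx.trans (indicator_of_notMem hxΩ _)
  · have h4 := (mem_sobolevSpace_iff hΩ (U t).1).1 (U t).2 W φ hφ hs
    rw [← h1 ⟨t, ht⟩]
    exact h4

end

end

noncomputable section

/-! ### Elements of `𝓗^s` as regular curves -/

/-- A curve on `(0,T)`, extended by zero to all times. -/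
def curve {T : ℝ} (u : Ioo 0 T → L2R3) (t : ℝ) : L2R3 :=
  open Classical in if ht : t ∈ Ioo 0 T then u ⟨t, ht⟩ else 0

section

variable {T : ℝ} {Ω : Set R3} {s : ℕ}

theorem curve_of_mem (u : Ioo 0 T → L2R3) {t : ℝ} (ht : t ∈ Ioo 0 T) : curve u t = u ⟨t, ht⟩ :=
  dif_pos ht

theorem curve_coe (u : Ioo 0 T → L2R3) (t : Ioo 0 T) : curve u t = u t := curve_of_mem u t.2

theorem ae_eq_zero_of_tpair {U : Set R3} (hU : IsOpen U) {g : L2R3}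
    (h : ∀ φ : R3 → ℝ, IsTest φ → tsupport φ ⊆ U → tpair (ofR φ) g = 0) :
    ∀ᵐ x, x ∈ U → g x = 0 := by
  have h1 := hU.ae_eq_zero_of_integral_contDiff_smul_eq_zero (μ := leb3)
    (g.locallyIntegrable.locallyIntegrableOn U) fun φ h1 h2 h3 => by
      rw [← tpair_ofReal ⟨h1, h2⟩]
      exact h φ ⟨h1, h2⟩ h3
  exact ae_leb3.1 h1

/-- If a source in `𝓗^s((0,T) × Ω)` has an extension by zero in `𝓗^s((0,T) × ℝ³)`, the extension is
as regular as the source, with the same bound: its derivatives are the extensions by zero of those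
of the source. -/
theorem HBound.reg_of_isZeroExtension (hΩ : IsOpen Ω) (hΩ0 : volume (frontier Ω) = 0)
    {f : Ioo 0 T → L2 Ω} {F : Ioo 0 T → L2R3} {C C' : ℝ} (hf : HBound T Ω s f C)
    (hF : HBound T univ s F C') (hfF : IsZeroExtension f F) : Reg T s (curve F) C := by
  classical
  have hm := hΩ.measurableSet
  choose D hD hD0 hDt using fun n (hn : n ≤ s) w => hf.exists_words hm n hn w
  choose E _ _ hEt using fun n (hn : n ≤ s) w => hF.exists_words MeasurableSet.univ n hn w
  have hZ : ∀ t, zeroExt hm (f t) = F t := fun t => ((eq_zeroExt_iff hm (f t) (F t)).2 (hfF t)).symm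
  have hpow : ∀ n : ℕ, (-1 : ℝ) ^ n ≠ 0 := fun n => pow_ne_zero n (by norm_num)
  have hDE : ∀ n (hn : n ≤ s) w t, t ∈ Ioo 0 T → D n hn w t = E n hn w t := fun n hn w t ht => by
    -- the derivatives agree inside `Ω` and vanish outside its closure; the frontier is a null set
    have a1 : ∀ᵐ x, x ∈ Ω → (D n hn w t - E n hn w t : L2R3) x = 0 :=
      ae_eq_zero_of_tpair hΩ fun φ hφ hs => by
        have b1 := hDt n hn w t ht φ hφ hs
        have b2 := hEt n hn w t ht φ hφ (subset_univ _)
        rw [zeroExt_univ] at b2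
        rw [hZ, b2] at b1
        rw [map_sub, sub_eq_zero]
        exact (smul_right_injective ℂ (hpow n) b1).symm
    have a2 : ∀ᵐ x, x ∈ (closure Ω)ᶜ → (E n hn w t : L2R3) x = 0 :=
      ae_eq_zero_of_tpair isClosed_closure.isOpen_compl fun φ hφ hs => by
        have b2 := hEt n hn w t ht φ hφ (subset_univ _)
        rw [zeroExt_univ, tpair_apply (hφ.partialDeriv w).1.ofReal.memLp] at b2
        have b3 : ∫ x, ofR (partialDeriv w φ) x * F ⟨t, ht⟩ x ∂leb3 = 0 := by
          refine integral_eq_zero_of_ae ?_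
          filter_upwards [ae_leb3.2 (hfF ⟨t, ht⟩)] with x hx
          by_cases hxΩ : x ∈ Ω
          · have b4 : x ∉ tsupport (partialDeriv w φ) := fun h' =>
              hs ((hφ.partialDeriv w).2 h') (subset_closure hxΩ)
            rw [ofR, image_eq_zero_of_notMem_tsupport b4, Complex.ofReal_zero, zero_mul,
              Pi.zero_apply]
          · rw [hx, indicator_of_notMem hxΩ, mul_zero, Pi.zero_apply]
        rw [b3] at b2
        exact (smul_eq_zero.1 b2.symm).resolve_left (hpow n)
    have a3 : ∀ᵐ x, x ∉ frontier Ω := measure_eq_zero_iff_ae_notMem.1 hΩ0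
    refine Lp.ext (ae_leb3.2 ?_)
    filter_upwards [a1, a2, a3, hD0 n hn w t,
      ae_leb3.1 (Lp.coeFn_sub (D n hn w t) (E n hn w t))] with x c1 c2 c3 c4 c5
    by_cases hx : x ∈ Ω
    · have := c1 hx
      rw [c5, Pi.sub_apply, sub_eq_zero] at this
      exact this
    · have hx' : x ∉ closure Ω := fun h' => c3 ⟨h', fun h'' => hx (interior_subset h'')⟩
      rw [c4 hx, c2 hx']
  refine reg_of_words hf.1 (fun n w => if hn : n ≤ s then D n hn w else 0) fun n hn w => ?_
  rw [dif_pos hn]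
  refine ⟨hD n hn w, fun t ht φ hφ => ?_⟩
  have b2 := hEt n hn w t ht φ hφ (subset_univ _)
  rw [zeroExt_univ] at b2
  rw [curve_of_mem F ht, hDE n hn w t ht, b2]

/-- Elements of `𝓗^s((0,T) × ℝ³)` are regular curves, with the same bound. -/
theorem HBound.reg {u : Ioo 0 T → L2R3} {C : ℝ} (h : HBound T univ s u C) : Reg T s (curve u) C :=
  h.reg_of_isZeroExtension isOpen_univ (by simp) h fun t => .of_forall fun x => by
    rw [indicator_univ]

theorem norm_le_of_components {m : ℕ} (G : PiLp 2 (fun _ : DerivWord m => L2 Ω)) {C : ℝ}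
    (hC : 0 ≤ C) (h : ∀ w, ‖G w‖ ≤ C) : ‖G‖ ≤ Fintype.card (DerivWord m) * C := by
  rw [PiLp.norm_eq_of_L2]
  refine Real.sqrt_le_iff.2 ⟨mul_nonneg (Nat.cast_nonneg _) hC, ?_⟩
  have h1 : ∑ w, ‖G w‖ ^ 2 ≤ ∑ _w : DerivWord m, C ^ 2 :=
    Finset.sum_le_sum fun w _ => pow_le_pow_left₀ (norm_nonneg _) (h w) 2
  refine h1.trans ?_
  rw [Finset.sum_const, Finset.card_univ, nsmul_eq_mul, mul_pow]
  refine mul_le_mul_of_nonneg_right ?_ (sq_nonneg C)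
  exact_mod_cast Nat.le_self_pow two_ne_zero _

/-- Regular curves, restricted to `Ω`, belong to `𝓗^s((0,T) × Ω)`. -/
theorem exists_hBound (hΩ : MeasurableSet Ω) (T : ℝ) (s : ℕ) : ∃ N : ℝ, 0 ≤ N ∧ ∀ u C, Reg T s u C →
    HBound T Ω s (fun t => restrictL2 Ω (u t)) (N * C) := by
  classical
  set N : ℝ := ∑ k ∈ Finset.range (s + 1), (Fintype.card (DerivWord (s - k)) : ℝ) with hN
  have hN0 : 0 ≤ N := Finset.sum_nonneg fun _ _ => Nat.cast_nonneg _
  refine ⟨N, hN0, fun u C hu => ⟨mul_nonneg hN0 hu.nonneg, fun k hk => ?_⟩⟩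
  have hkN : (Fintype.card (DerivWord (s - k)) : ℝ) ≤ N :=
    Finset.single_le_sum (f := fun k => (Fintype.card (DerivWord (s - k)) : ℝ))
      (fun _ _ => Nat.cast_nonneg _) (Finset.mem_range.2 (Nat.lt_succ_of_le hk))
  choose D hD hDw using fun w : DerivWord (s - k) => hu.exists_wordDeriv w.1 (by
    have := w.1.2
    omega) w.2
  have hDk : ∀ w, CkBdd T k (fun t => restrictL2 Ω (D w t)) C := fun w =>
    ((hD w).of_le (by have := w.1.2; omega)).ckBdd.clm ((restrictL2 Ω).restrictScalars ℝ)
      (norm_restrictL2_le Ω)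
  have hD0 : ∀ t ∈ Ioo 0 T, D (emptyWord (s - k)) t = u t := fun t ht =>
    (hDw (emptyWord (s - k)) t ht).eq_of_zero
  let G : ℝ → PiLp 2 (fun _ : DerivWord (s - k) => L2 Ω) := fun t =>
    WithLp.toLp 2 fun w => restrictL2 Ω (D w t)
  have hGm : ∀ t ∈ Ioo 0 T, G t ∈ SobolevSpace Ω (s - k) := fun t ht => by
    rw [mem_sobolevSpace_iff hΩ]
    intro w φ hφ hs
    change tpair (ofR (partialDeriv w.2 φ)) (zeroExt hΩ (restrictL2 Ω (D (emptyWord (s - k)) t))) =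
      (-1 : ℝ) ^ (w.1 : ℕ) • tpair (ofR φ) (zeroExt hΩ (restrictL2 Ω (D w t)))
    rw [tpair_zeroExt_restrictL2 hΩ hφ hs, tpair_zeroExt_restrictL2 hΩ (hφ.partialDeriv w.2).1
      ((hφ.partialDeriv w.2).2.trans hs), hD0 t ht, hDw w t ht φ hφ]
  have hGc : ContDiffOn ℝ k G (Ioo 0 T) := contDiffOn_piLp' 2 fun w => (hDk w).contDiff
  have hGb : ∀ j ≤ k, ∀ t ∈ Ioo 0 T, ‖iteratedDerivWithin j G (Ioo 0 T) t‖ ≤ N * C :=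
    fun j hj t ht => by
      refine (norm_le_of_components _ hu.nonneg fun w => ?_).trans
        (mul_le_mul_of_nonneg_right hkN hu.nonneg)
      have h1 := iteratedDerivWithin_clm
        ((PiLp.proj (𝕜 := ℝ) 2 (fun _ : DerivWord (s - k) => L2 Ω) w))
        (hGc.of_le (show (j : WithTop ℕ∞) ≤ k by exact_mod_cast hj)) (uniqueDiffOn_Ioo 0 T) ht
      have h2 := (hDk w).bound j hj t ht
      change ‖PiLp.proj (𝕜 := ℝ) 2 (fun _ : DerivWord (s - k) => L2 Ω) w _‖ ≤ _
      rw [← h1]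
      exact h2
  -- the Sobolev space is closed, so the orthogonal projection turns curves with values in it into
  -- curves in it
  have : CompleteSpace (SobolevSpace Ω (s - k)) := (isClosed_sobolevSpace hΩ (s - k)).completeSpace_coe
  let P := (SobolevSpace Ω (s - k)).orthogonalProjectionOnto
  refine ⟨fun t => P (G t), fun t => ?_, (P.restrictScalars ℝ).contDiff.comp_contDiffOn hGc,
    fun j hj t ht => ?_⟩
  · have h1 : P (G t) = ⟨G t, hGm t t.2⟩ :=
      Submodule.orthogonalProjectionOnto_mem_subspace_eq_self (⟨G t, hGm t t.2⟩ : SobolevSpace Ω (s - k))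
    change sobolevToL2 (P (G t)) = _
    rw [h1]
    change restrictL2 Ω (D (emptyWord (s - k)) t) = _
    rw [hD0 t t.2]
  · have h1 := iteratedDerivWithin_clm (P.restrictScalars ℝ)
      (hGc.of_le (show (j : WithTop ℕ∞) ≤ k by exact_mod_cast hj)) (uniqueDiffOn_Ioo 0 T) ht
    refine le_trans (le_of_eq (congrArg norm h1)) ?_
    refine le_trans ?_ (hGb j hj t ht)
    exact (SobolevSpace Ω (s - k)).norm_orthogonalProjectionOnto_apply_le _

theorem restrictL2_univ (g : L2R3) : restrictL2 univ g = g :=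
  Lp.ext (coe_restrictL2 univ g)

end

end

noncomputable section

/-! ### The norm of `𝓗^s` -/

section

variable {T : ℝ} {Ω : Set R3} {s : ℕ}

theorem waveNorm_le {u : WaveSpace T Ω s} {C : ℝ} (h : HBound T Ω s u.1 C) : waveNorm u ≤ C :=
  csInf_le ⟨0, fun _ h => h.1⟩ h

theorem waveNorm_nonneg (u : WaveSpace T Ω s) : 0 ≤ waveNorm u :=
  Real.sInf_nonneg fun _ h => h.1

theorem exists_hBound_lt (u : WaveSpace T Ω s) {r : ℝ} (h : waveNorm u < r) :
    ∃ C < r, HBound T Ω s u.1 C := by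
  obtain ⟨C, hC, hr⟩ := exists_lt_of_csInf_lt (show {C | HBound T Ω s u.1 C}.Nonempty from u.2) h
  exact ⟨C, hr, hC⟩

theorem waveNorm_smul_le (c : ℂ) (u : WaveSpace T Ω s) : waveNorm (c • u) ≤ ‖c‖ * waveNorm u := by
  refine le_of_forall_pos_le_add fun ε hε => ?_
  have hc : 0 < ‖c‖ + 1 := by positivity
  obtain ⟨C, h1, h2⟩ := exists_hBound_lt u (show waveNorm u < waveNorm u + ε / (‖c‖ + 1) by
    have := div_pos hε hc
    linarith)
  refine (waveNorm_le (h2.smul c)).trans ?_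
  have h3 : ‖c‖ * C ≤ ‖c‖ * (waveNorm u + ε / (‖c‖ + 1)) :=
    mul_le_mul_of_nonneg_left h1.le (norm_nonneg c)
  have h4 : ‖c‖ * (ε / (‖c‖ + 1)) ≤ ε := by
    rw [mul_div_assoc', div_le_iff₀ hc]
    nlinarith [norm_nonneg c]
  linarith

theorem waveNorm_smul (c : ℂ) (u : WaveSpace T Ω s) : waveNorm (c • u) = ‖c‖ * waveNorm u := by
  refine le_antisymm (waveNorm_smul_le c u) ?_
  rcases eq_or_ne c 0 with rfl | hc
  · rw [norm_zero, zero_mul]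
    exact waveNorm_nonneg _
  · have h := waveNorm_smul_le c⁻¹ (c • u)
    rw [inv_smul_smul₀ hc, norm_inv, ← div_eq_inv_mul, le_div_iff₀ (norm_pos_iff.2 hc)] at h
    rwa [mul_comm]

/-- A trilinear map that is bounded on bounds of its arguments is a bounded trilinear operator. -/
theorem bounded_of_hBound (A : MultilinearMap ℂ (fun _ : Fin 3 => SourceSpace T Ω s) (WaveSpace T Ω s))
    {K : ℝ} (hA : ∀ (f : Fin 3 → SourceSpace T Ω s) (C : Fin 3 → ℝ),
      (∀ j, HBound T Ω s (f j).1.1 (C j)) → HBound T Ω s (A f).1 (K * ∏ j, C j)) (hK : 0 ≤ K) :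
    BddAbove (unitValues A) ∧ ∀ f : Fin 3 → SourceSpace T Ω s,
      waveNorm (A f) ≤ trilinearOpNorm A * ∏ j, waveNorm (f j).1 := by
  have hle : ∀ f : Fin 3 → SourceSpace T Ω s, waveNorm (A f) ≤ K * ∏ j, waveNorm (f j).1 := fun f => by
    -- `waveNorm` is an infimum of bounds, so approach it from above
    have h1 : Tendsto (fun ε : ℝ => K * ∏ j, (waveNorm (f j).1 + ε)) (𝓝[>] 0)
        (𝓝 (K * ∏ j, (waveNorm (f j).1 + 0))) :=
      (Continuous.tendsto (by fun_prop) 0).mono_left nhdsWithin_le_nhds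
    simp only [add_zero] at h1
    refine ge_of_tendsto h1 ?_
    filter_upwards [self_mem_nhdsWithin] with ε hε
    choose C hC1 hC2 using fun j => exists_hBound_lt (f j).1
      (show waveNorm (f j).1 < waveNorm (f j).1 + ε from lt_add_of_pos_right _ hε)
    exact (waveNorm_le (hA f C hC2)).trans (mul_le_mul_of_nonneg_left
      (Finset.prod_le_prod (fun j _ => (hC2 j).1) fun j _ => (hC1 j).le) hK)
  have hb : BddAbove (unitValues A) := by
    refine ⟨K, ?_⟩
    rintro r ⟨f, hf, rfl⟩
    refine (hle f).trans_eq ?_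
    simp [hf]
  refine ⟨hb, fun f => ?_⟩
  by_cases hz : ∃ j, waveNorm (f j).1 = 0
  · obtain ⟨j, hj⟩ := hz
    have h0 : ∏ j, waveNorm (f j).1 = 0 := Finset.prod_eq_zero (Finset.mem_univ j) hj
    have := hle f
    rw [h0, mul_zero] at this ⊢
    exact this
  · push Not at hz
    have hpos : ∀ j, 0 < waveNorm (f j).1 := fun j => lt_of_le_of_ne (waveNorm_nonneg _) (hz j).symm
    -- normalise the sources
    set g : Fin 3 → SourceSpace T Ω s := fun j => ((waveNorm (f j).1 : ℂ)⁻¹) • f j with hg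
    have hg1 : ∀ j, waveNorm (g j).1 = 1 := fun j => by
      change waveNorm (((waveNorm (f j).1 : ℂ)⁻¹) • (f j).1) = 1
      rw [waveNorm_smul, norm_inv, Complex.norm_real, Real.norm_of_nonneg (hpos j).le,
        inv_mul_cancel₀ (hz j)]
    have h1 : waveNorm (A g) ≤ trilinearOpNorm A := le_csSup hb ⟨g, hg1, rfl⟩
    have h2 : A g = (∏ j, (waveNorm (f j).1 : ℂ)⁻¹) • A f := A.map_smul_univ _ f
    rw [h2, waveNorm_smul, norm_prod] at h1
    simp only [norm_inv, Complex.norm_real, Real.norm_of_nonneg (waveNorm_nonneg _)] at h1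
    rw [Finset.prod_inv_distrib, ← div_eq_inv_mul,
      div_le_iff₀ (Finset.prod_pos fun j _ => hpos j)] at h1
    exact h1

end

/-! ### The response operator -/

section

variable {T ρ : ℝ} {s : ℕ} {V : ℝ × R3 → ℝ} {h : ℝ × R3 → ℂ}

/-- A source, extended by zero to a curve in `L²(ℝ³)`. -/
def src (f : SourceSpace T (Metric.ball (0 : R3) ρ) s) : ℝ → L2R3 :=
  curve fun t => zeroExt Metric.isOpen_ball.measurableSet (f.1.1 t)

theorem src_add (f g : SourceSpace T (Metric.ball (0 : R3) ρ) s) : src (f + g) = src f + src g := by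
  ext1 t
  by_cases ht : t ∈ Ioo 0 T
  · rw [Pi.add_apply, src, src, src, curve_of_mem _ ht, curve_of_mem _ ht, curve_of_mem _ ht, ← map_add]
    rfl
  · simp only [Pi.add_apply, src, curve, dif_neg ht, add_zero]

theorem src_smul (c : ℂ) (f : SourceSpace T (Metric.ball (0 : R3) ρ) s) :
    src (c • f) = c • src f := by
  ext1 t
  by_cases ht : t ∈ Ioo 0 T
  · rw [Pi.smul_apply, src, src, curve_of_mem _ ht, curve_of_mem _ ht, ← map_smul]
    rfl
  · simp only [Pi.smul_apply, src, curve, dif_neg ht, smul_zero]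

theorem reg_src (f : SourceSpace T (Metric.ball (0 : R3) ρ) s) {C : ℝ}
    (hf : HBound T (Metric.ball (0 : R3) ρ) s f.1.1 C) : Reg T s (src f) C := by
  obtain ⟨F, ⟨C', hF⟩, hfF⟩ := f.2
  have e : (fun t => zeroExt Metric.isOpen_ball.measurableSet (f.1.1 t)) = F :=
    funext fun t => ((eq_zeroExt_iff _ _ _).2 (hfF t)).symm
  rw [src, e]
  refine hf.reg_of_isZeroExtension Metric.isOpen_ball ?_ hF hfF
  exact measure_mono_null Metric.frontier_ball_subset_sphere (Measure.addHaar_sphere _ _ _)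

theorem ae_src (f : SourceSpace T (Metric.ball (0 : R3) ρ) s) {t : ℝ} (ht : t ∈ Ioo 0 T) :
    ∀ᵐ x ∂leb3, extendZero f.1.1 t x = src f t x := by
  filter_upwards [coe_zeroExt Metric.isOpen_ball.measurableSet (f.1.1 ⟨t, ht⟩)] with x hx
  rw [src, curve_of_mem _ ht, hx, extendZero, dif_pos ht]

theorem src_eq_zero (f : SourceSpace T (Metric.ball (0 : R3) ρ) s) {t : ℝ} (ht : t ∈ Ioo 0 T) :
    ∀ᵐ x ∂leb3, ρ < ‖x‖ → src f t x = 0 := by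
  filter_upwards [ae_src f ht] with x hx hρ
  rw [← hx, extendZero, dif_pos ht, indicator_of_notMem]
  rw [mem_ball_zero_iff]
  exact not_lt.2 hρ.le

theorem extendZero_of_notMem {Ω : Set R3} (u : Ioo 0 T → L2 Ω) {t : ℝ} (ht : t ∉ Ioo 0 T) (x : R3) :
    extendZero u t x = 0 := by
  rw [extendZero, dif_neg ht]

theorem extendZero_univ (u : Ioo 0 T → L2R3) {t : ℝ} (ht : t ∈ Ioo 0 T) (x : R3) :
    extendZero u t x = curve u t x := by
  rw [extendZero, dif_pos ht, indicator_univ, curve_of_mem u ht]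

/-- The curves `u j` are the waves that the sources `f j` generate, and `w` is the wave that
`h u₁ u₂ u₃` generates. -/
structure IsResponse (V : ℝ × R3 → ℝ) (h : ℝ × R3 → ℂ)
    (f : Fin 3 → SourceSpace T (Metric.ball (0 : R3) ρ) s) (u : Fin 3 → ℝ → L2R3) (w : ℝ → L2R3) :
    Prop where
  wave : ∀ j, StrongSol T V (fun t => src (f j) t) (u j)
  prod : StrongSol T V (fun t x => h (t, x) * ∏ j, u j t x) w

theorem IsResponse.unique_wave (hT : 0 < T) (hV : Continuous V)
    {f : Fin 3 → SourceSpace T (Metric.ball (0 : R3) ρ) s} {u u' : Fin 3 → ℝ → L2R3}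
    {w w' : ℝ → L2R3} (hr : IsResponse V h f u w) (hr' : IsResponse V h f u' w') :
    ∀ t ∈ Ioo 0 T, (∀ j, u j t = u' j t) ∧ w t = w' t := fun t ht => by
  have h1 : ∀ t ∈ Ioo 0 T, ∀ j, u j t = u' j t := fun t ht j =>
    (hr.wave j).unique hT hV (hr'.wave j) ht
  refine ⟨h1 t ht, hr.prod.unique hT hV (hr'.prod.congr fun t ht => ?_) ht⟩
  exact .of_forall fun x => by simp only [h1 t ht]

/-- Responses exist, with a bound; the source of the last wave is a regular curve. -/
theorem exists_isResponse (hT : 0 < T) (hs : 4 ≤ s) (hV : ContDiff ℝ ∞ V) (hh : ContDiff ℝ ∞ h) :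
    ∃ K : ℝ, 0 ≤ K ∧ ∀ f : Fin 3 → SourceSpace T (Metric.ball (0 : R3) ρ) s, ∃ u w,
      IsResponse V h f u w ∧ (∀ j, ∃ C, Reg T s (u j) C) ∧
      (∃ G C, Reg T s G C ∧ ∀ t ∈ Ioo 0 T, ∀ᵐ x ∂leb3, h (t, x) * ∏ j, u j t x = G t x) ∧
      ∀ C : Fin 3 → ℝ, (∀ j, HBound T (Metric.ball (0 : R3) ρ) s (f j).1.1 (C j)) →
        Reg T s w (K * ∏ j, C j) := by
  obtain ⟨c1, hc1, h1⟩ := exists_strongSol hT hV ρ (s := s) (by omega)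
  obtain ⟨c2, hc2, h2⟩ := exists_reg_prod s s s le_rfl le_rfl (by omega)
  obtain ⟨c4, hc4, h4⟩ := exists_strongSol hT hV (ρ + T + 2) (s := s) (by omega)
  let κ : ContDiffBump (T / 2 : ℝ) := ⟨T, 2 * T, hT, by linarith⟩
  let χ : ContDiffBump (0 : R3) :=
    ⟨|ρ| + T + 2, |ρ| + T + 3, by positivity, by linarith⟩
  have hκ : ∀ t ∈ Ioo 0 T, κ t = 1 := fun t ht => κ.one_of_mem_closedBall (by
    rw [Metric.mem_closedBall, Real.dist_eq, abs_le]
    change -T ≤ _ ∧ _ ≤ T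
    constructor <;> linarith [ht.1, ht.2])
  -- the coupling, cut off where the waves do not reach
  set W : ℝ × R3 → ℂ := fun z => h z * stC (prodTest κ χ) z with hW
  have hχt : IsTest (χ : R3 → ℝ) := ⟨χ.contDiff, χ.hasCompactSupport⟩
  have hWc : IsCoeff W := (isCoeff_stC (contDiff_prodTest κ.contDiff hχt)
    (hasCompactSupport_prodTest κ.hasCompactSupport hχt)).mul_left hh
  obtain ⟨c3, hc3, h3⟩ := hWc.reg T s
  obtain ⟨M, hM⟩ := hWc.exists_bound
  refine ⟨c4 * (c3 * (c2 * (c2 * (c1 * c1) * c1))), by positivity, fun f => ?_⟩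
  choose C₀ hC₀ using fun j => (f j).1.2
  choose u hu hus huz using fun j => h1 _ _ (reg_src (f j) (hC₀ j)) fun t ht => src_eq_zero (f j) ht
  -- `C₀` is some bound of the sources; by uniqueness the waves obey the estimate for every bound
  have hur : ∀ j C, HBound T (Metric.ball (0 : R3) ρ) s (f j).1.1 C → Reg T s (u j) (c1 * C) :=
    fun j C hC => by
      obtain ⟨v, hv, hvs, -⟩ := h1 _ _ (reg_src (f j) hC) fun t ht => src_eq_zero (f j) ht
      exact hv.congr fun t ht => (hus j).unique hT hV.continuous hvs ht
  set G : ℝ → L2R3 := coeffMul W fun t => prodL2 (prodL2 (u 0 t) (u 1 t)) (u 2 t) with hG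
  have hGr : ∀ C : Fin 3 → ℝ, (∀ j, HBound T (Metric.ball (0 : R3) ρ) s (f j).1.1 (C j)) →
      Reg T s G (c3 * (c2 * (c2 * ((c1 * C 0) * (c1 * C 1)) * (c1 * C 2)))) := fun C hC =>
    h3 _ _ (h2 (h2 (hur 0 _ (hC 0)) (hur 1 _ (hC 1))) (hur 2 _ (hC 2)))
  have hGe : ∀ t ∈ Ioo 0 T, ∀ᵐ x ∂leb3, h (t, x) * ∏ j, u j t x = G t x := fun t ht => by
    have m1 : MemLp (fun x => u 0 t x * u 1 t x) 2 leb3 := (hu 0).memLp_mul (hu 1) (by omega) ht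
    have m2 : MemLp (fun x => prodL2 (u 0 t) (u 1 t) x * u 2 t x) 2 leb3 :=
      (h2 (hu 0) (hu 1)).memLp_mul (hu 2) (by omega) ht
    filter_upwards [coe_toL2 m1, coe_toL2 m2, huz 0 t ht,
      (hM t).coe_mulB (prodL2 (prodL2 (u 0 t) (u 1 t)) (u 2 t))] with x a1 a2 a3 a4
    have a5 : G t x = W (t, x) * (u 0 t x * u 1 t x * u 2 t x) := by
      rw [← a1]
      exact a4.trans (congrArg (W (t, x) * ·) a2)
    rw [a5, Fin.prod_univ_three]
    by_cases hx : ρ + T + 2 < ‖x‖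
    · rw [a3 hx, zero_mul, zero_mul, mul_zero, mul_zero]
    · have hχ : χ x = 1 := χ.one_of_mem_closedBall (by
        rw [mem_closedBall_zero_iff]
        change ‖x‖ ≤ |ρ| + T + 2
        linarith [le_abs_self ρ, not_lt.1 hx])
      simp only [hW, stC, prodTest, hκ t ht, hχ, mul_one, Complex.ofReal_one]
  have hGz : ∀ t ∈ Ioo 0 T, ∀ᵐ x ∂leb3, ρ + T + 2 < ‖x‖ → G t x = 0 := fun t ht => by
    filter_upwards [hGe t ht, huz 0 t ht] with x a1 a2 hx
    rw [← a1, Fin.prod_univ_three, a2 hx, zero_mul, zero_mul, mul_zero]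
  obtain ⟨w, -, hws, -⟩ := h4 _ _ (hGr C₀ hC₀) hGz
  refine ⟨u, w, ⟨hus, hws.congr hGe⟩, fun j => ⟨_, hu j⟩, ⟨G, _, hGr C₀ hC₀, hGe⟩, fun C hC => ?_⟩
  obtain ⟨w', hw', hws', -⟩ := h4 _ _ (hGr C hC) hGz
  refine (hw'.congr fun t ht => hws.unique hT hV.continuous hws' ht).mono (le_of_eq ?_)
  rw [Fin.prod_univ_three]
  ring

theorem IsResponse.update_add {f : Fin 3 → SourceSpace T (Metric.ball (0 : R3) ρ) s}
    {j : Fin 3} {x y : SourceSpace T (Metric.ball (0 : R3) ρ) s} [DecidableEq (Fin 3)]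
    (hT : 0 < T) (hV : Continuous V) {u u' v : Fin 3 → ℝ → L2R3} {w w' z : ℝ → L2R3}
    (hx : IsResponse V h (Function.update f j x) u w)
    (hy : IsResponse V h (Function.update f j y) u' w')
    (hxy : IsResponse V h (Function.update f j (x + y)) v z) :
    ∀ t ∈ Ioo 0 T, z t = w t + w' t := by
  have e1 : ∀ t ∈ Ioo 0 T, v j t = u j t + u' j t := fun t ht => by
    have a1 := hx.wave j
    have a2 := hy.wave j
    have a3 := hxy.wave j
    rw [Function.update_self] at a1 a2 a3
    refine a3.unique hT hV ((a1.add a2).congr fun t ht => ?_) ht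
    rw [src_add]
    exact Lp.coeFn_add _ _
  have e2 : ∀ i ≠ j, ∀ t ∈ Ioo 0 T, v i t = u i t ∧ u' i t = u i t := fun i hi t ht => by
    have a1 := hx.wave i
    have a2 := hy.wave i
    have a3 := hxy.wave i
    rw [Function.update_of_ne hi] at a1 a2 a3
    exact ⟨a3.unique hT hV a1 ht, a2.unique hT hV a1 ht⟩
  intro t ht
  refine hxy.prod.unique hT hV ((hx.prod.add hy.prod).congr fun t ht => ?_) ht
  filter_upwards [Lp.coeFn_add (u j t) (u' j t)] with x hx
  rw [← mul_add, ← Finset.mul_prod_erase _ _ (Finset.mem_univ j),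
    ← Finset.mul_prod_erase _ (fun i => u i t x) (Finset.mem_univ j),
    ← Finset.mul_prod_erase _ (fun i => u' i t x) (Finset.mem_univ j), e1 t ht, hx, Pi.add_apply,
    add_mul]
  congr 2
  · congr 1
    exact Finset.prod_congr rfl fun i hi => by rw [(e2 i (Finset.ne_of_mem_erase hi) t ht).1]
  · congr 1
    exact Finset.prod_congr rfl fun i hi => by
      rw [(e2 i (Finset.ne_of_mem_erase hi) t ht).1, (e2 i (Finset.ne_of_mem_erase hi) t ht).2]

theorem IsResponse.update_smul {f : Fin 3 → SourceSpace T (Metric.ball (0 : R3) ρ) s}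
    {j : Fin 3} {c : ℂ} {x : SourceSpace T (Metric.ball (0 : R3) ρ) s} [DecidableEq (Fin 3)]
    (hT : 0 < T) (hV : Continuous V) {u v : Fin 3 → ℝ → L2R3} {w z : ℝ → L2R3}
    (hx : IsResponse V h (Function.update f j x) u w)
    (hcx : IsResponse V h (Function.update f j (c • x)) v z) :
    ∀ t ∈ Ioo 0 T, z t = c • w t := by
  have e1 : ∀ t ∈ Ioo 0 T, v j t = c • u j t := fun t ht => by
    have a1 := hx.wave j
    have a3 := hcx.wave j
    rw [Function.update_self] at a1 a3
    refine a3.unique hT hV ((a1.smul c).congr fun t ht => ?_) ht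
    rw [src_smul]
    exact Lp.coeFn_smul _ _
  have e2 : ∀ i ≠ j, ∀ t ∈ Ioo 0 T, v i t = u i t := fun i hi t ht => by
    have a1 := hx.wave i
    have a3 := hcx.wave i
    rw [Function.update_of_ne hi] at a1 a3
    exact a3.unique hT hV a1 ht
  intro t ht
  refine hcx.prod.unique hT hV ((hx.prod.smul c).congr fun t ht => ?_) ht
  filter_upwards [Lp.coeFn_smul c (u j t)] with x hx
  rw [← Finset.mul_prod_erase _ _ (Finset.mem_univ j),
    ← Finset.mul_prod_erase _ (fun i => u i t x) (Finset.mem_univ j), e1 t ht, hx, Pi.smul_apply,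
    smul_eq_mul, Finset.prod_congr rfl fun i hi => by rw [e2 i (Finset.ne_of_mem_erase hi) t ht]]
  ring

/-- Waves in the sense of distributions form a response. As the source of the last wave must be a
curve in `L²`, this compares them with a response for which that is known. -/
theorem AreGeneratedWaves.isResponse (hT : 0 < T) (hs : 4 ≤ s) (hV : ContDiff ℝ ∞ V)
    {f : Fin 3 → SourceSpace T (Metric.ball (0 : R3) ρ) s} {u : Fin 3 → ℝ → L2R3} {w : ℝ → L2R3}
    (hr : IsResponse V h f u w) {G : ℝ → L2R3} {C : ℝ} (hG : BddCurve T G C)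
    (hGe : ∀ t ∈ Ioo 0 T, ∀ᵐ x ∂leb3, h (t, x) * ∏ j, u j t x = G t x)
    {p : Fin 3 → WaveSpace T univ s} {q : WaveSpace T univ s} (hp : AreGeneratedWaves V h f p q) :
    IsResponse V h f (fun j => curve (p j).1) (curve q.1) := by
  have h1 : ∀ j, StrongSol T V (fun t => src (f j) t) (curve (p j).1) := fun j => by
    obtain ⟨C, hC⟩ := (p j).2
    obtain ⟨D, hD⟩ := (f j).1.2
    exact StrongSol.of_isWaveSolution hT hV (hC.reg.of_le (by omega)) (reg_src (f j) hD).bdd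
      (fun t ht => extendZero_of_notMem _ ht) (fun t ht => extendZero_of_notMem _ ht)
      (fun t ht => .of_forall fun x => extendZero_univ _ ht x) (fun t ht => ae_src (f j) ht) (hp.1 j)
  have h2 : ∀ t ∈ Ioo 0 T, ∀ j, curve (p j).1 t = u j t := fun t ht j =>
    (h1 j).unique hT hV.continuous (hr.wave j) ht
  refine ⟨h1, ?_⟩
  obtain ⟨C, hC⟩ := q.2
  refine (StrongSol.of_isWaveSolution hT hV (hC.reg.of_le (by omega)) hG
      (fun t ht => extendZero_of_notMem _ ht) (fun t ht x => by
        rw [extendZero_of_notMem _ ht, zero_mul, zero_mul, mul_zero])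
      (fun t ht => .of_forall fun x => extendZero_univ _ ht x) (fun t ht => ?_) hp.2).congr
        fun t ht => ?_
  · filter_upwards [hGe t ht] with x hx
    rw [extendZero_univ _ ht, extendZero_univ _ ht, extendZero_univ _ ht, h2 t ht, h2 t ht, h2 t ht,
      ← hx, Fin.prod_univ_three]
  · filter_upwards [hGe t ht] with x hx
    simp only [h2 t ht]
    exact hx

/-- The curves of a response solve their equations in the sense of distributions. -/
theorem IsResponse.areGeneratedWaves (hT : 0 < T) (hV : ContDiff ℝ ∞ V)
    {f : Fin 3 → SourceSpace T (Metric.ball (0 : R3) ρ) s} {u : Fin 3 → ℝ → L2R3} {w : ℝ → L2R3}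
    (hr : IsResponse V h f u w) {G : ℝ → L2R3} {C : ℝ} (hG : BddCurve T G C)
    (hGe : ∀ t ∈ Ioo 0 T, ∀ᵐ x ∂leb3, h (t, x) * ∏ j, u j t x = G t x)
    {p : Fin 3 → WaveSpace T univ s} {q : WaveSpace T univ s}
    (hp : ∀ j, (p j).1 = fun t : Ioo 0 T => u j t) (hq : q.1 = fun t : Ioo 0 T => w t) :
    AreGeneratedWaves V h f p q := by
  have h2 : ∀ t ∈ Ioo 0 T, ∀ j, curve (p j).1 t = u j t := fun t ht j => by
    rw [hp, curve_of_mem _ ht]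
  refine ⟨fun j => ?_, ?_⟩
  · obtain ⟨D, hD⟩ := (f j).1.2
    refine (hr.wave j).isWaveSolution hT hV (reg_src (f j) hD).bdd
      (fun t ht => extendZero_of_notMem _ ht) (fun t ht => extendZero_of_notMem _ ht)
      (fun t ht => .of_forall fun x => ?_) (fun t ht => ae_src (f j) ht)
    rw [extendZero_univ _ ht, h2 t ht]
  · refine (hr.prod.congr fun t ht => ?_).isWaveSolution hT hV hG
      (fun t ht => extendZero_of_notMem _ ht) (fun t ht x => by
        rw [extendZero_of_notMem _ ht, zero_mul, zero_mul, mul_zero])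
      (fun t ht => .of_forall fun x => ?_) (fun t ht => ?_)
    · filter_upwards [hGe t ht] with x hx
      exact hx.symm
    · rw [extendZero_univ _ ht, hq, curve_of_mem _ ht]
    · filter_upwards [hGe t ht] with x hx
      rw [extendZero_univ _ ht, extendZero_univ _ ht, extendZero_univ _ ht, h2 t ht, h2 t ht, h2 t ht,
        ← hx, Fin.prod_univ_three]

end

end

theorem mainTheorem5 (T ρ : ℝ) (hT : 0 < T) (hρ : 0 < ρ) (s : ℕ) (hs : 4 ≤ s)
    (V : ℝ × R3 → ℝ) (hV : ContDiff ℝ ∞ V)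
    (h : ℝ × R3 → ℂ) (hh : ContDiff ℝ ∞ h) (hh0 : ∀ z, h z ≠ 0) :
    ∃ A : MultilinearMap ℂ (fun _ : Fin 3 => SourceSpace T (Metric.ball (0 : R3) ρ) s)
        (WaveSpace T (Metric.ball (0 : R3) ρ) s),
      (∀ f : Fin 3 → SourceSpace T (Metric.ball (0 : R3) ρ) s,
        (∃! p : (Fin 3 → WaveSpace T univ s) × WaveSpace T univ s, AreGeneratedWaves V h f p.1 p.2) ∧
        ∀ u w, AreGeneratedWaves V h f u w → IsRestriction w.1 (A f).1) ∧
      BddAbove (unitValues A) ∧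
      ∀ f : Fin 3 → SourceSpace T (Metric.ball (0 : R3) ρ) s,
        waveNorm (A f) ≤ trilinearOpNorm A * ∏ j, waveNorm (f j).1 := by
  obtain ⟨K, hK, hex⟩ := exists_isResponse (ρ := ρ) hT hs hV hh
  choose u w hr hu hG hw using hex
  choose G D hD hGe using hG
  obtain ⟨N, hN, hNb⟩ := exists_hBound (Metric.isOpen_ball (x := (0 : R3)) (ε := ρ)).measurableSet T s
  obtain ⟨N', -, hNb'⟩ := exists_hBound MeasurableSet.univ T s
  -- `A f` is the restriction to the ball of the wave `w f` chosen for the sources `f`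
  have hwb : ∀ f (C : Fin 3 → ℝ), (∀ j, HBound T (Metric.ball (0 : R3) ρ) s (f j).1.1 (C j)) →
      HBound T (Metric.ball (0 : R3) ρ) s (fun t => restrictL2 (Metric.ball (0 : R3) ρ) (w f t))
        (N * K * ∏ j, C j) := fun f C hC => by
    rw [mul_assoc]
    exact hNb _ _ (hw f C hC)
  have hwr : ∀ f, ∃ C, Reg T s (w f) C := fun f => by
    choose C hC using fun j => (f j).1.2
    exact ⟨_, hw f C hC⟩
  let A : MultilinearMap ℂ (fun _ : Fin 3 => SourceSpace T (Metric.ball (0 : R3) ρ) s)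
      (WaveSpace T (Metric.ball (0 : R3) ρ) s) :=
    { toFun := fun f => ⟨fun t => restrictL2 (Metric.ball (0 : R3) ρ) (w f t), by
        obtain ⟨C, hC⟩ := hwr f
        exact ⟨_, hNb _ _ hC⟩⟩
      map_update_add' := fun f j x y => by
        refine Subtype.ext (funext fun t => ?_)
        change restrictL2 _ _ = restrictL2 _ _ + restrictL2 _ _
        rw [← map_add, IsResponse.update_add hT hV.continuous (hr _) (hr _) (hr _) t t.2]
      map_update_smul' := fun f j c x => by
        refine Subtype.ext (funext fun t => ?_)
        change restrictL2 _ _ = c • restrictL2 _ _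
        rw [← map_smul, IsResponse.update_smul hT hV.continuous (hr _) (hr _) t t.2] }
  refine ⟨A, fun f => ⟨?_, fun p q hpq t => ?_⟩,
    bounded_of_hBound A hwb (mul_nonneg hN hK)⟩
  · have hus : ∀ j, (fun t : Ioo 0 T => u f j t) ∈ WaveSpace T univ s := fun j => by
      obtain ⟨C, hC⟩ := hu f j
      have := hNb' _ _ hC
      simp only [restrictL2_univ] at this
      exact ⟨_, this⟩
    have hws : (fun t : Ioo 0 T => w f t) ∈ WaveSpace T univ s := by
      obtain ⟨C, hC⟩ := hwr f
      have := hNb' _ _ hC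
      simp only [restrictL2_univ] at this
      exact ⟨_, this⟩
    refine ⟨(fun j => ⟨_, hus j⟩, ⟨_, hws⟩), (hr f).areGeneratedWaves hT hV (hD f).bdd (hGe f)
      (fun _ => rfl) rfl, fun p hp => ?_⟩
    have h1 := (AreGeneratedWaves.isResponse hT hs hV (hr f) (hD f).bdd (hGe f) hp).unique_wave hT
      hV.continuous (hr f)
    refine Prod.ext (funext fun j => Subtype.ext (funext fun t => ?_))
      (Subtype.ext (funext fun t => ?_))
    · exact (curve_coe _ t).symm.trans ((h1 t t.2).1 j)
    · exact (curve_coe _ t).symm.trans (h1 t t.2).2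
  · have h1 := (AreGeneratedWaves.isResponse hT hs hV (hr f) (hD f).bdd (hGe f) hpq).unique_wave hT
      hV.continuous (hr f)
    have h2 : q.1 t = w f t := (curve_coe _ t).symm.trans (h1 t t.2).2
    rw [h2]
    exact coe_restrictL2 _ _
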